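/- **Setting.** Let $p>3$ be a prime, $k$ an algebraically closed field of characteristic $p$, $W=W(k)$ its ring of Witt vectors with Frobenius $\sigma$, $K=W[1/p]$, $A_0=k[[t_1,\dots,t_n]]$, $A=W[[t_1,\dots,t_n]]$. Let $\Omega^1=\bigoplus_j A\,dt_j$. A *lift of Frobenius* is a ring endomorphism $\phi$ of $A$ with $\phi|_W=\sigma$ and $\phi(a)\equiv a^p \bmod p$. An *$F$-crystal* over $A_0$ is a finitely generated free $A$-module $H$ with an integrable connection $\nabla=\sum_j dt_j\otimes D_j$ such that $D_j^m\to 0$ $p$-adically, and, for every lift of Frobenius $\phi$, a horizontal $A$-linear map $F(\phi):\phi^*H\to H$ which is an isomorphism after inverting $p$, such that for all lifts $\phi,\psi$ and all $x\in H$ $$F(\phi)\phi^*x=\sum_{m\in\mathbb N^n}\Big(\prod_j\tfrac{(\phi(t_j)-\psi(t_j))^{m_j}}{m_j!}\Big)\,F(\psi)\psi^*(D_1^{m_1}\cdots D_n^{m_n}x).$$ It is a *unit* $F$-crystal if all $F(\phi)$ are isomorphisms. Put $H_0=H/pH$, let $\mathrm{Fil}_iH_0$ (resp. $\mathrm{Fil}^iH_0$)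 be the set of classes having a lift $y\in H$ with $p^iy\in\mathrm{Im}\,F(\phi)$ (resp. $F(\phi)\phi^*y\in p^iH$); these do not depend on $\phi$. $H$ is of *level $\le N$* if $\mathrm{Fil}_NH_0=H_0$ and $\mathrm{Fil}^{N+1}H_0=0$; it is *ordinary* if all $\mathrm{gr}_iH_0=\mathrm{Fil}_iH_0/\mathrm{Fil}_{i-1}H_0$ are free over $A_0$ (their ranks are the *Hodge numbers*) and $H_0=\mathrm{Fil}_iH_0\oplus\mathrm{Fil}^{i+1}H_0$ for all $i$. A *Hodge filtration* on $H$ is a decreasing filtration $H=\mathrm{Fil}^0H\supset\mathrm{Fil}^1H\supset\cdots$ by free submodules with $\mathrm{Fil}^iH\otimes_AA_0=\mathrm{Fil}^iH_0$ and $\nabla\mathrm{Fil}^iH\subset\Omega^1\otimes\mathrm{Fil}^{i-1}H$; an $F$-crystal with such a filtration is a *Hodge $F$-crystal*. For level $\le N$ it is *divisible* if for some $\phi$ one has $F(\phi)\phi^*\mathrm{Fil}^iH\subset p^iH$ for $0\le i\le N$. An *ordinary CY3 crystal* is a divisible ordinary Hodge $F$-crystal $H$ of level $\leq 3$ with Hodge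 numbers $1,h,h,1$ (for $i=0,1,2,3$), equipped with an alternating bilinear form $\langle\,,\rangle:H\times H\to A$ which is perfect (it induces an isomorphism $H\to\mathrm{Hom}_A(H,A)$) and satisfies $\langle\nabla x,y\rangle+\langle x,\nabla y\rangle=d\langle x,y\rangle$, $\langle F(\phi)\phi^*x,F(\phi)\phi^*y\rangle=p^3\phi(\langle x,y\rangle)$ for every lift $\phi$, $(\mathrm{Fil}^3H)^\perp=\mathrm{Fil}^1H$ and $(\mathrm{Fil}^2H)^\perp=\mathrm{Fil}^2H$. **Theorem.** Let $H$ be an ordinary CY3 crystal. There is a filtration $0=U_{-1}\subset U_0\subset U_1\subset\cdots$ of $H$ by sub-$F$-crystals with $U_i\otimes_AA_0=\mathrm{Fil}_iH_0$ and $U_i/U_{i-1}\simeq V_i(-i)$ for a unit $F$-crystal $V_i$ (where $(-i)$ means that $F$ is multiplied by $p^i$). For any such filtration put $H^i=U_i\cap\mathrm{Fil}^iH$. Then there are an $A$-basis $e_0,\dots,e_{2h+1}$ of $H$ with $$e_0\in H^0,\quad e_1,\dots,e_h\in H^1,\quad e_{h+1},\dots,e_{2h}\in H^2,\quad e_{2h+1}\in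 H^3$$ and Gram matrix $$(\langle e_i,e_j\rangle)=\begin{pmatrix}0&0&0&-1\\0&0&I_h&0\\0&-I_h&0&0\\1&0&0&0\end{pmatrix},$$ and an invertible matrix $\mathcal T$ over $K[[t_1,\dots,t_n]]$ such that the matrix of $\nabla$ in this basis is $\mathcal T^{-1}d\mathcal T$ and, for every lift of Frobenius $\psi$, the matrix of $F(\psi)\psi^*$ is $\mathcal T^{-1}P\,\psi(\mathcal T)$ with $P=\mathrm{diag}(1,pI_h,p^2I_h,p^3)$. (In both cases the coordinates of the image of the $j$-th basis vector form the $j$-th column. For $f=\sum a_mt^m\in K[[t]]$, $\psi(f)$ denotes $\sum\sigma(a_m)\psi(t)^m$; it is part of the assertion that this series converges for the entries of $\mathcal T$, coefficientwise in the $p$-adic topology of $K$.) Moreover $$\mathcal T=\begin{pmatrix}1&\tau_{23}^{\top}&0&0\\0&I_h&0&0\\0&0&I_h&\tau_{23}\\0&0&0&1\end{pmatrix}\begin{pmatrix}1&0&-\tau_{13}^{\top}&Z\\0&I_h&\tau_{12}&\tau_{13}\\0&0&I_h&0\\0&0&0&1\end{pmatrix}$$ with $Z,\tau_{23},\tau_{13},\tau_{12}$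 matrices over $K[[t_1,\dots,t_n]]$ of sizes $1\times1$, $h\times1$, $h\times1$, $h\times h$. If in addition the $A$-linear (Kodaira–Spencer) map $\bigoplus_jA\,\partial/\partial t_j\to\mathrm{Hom}_A(H^3,H^2)$ induced by $\nabla$ (with $H^3=\mathrm{Fil}^3H$, $H^2\simeq\mathrm{Fil}^2H/\mathrm{Fil}^3H$) is an isomorphism, then $n=h$; writing $\tau_{23}=(\tau_1,\dots,\tau_h)^{\top}$, the matrix $(\partial\tau_i/\partial t_j)$ is invertible over $K[[t_1,\dots,t_h]]$; and, with $\partial/\partial\tau_i=\sum_j(\partial t_j/\partial\tau_i)\,\partial/\partial t_j$ defined by the inverse matrix $(\partial t_j/\partial\tau_i)$, $$\tau_{13}=-\tfrac12\Big(\frac{\partial Z}{\partial\tau_1},\dots,\frac{\partial Z}{\partial\tau_h}\Big)^{\top},\qquad\tau_{12}=-\tfrac12\Big(\frac{\partial^2Z}{\partial\tau_i\partial\tau_j}\Big)_{1\le i,j\le h}.$$ -/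

import Mathlib

universe u v

noncomputable section

namespace CY3

/-! ### Coefficient rings -/

/-- `A = W(k)[[t_1, …, t_n]]`. -/
abbrev PS (p : ℕ) [Fact p.Prime] (k : Type u) [Field k] (n : ℕ) : Type u :=
  MvPowerSeries (Fin n) (WittVector p k)

/-- `K[[t_1, …, t_n]]`, where `K = Frac W(k)` (which is `W(k)[1/p]` for perfect `k`). -/
abbrev KPS (p : ℕ) [Fact p.Prime] (k : Type u) [Field k] (n : ℕ) : Type u :=
  MvPowerSeries (Fin n) (FractionRing (WittVector p k))

section Rings

variable (p : ℕ) [Fact p.Prime] (k : Type u) [Field k] (n : ℕ)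

/-- The inclusion `W(k)[[t]] → K[[t]]`. -/
def toKPS : PS p k n →+* KPS p k n :=
  MvPowerSeries.map (algebraMap (WittVector p k) (FractionRing (WittVector p k)))

/-- Reduction modulo `p`, `W(k)[[t]] → k[[t]]`. -/
def reduce : PS p k n →+* MvPowerSeries (Fin n) k :=
  MvPowerSeries.map (WittVector.constantCoeff : WittVector p k →+* k)

/-- The derivation `∂/∂t_j` of `W(k)[[t]]`. -/
def dA (j : Fin n) (a : PS p k n) : PS p k n := MvPowerSeries.pderiv (WittVector p k) j a

/-- The derivation `∂/∂t_j` of `K[[t]]`. -/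
def dK (j : Fin n) (a : KPS p k n) : KPS p k n :=
  MvPowerSeries.pderiv (FractionRing (WittVector p k)) j a

/-- A lift of Frobenius: a ring endomorphism of `W(k)[[t]]` that restricts to the Witt vector
Frobenius on `W(k)` and reduces modulo `p` to the `p`-th power map of `k[[t]]`. -/
structure FrobLift where
  hom : PS p k n →+* PS p k n
  map_C : ∀ w : WittVector p k,
    hom (MvPowerSeries.C w) = MvPowerSeries.C (WittVector.frobenius w)
  reduce_hom : ∀ a : PS p k n, reduce p k n (hom a) = reduce p k n a ^ p

/-- The standard lift `∑ a_m t^m ↦ ∑ σ(a_m) t^{pm}`. -/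
def stdLift [CharP k p] : FrobLift p k n where
  hom := (MvPowerSeries.expand p (Fact.out : p.Prime).ne_zero).toRingHom.comp
    (MvPowerSeries.map (WittVector.frobenius : WittVector p k →+* WittVector p k))
  map_C w := by
    simp only [RingHom.comp_apply, MvPowerSeries.map_C]
    exact MvPowerSeries.expand_C p (Fact.out : p.Prime).ne_zero _
  reduce_hom a := by
    have : ExpChar k p := ExpChar.prime Fact.out
    rw [← MvPowerSeries.map_frobenius_expand p (Fact.out : p.Prime).ne_zero]
    ext m
    simp only [reduce, RingHom.comp_apply, AlgHom.toRingHom_eq_coe, RingHom.coe_coe,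
      MvPowerSeries.map_expand]
    congr 2
    ext m
    simp only [MvPowerSeries.coeff_map, WittVector.constantCoeff_apply, frobenius_def,
      WittVector.coeff_frobenius_charP]

end Rings

/-! ### `p`-adic sums -/

/-- The family `f` in the abelian group `M` is (unconditionally) summable to `s` for the `p`-adic
topology of the subgroup `L` of `M`, i.e. for the topology in which the subgroups `p ^ N L` are a
basis of neighbourhoods of `0`. -/
def HasPadicSum (p : ℕ) {ι M : Type*} [AddCommGroup M] (L : AddSubgroup M) (f : ι → M) (s : M) :
    Prop :=
  ∀ N : ℕ, ∃ S₀ : Finset ι, ∀ S : Finset ι, S₀ ⊆ S →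
    ∃ y ∈ L, s - ∑ i ∈ S, f i = p ^ N • y

section Extension

variable {p : ℕ} [Fact p.Prime] {k : Type u} [Field k] [CharP k p] [PerfectRing k p] {n : ℕ}

/-- `g = ψ(f)` for a lift of Frobenius `ψ` and `f = ∑ a_m t^m ∈ K[[t]]`, i.e. the series
`∑_m σ(a_m) ψ(t)^m` converges to `g`, coefficient by coefficient for the `p`-adic topology of `K`.
The `ψ(t_j)` may have a non-zero constant term (divisible by `p`), so convergence is a genuine
condition on `f`; if `g` exists it is unique, and it is the usual `ψ(f)` if `f ∈ W(k)[[t]]`. -/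
def IsFrobImage (ψ : FrobLift p k n) (f g : KPS p k n) : Prop :=
  ∀ d : Fin n →₀ ℕ,
    HasPadicSum p (algebraMap (WittVector p k) (FractionRing (WittVector p k))).toAddMonoidHom.range
      (fun m : Fin n →₀ ℕ =>
        WittVector.FractionRing.frobeniusRingHom p k (MvPowerSeries.coeff m f) *
          MvPowerSeries.coeff d (toKPS p k n (∏ j, ψ.hom (MvPowerSeries.X j) ^ m j)))
      (MvPowerSeries.coeff d g)

end Extension

/-! ### `F`-crystals -/

section Crystals

variable (p : ℕ) [Fact p.Prime] (k : Type u) [Field k] (n : ℕ)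

/-- An `F`-crystal over `k[[t_1, …, t_n]]` on the (finitely generated free) `W(k)[[t]]`-module `H`.

The module of (continuous) differentials of `W(k)[[t]]` over `W(k)` is free on `dt_1, …, dt_n`, so
a connection is given by its components `∇ = ∑ dt_j ⊗ D j`. An `A`-linear map `F(φ) : φ^*H → H` is
given by the `φ`-semilinear map `Φ φ = F(φ) ∘ φ^*` of `H`; the image of `F(φ)` is the `A`-span of
the image of `Φ φ`. -/
structure FCrystal (H : Type v) [AddCommGroup H] [Module (PS p k n) H]
    [Module.Free (PS p k n) H] [Module.Finite (PS p k n) H] where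
  /-- the components of the connection -/
  D : Fin n → AddMonoid.End H
  leibniz : ∀ (j : Fin n) (a : PS p k n) (x : H), D j (a • x) = dA p k n j a • x + a • D j x
  integrable : ∀ i j : Fin n, D i * D j = D j * D i
  /-- `(D j) ^ m → 0` in the `p`-adic topology -/
  nilpotent : ∀ (j : Fin n) (N : ℕ), ∃ M : ℕ, ∀ m ≥ M, ∀ x : H, ∃ y : H, (D j ^ m) x = p ^ N • y
  /-- the maps `F(φ) ∘ φ^*` -/
  Φ : (φ : FrobLift p k n) → H →ₛₗ[φ.hom] H
  /-- `∇ ∘ Φ φ = (φ ⊗ Φ φ) ∘ ∇`, with `φ(dt_j) = d(φ(t_j)) = ∑ ∂(φ(t_j))/∂t_i dt_i` -/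
  horizontal : ∀ (φ : FrobLift p k n) (i : Fin n) (x : H),
    D i (Φ φ x) = ∑ j, dA p k n i (φ.hom (MvPowerSeries.X j)) • Φ φ (D j x)
  /-- `F(ψ) ∘ χ(φ, ψ) = F(φ)` for the Taylor isomorphism `χ(φ, ψ)`. The coefficient `c m` is
  `∏ j, (φ(t_j) - ψ(t_j)) ^ m_j / m_j!`, an element of the torsion free ring `W(k)[[t]]`. -/
  taylor : ∀ φ ψ : FrobLift p k n, ∃ c : (Fin n →₀ ℕ) → PS p k n,
    (∀ m, ((∏ j, (m j).factorial : ℕ) : PS p k n) * c m =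
      ∏ j, (φ.hom (MvPowerSeries.X j) - ψ.hom (MvPowerSeries.X j)) ^ m j) ∧
    ∀ x : H, HasPadicSum p (⊤ : AddSubgroup H)
      (fun m => c m • Φ ψ ((List.ofFn fun j => D j ^ m j).prod x)) (Φ φ x)
  /-- `F(φ)` is an isomorphism after inverting `p`: its cokernel is killed by a power of `p`
  (injectivity is then automatic, since `φ^*H` and `H` are free of the same finite rank). -/
  isogeny : ∀ φ : FrobLift p k n, ∃ N : ℕ, ∀ x : H,
    p ^ N • x ∈ Submodule.span (PS p k n) (Set.range (Φ φ))

end Crystals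

namespace FCrystal

variable {p : ℕ} [Fact p.Prime] {k : Type u} [Field k] {n : ℕ}
variable {H : Type v} [AddCommGroup H] [Module (PS p k n) H]
  [Module.Free (PS p k n) H] [Module.Finite (PS p k n) H]

/-- The image of the linear map `F(φ) : φ^*H → H`. -/
def imF (C : FCrystal p k n H) (φ : FrobLift p k n) : Submodule (PS p k n) H :=
  Submodule.span (PS p k n) (Set.range (C.Φ φ))

/-- A unit `F`-crystal: every `F(φ)` is surjective, equivalently (equal finite ranks) an
isomorphism. -/
def IsUnit (C : FCrystal p k n H) : Prop := ∀ φ : FrobLift p k n, C.imF φ = ⊤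

end FCrystal

section Reduction

variable (p : ℕ) [Fact p.Prime] (k : Type u) [Field k] (n : ℕ)
variable (H : Type v) [AddCommGroup H] [Module (PS p k n) H]

/-- The submodule `p ^ i H` of `H`. -/
def pPow (i : ℕ) : Submodule (PS p k n) H :=
  LinearMap.range (LinearMap.lsmul (PS p k n) H ((p : PS p k n) ^ i))

/-- `H_0 = H ⊗ k[[t]]`, realised as `H / pH`. -/
abbrev H0 : Type v := H ⧸ pPow p k n H 1

variable {p k n H}

/-- `N ⊗ k[[t]] = N₀` for submodules `N ⊆ H` and `N₀ ⊆ H_0`: the natural map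
`N ⊗ k[[t]] = N / pN → H_0` is injective with image `N₀`. -/
def LiftsTo (N : Submodule (PS p k n) H) (N₀ : Submodule (PS p k n) (H0 p k n H)) : Prop :=
  N.map (pPow p k n H 1).mkQ = N₀ ∧ ∀ x ∈ N, x ∈ pPow p k n H 1 → ∃ y ∈ N, x = p • y

end Reduction

namespace FCrystal

variable {p : ℕ} [Fact p.Prime] {k : Type u} [Field k] [CharP k p] {n : ℕ}
variable {H : Type v} [AddCommGroup H] [Module (PS p k n) H]
  [Module.Free (PS p k n) H] [Module.Finite (PS p k n) H]

/-- The conjugate filtration `Fil_i H_0`: the classes that have a lift `y ∈ H` with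
`p ^ i y ∈ Im F(φ)`. It does not depend on the lift of Frobenius `φ`; the standard one is used. -/
def conjFil (C : FCrystal p k n H) (i : ℕ) : Submodule (PS p k n) (H0 p k n H) :=
  ((C.imF (stdLift p k n)).comap (LinearMap.lsmul (PS p k n) H ((p : PS p k n) ^ i))).map
    (pPow p k n H 1).mkQ

/-- `Fil_{i-1} H_0`, with `Fil_{-1} H_0 = 0`. -/
def conjFilPred (C : FCrystal p k n H) : ℕ → Submodule (PS p k n) (H0 p k n H)
  | 0 => ⊥
  | i + 1 => C.conjFil i

/-- The Hodge filtration `Fil^i H_0`: the classes that have a lift `y ∈ H` with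
`F(φ) φ^* y ∈ p ^ i H`. It does not depend on `φ`; the standard lift is used. -/
def hodgeFil (C : FCrystal p k n H) (i : ℕ) : Submodule (PS p k n) (H0 p k n H) :=
  ((pPow p k n H i).comap (C.Φ (stdLift p k n))).map (pPow p k n H 1).mkQ

/-- `gr_i H_0 = Fil_i H_0 / Fil_{i-1} H_0` is free of rank `r` over `k[[t]] = W(k)[[t]] / (p)`;
`r` is the `i`-th Hodge number. -/
def HasHodgeNumber (C : FCrystal p k n H) (i r : ℕ) : Prop :=
  Nonempty ((C.conjFil i ⧸ (C.conjFilPred i).submoduleOf (C.conjFil i)) ≃ₗ[PS p k n]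
    (Fin r → PS p k n ⧸ Ideal.span {(p : PS p k n)}))

/-- `H` is of level `≤ N`: `Fil_N H_0 = H_0` and `Fil^{N+1} H_0 = 0`. -/
def LevelLE (C : FCrystal p k n H) (N : ℕ) : Prop :=
  C.conjFil N = ⊤ ∧ C.hodgeFil (N + 1) = ⊥

/-- `H` is ordinary: `gr_• H_0` is free and `H_0 = Fil_i H_0 ⊕ Fil^{i+1} H_0` for all `i`. -/
def IsOrdinary (C : FCrystal p k n H) : Prop :=
  (∀ i, ∃ r, C.HasHodgeNumber i r) ∧ ∀ i, IsCompl (C.conjFil i) (C.hodgeFil (i + 1))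

/-- `U_{i-1}`, with `U_{-1} = 0`. -/
def pred (U : ℕ → Submodule (PS p k n) H) : ℕ → Submodule (PS p k n) H
  | 0 => ⊥
  | i + 1 => U i

/-- The filtration `0 = U_{-1} ⊆ U_0 ⊆ U_1 ⊆ …` of `H` by sub-`F`-crystals such that
`U_i ⊗ k[[t]] = Fil_i H_0` and `U_i / U_{i-1} ≃ V_i(-i)` with `V_i` a unit `F`-crystal.
The isomorphism is given by a surjection `π : U_i → V_i` with kernel `U_{i-1}`, compatible with the
connections and such that `F` on `U_i` corresponds to `p ^ i F` on `V_i`. -/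
structure IsUnitRootFiltration (C : FCrystal p k n H) (U : ℕ → Submodule (PS p k n) H) : Prop where
  mono : Monotone U
  free : ∀ i, Module.Free (PS p k n) (U i)
  finite : ∀ i, Module.Finite (PS p k n) (U i)
  stable_D : ∀ i j, ∀ x ∈ U i, C.D j x ∈ U i
  stable_Φ : ∀ i φ, ∀ x ∈ U i, C.Φ φ x ∈ U i
  lifts : ∀ i, LiftsTo (U i) (C.conjFil i)
  graded : ∀ i, ∃ (r : ℕ) (V : FCrystal p k n (Fin r → PS p k n))
    (π : U i →ₗ[PS p k n] (Fin r → PS p k n)),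
    V.IsUnit ∧ Function.Surjective π ∧
    (∀ x : U i, π x = 0 ↔ (x : H) ∈ pred U i) ∧
    (∀ (j : Fin n) (x y : U i), (y : H) = C.D j x → π y = V.D j (π x)) ∧
    (∀ (φ : FrobLift p k n) (x y : U i), (y : H) = C.Φ φ x → π y = p ^ i • V.Φ φ (π x))

end FCrystal

/-! ### Hodge `F`-crystals -/

section Hodge

variable {p : ℕ} [Fact p.Prime] {k : Type u} [Field k] [CharP k p] {n : ℕ}
variable {H : Type v} [AddCommGroup H] [Module (PS p k n) H]
  [Module.Free (PS p k n) H] [Module.Finite (PS p k n) H]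

/-- A Hodge filtration on the `F`-crystal `H` (making it a Hodge `F`-crystal): a filtration by free
submodules that lifts the Hodge filtration of `H_0` and satisfies Griffiths transversality. -/
structure HodgeFiltration (C : FCrystal p k n H) where
  fil : ℕ → Submodule (PS p k n) H
  fil_zero : fil 0 = ⊤
  anti : Antitone fil
  free : ∀ i, Module.Free (PS p k n) (fil i)
  lifts : ∀ i, LiftsTo (fil i) (C.hodgeFil i)
  transversal : ∀ i j, ∀ x ∈ fil (i + 1), C.D j x ∈ fil i

namespace HodgeFiltration

variable {C : FCrystal p k n H}

/-- Divisibility, for an `F`-crystal of level `≤ N`: for some lift of Frobenius `φ` one has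
`F(φ) φ^* Fil^i H ⊆ p ^ i H` for `0 ≤ i ≤ N`. -/
def IsDivisible (𝓕 : HodgeFiltration C) (N : ℕ) : Prop :=
  ∃ φ : FrobLift p k n, ∀ i ≤ N, ∀ x ∈ 𝓕.fil i, C.Φ φ x ∈ pPow p k n H i

/-- The graded piece `gr^i H = Fil^i H / Fil^{i+1} H`. -/
abbrev gr (𝓕 : HodgeFiltration C) (i : ℕ) : Type v :=
  𝓕.fil i ⧸ (𝓕.fil (i + 1)).submoduleOf (𝓕.fil i)

/-- The linear map `Fil^{i+1} H → gr^i H`, `x ↦ ∑ v_j D_j x`, for the vector field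
`∑ v_j ∂/∂t_j`. -/
def ksMap (𝓕 : HodgeFiltration C) (i : ℕ) (v : Fin n → PS p k n) :
    𝓕.fil (i + 1) →ₗ[PS p k n] 𝓕.gr i where
  toFun x := ∑ j, v j •
    ((𝓕.fil (i + 1)).submoduleOf (𝓕.fil i)).mkQ ⟨C.D j x, 𝓕.transversal i j x x.2⟩
  map_add' x y := by
    rw [← Finset.sum_add_distrib]
    refine Finset.sum_congr rfl fun j _ => ?_
    rw [← smul_add, ← map_add]
    congr 2
    ext
    simp
  map_smul' a x := by
    rw [RingHom.id_apply, Finset.smul_sum]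
    refine Finset.sum_congr rfl fun j _ => ?_
    rw [smul_comm a]
    refine congrArg (v j • ·) ?_
    rw [← map_smul]
    rw [← sub_eq_zero, ← map_sub, Submodule.mkQ_apply, Submodule.Quotient.mk_eq_zero]
    change C.D j ((a • x : 𝓕.fil (i + 1)) : H) - a • C.D j x ∈ 𝓕.fil (i + 1)
    have : dA p k n j a • (x : H) ∈ 𝓕.fil (i + 1) := Submodule.smul_mem _ _ x.2
    simpa [C.leibniz] using this

/-- The Kodaira–Spencer map `T → Hom(H^3, H^2)` induced by `∇`, with
`T = ⊕ A ∂/∂t_j` the module of vector fields, `H^3 = Fil^3 H` and `H^2 = Fil^2 H / Fil^3 H`. -/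
def kodairaSpencer (𝓕 : HodgeFiltration C) :
    (Fin n → PS p k n) →ₗ[PS p k n] (𝓕.fil 3 →ₗ[PS p k n] 𝓕.gr 2) where
  toFun v := 𝓕.ksMap 2 v
  map_add' v w := by
    ext1 x
    simp [ksMap, add_smul, Finset.sum_add_distrib]
  map_smul' a v := by
    ext1 x
    simp [ksMap, mul_smul, Finset.smul_sum]

end HodgeFiltration

/-! ### Ordinary CY3 crystals -/

/-- The `F`-crystal `C` on `H` with Hodge filtration `𝓕` and bilinear form `B` is an ordinary CY3
crystal with Hodge numbers `1, h, h, 1`. -/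
structure IsOrdinaryCY3 (C : FCrystal p k n H) (𝓕 : HodgeFiltration C)
    (B : LinearMap.BilinForm (PS p k n) H) (h : ℕ) : Prop where
  ordinary : C.IsOrdinary
  level : C.LevelLE 3
  divisible : 𝓕.IsDivisible 3
  hodge_zero : C.HasHodgeNumber 0 1
  hodge_one : C.HasHodgeNumber 1 h
  hodge_two : C.HasHodgeNumber 2 h
  hodge_three : C.HasHodgeNumber 3 1
  alternating : B.IsAlt
  /-- non-degenerate over the ring `W(k)[[t]]`: `H → Hom(H, W(k)[[t]])` is an isomorphism -/
  nondegenerate : Function.Bijective B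
  form_D : ∀ (j : Fin n) (x y : H), B (C.D j x) y + B x (C.D j y) = dA p k n j (B x y)
  form_Φ : ∀ (φ : FrobLift p k n) (x y : H),
    B (C.Φ φ x) (C.Φ φ y) = (p : PS p k n) ^ 3 * φ.hom (B x y)
  riemann_three : B.orthogonal (𝓕.fil 3) = 𝓕.fil 1
  riemann_two : B.orthogonal (𝓕.fil 2) = 𝓕.fil 2

end Hodge

/-! ### Block matrices of type `(1, h, h, 1)` -/

/-- The index set `0 | 1, …, h | h+1, …, 2h | 2h+1`, by blocks. -/
abbrev Idx (h : ℕ) : Type := Unit ⊕ Fin h ⊕ Fin h ⊕ Unit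

/-- The number `0, 1, 2, 3` of the block to which an index belongs. -/
def deg {h : ℕ} : Idx h → ℕ
  | .inl _ => 0
  | .inr (.inl _) => 1
  | .inr (.inr (.inl _)) => 2
  | .inr (.inr (.inr _)) => 3

section Blocks

variable {R : Type*} [CommRing R] {h : ℕ}

/-- The Gram matrix `(0 0 0 -1 | 0 0 I 0 | 0 -I 0 0 | 1 0 0 0)`. -/
def gram : Matrix (Idx h) (Idx h) R := Matrix.of fun a b =>
  match a, b with
  | .inl _, .inr (.inr (.inr _)) => -1
  | .inr (.inl i), .inr (.inr (.inl j)) => if i = j then 1 else 0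
  | .inr (.inr (.inl i)), .inr (.inl j) => if i = j then -1 else 0
  | .inr (.inr (.inr _)), .inl _ => 1
  | _, _ => 0

/-- `diag(1, pI, p²I, p³)`. -/
def diagP (p : ℕ) : Matrix (Idx h) (Idx h) R := Matrix.diagonal fun a => (p : R) ^ deg a

/-- `(1 x* 0 0 | 0 I 0 0 | 0 0 I x | 0 0 0 1)`. -/
def leftFactor (x : Fin h → R) : Matrix (Idx h) (Idx h) R := Matrix.of fun a b =>
  match a, b with
  | .inl _, .inl _ => 1
  | .inl _, .inr (.inl j) => x j
  | .inr (.inl i), .inr (.inl j) => if i = j then 1 else 0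
  | .inr (.inr (.inl i)), .inr (.inr (.inl j)) => if i = j then 1 else 0
  | .inr (.inr (.inl i)), .inr (.inr (.inr _)) => x i
  | .inr (.inr (.inr _)), .inr (.inr (.inr _)) => 1
  | _, _ => 0

/-- `(1 0 -y* z | 0 I w y | 0 0 I 0 | 0 0 0 1)`. -/
def rightFactor (y : Fin h → R) (w : Matrix (Fin h) (Fin h) R) (z : R) :
    Matrix (Idx h) (Idx h) R := Matrix.of fun a b =>
  match a, b with
  | .inl _, .inl _ => 1
  | .inl _, .inr (.inr (.inl j)) => -y j
  | .inl _, .inr (.inr (.inr _)) => z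
  | .inr (.inl i), .inr (.inl j) => if i = j then 1 else 0
  | .inr (.inl i), .inr (.inr (.inl j)) => w i j
  | .inr (.inl i), .inr (.inr (.inr _)) => y i
  | .inr (.inr (.inl i)), .inr (.inr (.inl j)) => if i = j then 1 else 0
  | .inr (.inr (.inr _)), .inr (.inr (.inr _)) => 1
  | _, _ => 0

end Blocks

section Matrices

variable {p : ℕ} [Fact p.Prime] {k : Type u} [Field k] {n h : ℕ}
variable {H : Type v} [AddCommGroup H] [Module (PS p k n) H]
  [Module.Free (PS p k n) H] [Module.Finite (PS p k n) H]

/-- The `dt_j`-component of the matrix of `∇` with respect to the basis `e`, with entries in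
`K[[t]]`: `D_j e_b = ∑_a M_{ab} e_a`. -/
def connMatrix (C : FCrystal p k n H) (e : Module.Basis (Idx h) (PS p k n) H) (j : Fin n) :
    Matrix (Idx h) (Idx h) (KPS p k n) :=
  Matrix.of fun a b => toKPS p k n (e.repr (C.D j (e b)) a)

/-- The matrix of `F(ψ) ψ^*` with respect to the basis `e`, with entries in `K[[t]]`:
`F(ψ) ψ^* e_b = ∑_a M_{ab} e_a`. -/
def frobMatrix (C : FCrystal p k n H) (e : Module.Basis (Idx h) (PS p k n) H)
    (ψ : FrobLift p k n) : Matrix (Idx h) (Idx h) (KPS p k n) :=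
  Matrix.of fun a b => toKPS p k n (e.repr (C.Φ ψ (e b)) a)

/-- The Jacobian matrix `(∂τ_i/∂t_j)`. -/
def jacobian (τ : Fin h → KPS p k n) : Matrix (Fin h) (Fin n) (KPS p k n) :=
  Matrix.of fun i j => dK p k n j (τ i)

/-- The operator `∂/∂τ_i = ∑_j (∂t_j/∂τ_i) ∂/∂t_j`, where `G` is the inverse `(∂t_j/∂τ_i)` of the
Jacobian matrix of `τ`. -/
def dTau (G : Matrix (Fin n) (Fin h) (KPS p k n)) (i : Fin h) (f : KPS p k n) : KPS p k n :=
  ∑ j, G j i * dK p k n j f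

end Matrices

end CY3

end

noncomputable section

set_option linter.unusedSectionVars false

namespace CY3

/-! ### `p`-adic completeness -/

/-! The unit root filtration is built one slope at a time. Let U carry the slopes `< i` and be a
complement of Fil^i. Lifting a basis of gr_i H_0 to vectors v with p^i v in the image of F gives H =
U ⊕ ⟨v⟩ ⊕ Fil^{i+1}. Modulo U, the map p^{-i}F has in this decomposition a block matrix (a, pb; c,
pd) with a invertible, so it has an invariant graph over ⟨v⟩, the fixed point of a p-adic
contraction (`exists_invariant_graph`). Adjoining the graph to U is the next step (`exists_succ`).
The differential of the standard Frobenius lift is divisible by p, which forces the connection to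
preserve the pieces (`D_mem`). The Taylor formula, together with the p-adic closedness of
submodules, passes from the standard lift to all lifts (`Φ_mem_of_Φ_mem`).

For any such filtration U_i is a complement of Fil^{i+1}, so H is the direct sum of the H^i. The
pieces H^i and H^j are orthogonal unless i + j = 3: above 3 by the Riemann relations, below 3
because p^{i+j}⟨x, y⟩ comes from values p^3 φ⟨x', y'⟩ of the same kind, so that ⟨x, y⟩ is infinitely
p-divisible (`form_U`). Over an algebraically closed field a unit F-crystal has a basis of
horizontal, Frobenius-fixed vectors: this is Lang's theorem, lifted to W(k) and then to W(k)[[t]]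
(`exists_frame`). Such bases of gr_0 and gr_1, lifted to H^0 and H^1, and the dual bases of H^3 and
H^2 form the basis e. Griffiths transversality, stability of the U_i and horizontality on the graded
pieces leave only a degree -1 part of ∇, and the standard Frobenius is upper triangular with
diagonal p^deg (`exists_adapted_basis`).

At the origin the Frobenius matrix is diagonalized over K by a unipotent matrix, because σ - p^m is
surjective on K for m > 0; its injectivity makes that matrix symplectic. The rows are
Frobenius-eigenfunctionals ℓ on the fibre, and x ↦ ∑ ℓ(D^m x) t^m / m! extends each of them
horizontally. Linearity, the Frobenius relation, compatibility with the form and triangularity hold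
at the origin and spread to K[[t]] by uniqueness of solutions of formal differential systems
(`eq_zero_of_dK`). The values of these functionals on e are the entries of T. For an arbitrary lift
ψ the Taylor formula turns the series for ψ(T) into a rearrangement of a p-adically convergent
double series (`isFrobImage_taylorSeries`).

A unipotent symplectic T consists of blocks x, y, w, z with w symmetric (`exists_factors`), and the
last column of dT = T·∇ reads dy = w dx, dz = -2 y·dx, with dx the Kodaira–Spencer matrix. When that
matrix is invertible, x gives coordinates and y, w are -1/2 times the first and second derivatives
of z (`prepotential`). -/

/-- Every `p`-adic Cauchy sequence (with prescribed rate) of `M` converges. -/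
def PComplete (p : ℕ) (M : Type*) [AddCommGroup M] : Prop :=
  ∀ x : ℕ → M, (∀ m, ∃ z, x (m + 1) - x m = p ^ m • z) → ∃ y, ∀ m, ∃ z, y - x m = p ^ m • z

/-- The `p`-adic topology of `M` is separated. -/
def PSeparated (p : ℕ) (M : Type*) [AddCommGroup M] : Prop :=
  ∀ x : M, (∀ m, ∃ z, x = p ^ m • z) → x = 0

section Padic

variable {p : ℕ} {M : Type*} [AddCommGroup M]

theorem PComplete.pi {ι : Type*} (h : PComplete p M) : PComplete p (ι → M) := by
  intro x hx
  have (i : ι) : ∃ y, ∀ m, ∃ z, y - x m i = p ^ m • z := by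
    refine h (fun m => x m i) fun m => ?_
    obtain ⟨z, hz⟩ := hx m
    exact ⟨z i, congrFun hz i⟩
  choose y hy using this
  choose z hz using hy
  exact ⟨y, fun m => ⟨fun i => z i m, funext fun i => hz i m⟩⟩

theorem PSeparated.pi {ι : Type*} (h : PSeparated p M) : PSeparated p (ι → M) := by
  intro x hx
  funext i
  refine h _ fun m => ?_
  obtain ⟨z, hz⟩ := hx m
  exact ⟨z i, congrFun hz i⟩

theorem PComplete.matrix (ι κ : Type*) (h : PComplete p M) : PComplete p (Matrix ι κ M) :=
  h.pi.pi

theorem PSeparated.matrix (ι κ : Type*) (h : PSeparated p M) : PSeparated p (Matrix ι κ M) :=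
  h.pi.pi

/-- A map gaining one power of `p` on every congruence is a contraction: its iterates starting from
0 converge, and separatedness shows that the limit is fixed. -/
theorem exists_fixedPoint (hc : PComplete p M) (hs : PSeparated p M) (F : M → M)
    (hF : ∀ (m : ℕ) (x y z : M), x - y = p ^ m • z → ∃ w, F x - F y = p ^ (m + 1) • w) :
    ∃ x, F x = x := by
  have key (m : ℕ) : ∃ z, F^[m + 1] 0 - F^[m] 0 = p ^ m • z := by
    induction m with
    | zero => exact ⟨F 0, by simp⟩
    | succ m ih =>
      obtain ⟨z, hz⟩ := ih
      rw [Function.iterate_succ_apply' F (m + 1), Function.iterate_succ_apply' F m]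
      exact hF m _ _ z (by rw [← hz, Function.iterate_succ_apply' F m])
  obtain ⟨y, hy⟩ := hc (fun m => F^[m] 0) key
  refine ⟨y, sub_eq_zero.1 (hs _ fun m => ?_)⟩
  obtain ⟨z, hz⟩ := hy m
  obtain ⟨w, hw⟩ := hF m _ _ z hz
  obtain ⟨w', hw'⟩ := hy (m + 1)
  refine ⟨p • w - p • w', ?_⟩
  rw [← Function.iterate_succ_apply' F m] at hw
  have : F y - y = (F y - F^[m.succ] 0) - (y - F^[m + 1] 0) := by abel
  rw [this, hw, hw', smul_sub, smul_smul, smul_smul, pow_succ]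

/-- Successive approximation: the error of an approximate solution is divided by p and solved for
again. Only additivity of `L` is needed, so Frobenius-semilinear operators are covered. -/
theorem surjective_of_surjective_mod (hc : PComplete p M) (hs : PSeparated p M) (L : M →+ M)
    (hL : ∀ c, ∃ z w, L z = c + p • w) : Function.Surjective L := by
  choose z w hzw using hL
  intro c
  -- `r m` is the remainder after `m` steps, divided by `p ^ m`
  let r : ℕ → M := fun m => Nat.rec c (fun _ a => -w a) m
  let x : ℕ → M := fun m => ∑ i ∈ Finset.range m, p ^ i • z (r i)
  have hr (m : ℕ) : r (m + 1) = -w (r m) := rfl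
  have hx (m : ℕ) : c - L (x m) = p ^ m • r m := by
    induction m with
    | zero => simp [x, r]
    | succ m ih =>
      have : L (x (m + 1)) = L (x m) + p ^ m • (r m + p • w (r m)) := by
        simp only [x, Finset.sum_range_succ, map_add, map_nsmul, hzw]
      rw [this, ← sub_sub, ih, hr, smul_add, smul_neg, pow_succ, mul_smul]
      abel
  obtain ⟨y, hy⟩ := hc x fun m => ⟨z (r m), by simp [x, Finset.sum_range_succ]⟩
  refine ⟨y, (sub_eq_zero.1 (hs _ fun m => ?_)).symm⟩
  obtain ⟨v, hv⟩ := hy m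
  refine ⟨r m - L v, ?_⟩
  rw [smul_sub, ← hx, ← map_nsmul, ← hv, map_sub]
  abel

end Padic

/-! ### The rings W(k) and W(k)[[t]]: characteristic, completeness, reduction. -/

section Witt

variable (p : ℕ) [Fact p.Prime] (k : Type u) [Field k] [CharP k p]

instance : CharZero (WittVector p k) := by
  obtain ⟨q, hq⟩ := CharP.exists (WittVector p k)
  rcases CharP.char_is_prime_or_zero (WittVector p k) q with h | h
  · exfalso
    have h0 : (q : k) = 0 := by
      rw [← map_natCast (WittVector.constantCoeff : WittVector p k →+* k), CharP.cast_eq_zero,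
        map_zero]
    have h1 : p = q :=
      (Nat.prime_dvd_prime_iff_eq (Fact.out : p.Prime) h).1 ((CharP.cast_eq_zero_iff k p q).1 h0)
    subst h1
    exact WittVector.p_nonzero p k (CharP.cast_eq_zero _ _)
  · subst h
    exact CharP.charP_to_charZero _

instance : CharZero (FractionRing (WittVector p k)) :=
  charZero_of_injective_algebraMap
    (IsFractionRing.injective (WittVector p k) (FractionRing (WittVector p k)))

variable (n : ℕ)

instance : IsDomain (PS p k n) := NoZeroDivisors.to_isDomain _

instance {σ R : Type*} [CommRing R] [CharZero R] : CharZero (MvPowerSeries σ R) :=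
  charZero_of_injective_ringHom (f := (MvPowerSeries.C : R →+* MvPowerSeries σ R))
    MvPowerSeries.C_injective

variable [PerfectRing k p]

theorem witt_pcomplete : PComplete p (WittVector p k) := by
  intro x hx
  have h : ∀ {m l : ℕ}, m ≤ l →
      x m ≡ x l [SMOD (Ideal.span {(p : WittVector p k)} ^ m • ⊤ : Ideal (WittVector p k))] := by
    intro m l hml
    induction l, hml using Nat.le_induction with
    | base => rfl
    | succ l hml ih =>
      refine ih.trans (SModEq.symm ?_)
      obtain ⟨z, hz⟩ := hx l
      rw [SModEq.sub_mem, hz, smul_eq_mul, Ideal.mul_top, Ideal.span_singleton_pow,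
        Ideal.mem_span_singleton, nsmul_eq_mul]
      push_cast
      exact (pow_dvd_pow _ hml).mul_right _
  obtain ⟨y, hy⟩ := IsPrecomplete.prec (I := Ideal.span {(p : WittVector p k)}) inferInstance h
  refine ⟨y, fun m => ?_⟩
  have := (hy m).symm
  rw [SModEq.sub_mem, smul_eq_mul, Ideal.mul_top, Ideal.span_singleton_pow,
    Ideal.mem_span_singleton] at this
  obtain ⟨z, hz⟩ := this
  exact ⟨z, by rw [hz, nsmul_eq_mul]; push_cast; rfl⟩

theorem witt_pseparated : PSeparated p (WittVector p k) := by
  intro x hx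
  refine IsHausdorff.haus (I := Ideal.span {(p : WittVector p k)}) inferInstance x fun m => ?_
  obtain ⟨z, hz⟩ := hx m
  rw [SModEq.zero, smul_eq_mul, Ideal.mul_top, Ideal.span_singleton_pow,
    Ideal.mem_span_singleton, hz, nsmul_eq_mul]
  push_cast
  exact dvd_mul_right _ _

theorem ps_pcomplete : PComplete p (PS p k n) := (witt_pcomplete p k).pi

theorem ps_pseparated : PSeparated p (PS p k n) := (witt_pseparated p k).pi

variable {p k n}

theorem reduce_eq_zero_iff (a : PS p k n) : reduce p k n a = 0 ↔ (p : PS p k n) ∣ a := by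
  constructor
  · intro h
    have (m : Fin n →₀ ℕ) : ∃ w, MvPowerSeries.coeff m a = p * w := by
      have h1 : MvPowerSeries.coeff m a ∈ RingHom.ker WittVector.constantCoeff := by
        simpa [reduce] using congrArg (MvPowerSeries.coeff m) h
      rwa [WittVector.ker_constantCoeff, Ideal.mem_span_singleton] at h1
    choose w hw using this
    let b : PS p k n := w
    refine ⟨b, MvPowerSeries.ext fun m => ?_⟩
    rw [hw m, ← map_natCast (MvPowerSeries.C (σ := Fin n) (R := WittVector p k)),
      MvPowerSeries.coeff_C_mul]
    rfl
  · rintro ⟨b, rfl⟩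
    rw [map_mul, map_natCast, ← map_natCast (MvPowerSeries.C : k →+* MvPowerSeries (Fin n) k),
      CharP.cast_eq_zero, map_zero, zero_mul]

theorem reduce_natCast : reduce p k n p = 0 := (reduce_eq_zero_iff _).2 dvd_rfl

end Witt

section StdLift

variable {p : ℕ} [Fact p.Prime] {k : Type u} [Field k] [CharP k p] {n : ℕ}

theorem stdLift_X (j : Fin n) : (stdLift p k n).hom (MvPowerSeries.X j : PS p k n) = MvPowerSeries.X j ^ p := by
  change MvPowerSeries.expand p (Fact.out : p.Prime).ne_zero (MvPowerSeries.map WittVector.frobenius (MvPowerSeries.X j)) = _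
  rw [MvPowerSeries.map_X, MvPowerSeries.expand_X]

theorem dA_stdLift_X (i j : Fin n) : dA p k n i ((stdLift p k n).hom (MvPowerSeries.X j : PS p k n)) =
    if j = i then (p : PS p k n) * MvPowerSeries.X j ^ (p - 1) else 0 := by
  classical
  rw [stdLift_X, dA, MvPowerSeries.pderiv_pow, MvPowerSeries.pderiv_X, Pi.single_apply]
  split_ifs <;> simp

end StdLift

/-! ### Modules over `W(k)[[t]]` -/

section Modules

variable {p : ℕ} [Fact p.Prime] {k : Type u} [Field k] [CharP k p] [PerfectRing k p] {n : ℕ}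
variable {H : Type v} [AddCommGroup H] [Module (PS p k n) H]

theorem cast_pow_smul (i : ℕ) (x : H) : ((p : PS p k n) ^ i) • x = p ^ i • x := by
  rw [← Nat.cast_pow, Nat.cast_smul_eq_nsmul]

theorem mem_pPow {i : ℕ} {x : H} : x ∈ pPow p k n H i ↔ ∃ y : H, x = p ^ i • y := by
  simp only [pPow, LinearMap.mem_range, LinearMap.lsmul_apply, cast_pow_smul]
  exact exists_congr fun y => eq_comm

theorem mem_pPow_one {x : H} : x ∈ pPow p k n H 1 ↔ ∃ y : H, x = p • y := by
  rw [mem_pPow, pow_one]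

theorem p_mem_maximalIdeal : (p : PS p k n) ∈ IsLocalRing.maximalIdeal (PS p k n) := by
  rw [IsLocalRing.mem_maximalIdeal, mem_nonunits_iff]
  intro h
  have := h.map (reduce p k n)
  rw [reduce_natCast] at this
  exact not_isUnit_zero this

theorem p_smul_top_eq : Ideal.span {(p : PS p k n)} • (⊤ : Submodule (PS p k n) H) =
    pPow p k n H 1 := by
  ext x
  rw [Submodule.ideal_span_singleton_smul, Submodule.mem_smul_pointwise_iff_exists]
  simp [pPow]

variable [Module.Finite (PS p k n) H]

/-- Nakayama's lemma, since p lies in the maximal ideal of the local ring W(k)[[t]]. -/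
theorem eq_top_of_sup_pPow {N : Submodule (PS p k n) H} (h : N ⊔ pPow p k n H 1 = ⊤) : N = ⊤ := by
  rw [eq_top_iff]
  refine Submodule.le_of_le_smul_of_le_jacobson_bot (I := Ideal.span {(p : PS p k n)})
    Module.Finite.fg_top ?_ (by rw [p_smul_top_eq, h])
  rw [IsLocalRing.jacobson_eq_maximalIdeal _ bot_ne_top, Ideal.span_singleton_le_iff_mem]
  exact p_mem_maximalIdeal

/-- Submodules of a finite module are `p`-adically closed. -/
theorem mem_of_forall_add_pow (N : Submodule (PS p k n) H) {x : H}
    (h : ∀ m, ∃ u ∈ N, ∃ y, x = u + p ^ m • y) : x ∈ N := by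
  -- Krull's intersection theorem for the finite module H / N.
  have key := Ideal.iInf_pow_smul_eq_bot_of_isLocalRing (M := H ⧸ N)
    (Ideal.span {(p : PS p k n)}) (by
      rw [Ne, Ideal.span_singleton_eq_top]
      exact (IsLocalRing.mem_maximalIdeal _).1 p_mem_maximalIdeal)
  rw [← Submodule.Quotient.mk_eq_zero, ← Submodule.mem_bot (PS p k n), ← key, Submodule.mem_iInf]
  intro m
  obtain ⟨u, hu, y, rfl⟩ := h m
  rw [Submodule.Quotient.mk_add, (Submodule.Quotient.mk_eq_zero N).2 hu, zero_add,
    ← cast_pow_smul (k := k) (n := n), Submodule.Quotient.mk_smul]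
  exact Submodule.smul_mem_smul (Ideal.pow_mem_pow (Ideal.mem_span_singleton_self _) m) trivial

theorem pseparated_of_finite (p : ℕ) [Fact p.Prime] (k : Type u) [Field k] [CharP k p]
    [PerfectRing k p] (n : ℕ) (H : Type v) [AddCommGroup H] [Module (PS p k n) H]
    [Module.Finite (PS p k n) H] : PSeparated p H := by
  intro x hx
  refine (Submodule.mem_bot (PS p k n)).1 (mem_of_forall_add_pow (⊥ : Submodule (PS p k n) H) fun m => ?_)
  obtain ⟨z, hz⟩ := hx m
  exact ⟨0, zero_mem _, z, by rw [hz, zero_add]⟩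

end Modules

section Free

variable {p : ℕ} [Fact p.Prime] {k : Type u} [Field k] [CharP k p] [PerfectRing k p] {n : ℕ}
variable {H : Type v} [AddCommGroup H] [Module (PS p k n) H] [Module.Free (PS p k n) H]

theorem pow_smul_cancel {p : ℕ} [Fact p.Prime] (k : Type u) [Field k] [CharP k p]
    [PerfectRing k p] (n : ℕ) {H : Type v} [AddCommGroup H] [Module (PS p k n) H]
    [Module.Free (PS p k n) H] {i : ℕ} {x y : H} (h : p ^ i • x = p ^ i • y) : x = y := by
  rw [← cast_pow_smul (k := k) (n := n), ← cast_pow_smul (k := k) (n := n)] at h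
  have hp : (p : PS p k n) ≠ 0 := Nat.cast_ne_zero.2 (Fact.out : p.Prime).ne_zero
  exact smul_right_injective H (pow_ne_zero i hp) h

/-- A direct summand is saturated. -/
theorem mem_of_pow_smul_mem {N E : Submodule (PS p k n) H} (h : Disjoint N E) (h' : N ⊔ E = ⊤)
    {i : ℕ} {x : H} (hx : p ^ i • x ∈ N) : x ∈ N := by
  obtain ⟨u, hu, e, he, rfl⟩ := Submodule.mem_sup.1 (h' ▸ Submodule.mem_top : x ∈ N ⊔ E)
  rw [smul_add] at hx
  have h1 : p ^ i • e ∈ N := by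
    simpa using sub_mem hx (N.smul_of_tower_mem (p ^ i) hu)
  have h2 := Submodule.disjoint_def.1 h _ h1 (E.smul_of_tower_mem (p ^ i) he)
  rw [← smul_zero (p ^ i)] at h2
  rw [pow_smul_cancel k n h2, add_zero]
  exact hu

variable [Module.Finite (PS p k n) H]

/-- The sum is everything by Nakayama. An element of the intersection dies in H_0, hence is p times
an element lying in both submodules; iterating, it is infinitely p-divisible and so zero. -/
theorem isCompl_of_liftsTo {N E : Submodule (PS p k n) H}
    {N₀ E₀ : Submodule (PS p k n) (H0 p k n H)} (hN : LiftsTo N N₀) (hE : LiftsTo E E₀)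
    (h : IsCompl N₀ E₀) : IsCompl N E := by
  refine ⟨?_, codisjoint_iff.2 (eq_top_of_sup_pPow ?_)⟩
  · rw [Submodule.disjoint_def]
    intro x hxN hxE
    have key : ∀ m, ∀ x ∈ N, x ∈ E → ∃ z, x = p ^ m • z := by
      intro m
      induction m with
      | zero => exact fun x _ _ => ⟨x, by simp⟩
      | succ m ih =>
        intro x hxN hxE
        have h0 : (pPow p k n H 1).mkQ x = 0 := by
          refine Submodule.disjoint_def.1 h.disjoint _ ?_ ?_
          · rw [← hN.1]; exact Submodule.mem_map_of_mem hxN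
          · rw [← hE.1]; exact Submodule.mem_map_of_mem hxE
        have h1 : x ∈ pPow p k n H 1 := by simpa using h0
        obtain ⟨y, hy, rfl⟩ := hN.2 x hxN h1
        obtain ⟨y', hy', h2⟩ := hE.2 _ hxE h1
        have : y = y' := pow_smul_cancel k n (i := 1) (by simpa using h2)
        subst this
        obtain ⟨z, rfl⟩ := ih y hy hy'
        exact ⟨z, by rw [smul_smul, pow_succ']⟩
    exact pseparated_of_finite p k n H x fun m => key m x hxN hxE
  · rw [eq_top_iff]
    intro x _
    have hx : (pPow p k n H 1).mkQ x ∈ N₀ ⊔ E₀ := by rw [h.sup_eq_top]; trivial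
    rw [← hN.1, ← hE.1, ← Submodule.map_sup] at hx
    obtain ⟨y, hy, hyx⟩ := hx
    have : x - y ∈ pPow p k n H 1 := by
      rw [← Submodule.ker_mkQ (pPow p k n H 1), LinearMap.mem_ker, map_sub, hyx, sub_self]
    rw [← add_sub_cancel y x]
    exact Submodule.add_mem_sup hy this

end Free

end CY3

end

noncomputable section

set_option linter.unusedSectionVars false

namespace CY3

/-! ### Lang's theorem for `GL_r` over an algebraically closed field -/

section Lang

variable {p : ℕ} [Fact p.Prime] {k : Type u} [Field k] [CharP k p] [IsAlgClosed k]

open Polynomial in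
/-- The polynomials `P 0 = a 0 X ^ p`, `P (i + 1) = P i ^ p + a (i + 1) X ^ p`. -/
def langPoly (p : ℕ) (a : ℕ → k) : ℕ → k[X]
  | 0 => C (a 0) * X ^ p
  | i + 1 => langPoly p a i ^ p + C (a (i + 1)) * X ^ p

open Polynomial in
theorem X_pow_dvd_langPoly (a : ℕ → k) (i : ℕ) : (X : k[X]) ^ p ∣ langPoly p a i := by
  have hp : p ≠ 0 := (Fact.out : p.Prime).ne_zero
  induction i with
  | zero => exact dvd_mul_left _ _
  | succ i ih => exact dvd_add (ih.trans (dvd_pow_self _ hp)) (dvd_mul_left _ _)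

-- The term P_i ^ p is divisible by X ^ (p * p), so the coefficient of X ^ p in P_{i+1} is exactly
-- a_{i+1}; once it vanishes, P_i ^ p = 0 and the induction descends.
open Polynomial in
theorem eq_zero_of_langPoly_eq_zero (a : ℕ → k) (i : ℕ) (h : langPoly p a i = 0) :
    ∀ j ≤ i, a j = 0 := by
  have hp : p.Prime := Fact.out
  induction i with
  | zero =>
    intro j hj
    have h1 := congrArg (coeff · p) h
    simp only [langPoly, coeff_C_mul_X_pow, if_true, coeff_zero] at h1
    rwa [Nat.le_zero.1 hj]
  | succ i ih =>
    have hd : (X : k[X]) ^ (p * p) ∣ langPoly p a i ^ p := by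
      rw [pow_mul]
      exact pow_dvd_pow_of_dvd (X_pow_dvd_langPoly a i) p
    have h0 : (langPoly p a i ^ p).coeff p = 0 :=
      X_pow_dvd_iff.1 hd p (by nlinarith [hp.two_le])
    have h1 := congrArg (coeff · p) h
    simp only [langPoly, coeff_add, coeff_C_mul_X_pow, if_true, coeff_zero, h0, zero_add] at h1
    have h2 : langPoly p a i = 0 := by
      have : langPoly p a i ^ p = 0 := by simpa [langPoly, h1] using h
      exact pow_eq_zero_iff hp.ne_zero |>.1 this
    intro j hj
    rcases Nat.le_succ_iff.1 hj with hj | rfl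
    · exact ih h2 j hj
    · exact h1

open Polynomial in
theorem exists_langPoly_eval_eq (a : ℕ → k) (m : ℕ) (h : ∃ j ≤ m, a j ≠ 0) :
    ∃ y : k, y ≠ 0 ∧ (langPoly p a m).eval y = y := by
  have hp : p.Prime := Fact.out
  have hne : langPoly p a m ≠ 0 := by
    intro h0
    obtain ⟨j, hj, hj'⟩ := h
    exact hj' (eq_zero_of_langPoly_eq_zero a m h0 j hj)
  -- The polynomial P_m - X factors as X (X S - 1), and the second factor is nonconstant with
  -- nonzero roots only.
  obtain ⟨S, hS⟩ := (pow_dvd_pow (X : k[X]) hp.two_le).trans (X_pow_dvd_langPoly a m)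
  have hS0 : S ≠ 0 := by
    rintro rfl
    exact hne (by simpa using hS)
  obtain ⟨y, hy⟩ := IsAlgClosed.exists_root (X * S - C 1) (by
    rw [degree_sub_C]
    · rw [degree_mul, degree_X, degree_eq_natDegree hS0]
      norm_cast
      omega
    · rw [degree_mul, degree_X, degree_eq_natDegree hS0]
      norm_cast
      omega)
  have hy' : y * S.eval y = 1 := by
    have : (X * S - C 1).eval y = 0 := hy
    simpa [sub_eq_zero] using this
  refine ⟨y, fun h0 => by simp [h0] at hy', ?_⟩
  rw [hS, eval_mul, eval_pow, eval_X, pow_two, mul_assoc, hy', mul_one]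

variable {V : Type v} [AddCommGroup V] [Module k V] [FiniteDimensional k V]

/-- On the span of the orbit of a vector v, with the first relation F^{m+1} v = ∑ a_i F^i v, the
equation F w = w for w = ∑ x_i F^i v says x_0 = a_0 x_m ^ p and x_{i+1} = x_i ^ p + a_{i+1} x_m ^ p.
Eliminating all unknowns but y = x_m leaves P_m(y) = y, with P_m the polynomial `langPoly p a m`. -/
theorem exists_fixed_ne_zero [Nontrivial V] (F : V →ₛₗ[frobenius k p] V)
    (hF : Function.Injective F) : ∃ w : V, w ≠ 0 ∧ F w = w := by
  classical
  obtain ⟨v, hv⟩ := exists_ne (0 : V)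
  let S : ℕ → Submodule k V := fun m => Submodule.span k ((fun i => F^[i] v) '' Set.Iio m)
  have hmono : Monotone S := fun a b hab =>
    Submodule.span_mono (Set.image_mono (Set.Iio_subset_Iio hab))
  have hex : ∃ m, F^[m] v ∈ S m := by
    obtain ⟨m, hm⟩ := monotone_stabilizes_iff_noetherian.2 inferInstance (⟨S, hmono⟩ : ℕ →o _)
    refine ⟨m, ?_⟩
    rw [show S m = S (m + 1) from hm (m + 1) (Nat.le_succ m)]
    exact Submodule.subset_span ⟨m, Nat.lt_succ_self m, rfl⟩
  obtain ⟨m, hm⟩ : ∃ m, Nat.find hex = m + 1 := by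
    refine Nat.exists_eq_succ_of_ne_zero fun h0 => hv ?_
    have := Nat.find_spec hex
    rw [h0] at this
    simpa [S] using this
  have h1 : F^[m + 1] v ∈ S (m + 1) := hm ▸ Nat.find_spec hex
  have h2 : F^[m] v ∉ S m := Nat.find_min hex (by omega)
  obtain ⟨a, ha⟩ : ∃ a : ℕ → k, F^[m + 1] v = ∑ i ∈ Finset.range (m + 1), a i • F^[i] v := by
    have h3 : F^[m + 1] v ∈ Submodule.span k
        ((fun i => F^[i] v) '' (Finset.range (m + 1) : Set ℕ)) := by
      simpa [S] using h1
    obtain ⟨c, hc⟩ := Submodule.mem_span_image_finset_iff_exists_fun k |>.1 h3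
    refine ⟨fun i => if hi : i ∈ Finset.range (m + 1) then c ⟨i, hi⟩ else 0, ?_⟩
    rw [← hc, ← Finset.sum_attach (Finset.range (m + 1)), Finset.univ_eq_attach]
    exact Finset.sum_congr rfl fun i _ => by beta_reduce; rw [dif_pos i.2]
  -- The relation is nontrivial because F is injective and v is nonzero.
  have hne : ∃ j ≤ m, a j ≠ 0 := by
    by_contra! h0
    have : F^[m + 1] v = 0 := by
      rw [ha]
      exact Finset.sum_eq_zero fun i hi => by
        rw [h0 i (Nat.lt_succ_iff.1 (Finset.mem_range.1 hi)), zero_smul]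
    have hz : F^[m + 1] 0 = 0 := Function.iterate_fixed (map_zero F) _
    exact hv (hF.iterate (m + 1) (this.trans hz.symm))
  obtain ⟨y, hy0, hy⟩ := exists_langPoly_eval_eq (p := p) a m hne
  let x : ℕ → k := fun i => (langPoly p a i).eval y
  have hxm : x m = y := hy
  have hx0 : x 0 = a 0 * y ^ p := by simp [x, langPoly]
  have hxs (i : ℕ) : x (i + 1) = x i ^ p + a (i + 1) * y ^ p := by simp [x, langPoly]
  refine ⟨∑ i ∈ Finset.range (m + 1), x i • F^[i] v, fun h0 => h2 ?_, ?_⟩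
  · rw [Finset.sum_range_succ, hxm] at h0
    have h3 : F^[m] v = -(y⁻¹ • ∑ i ∈ Finset.range m, x i • F^[i] v) := by
      rw [eq_neg_of_add_eq_zero_left h0, smul_neg, neg_neg, smul_smul, inv_mul_cancel₀ hy0,
        one_smul]
    rw [h3]
    refine Submodule.neg_mem _ (Submodule.smul_mem _ _ (Submodule.sum_mem _ fun i hi =>
      Submodule.smul_mem _ _ (Submodule.subset_span ⟨i, Finset.mem_range.1 hi, rfl⟩)))
  · rw [map_sum]
    simp only [map_smulₛₗ, frobenius_def, ← Function.iterate_succ_apply' F]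
    rw [Finset.sum_range_succ, hxm, Nat.succ_eq_add_one, ha, Finset.smul_sum,
      Finset.sum_range_succ', Finset.sum_range_succ' (fun i => x i • F^[i] v), ← add_assoc,
      ← Finset.sum_add_distrib]
    congr 1
    · refine Finset.sum_congr rfl fun i _ => ?_
      rw [hxs, add_smul, smul_smul, mul_comm]
    · rw [hx0, smul_smul, mul_comm]

theorem exists_artinSchreier (c : k) : ∃ z : k, z ^ p - z = c := by
  have hp : p.Prime := Fact.out
  obtain ⟨z, hz⟩ := IsAlgClosed.exists_root
    (Polynomial.X ^ p + (-Polynomial.X - Polynomial.C c) : Polynomial k) (by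
      have h1 : (-Polynomial.X - Polynomial.C c : Polynomial k).degree < (p : WithBot ℕ) := by
        rw [← neg_add', Polynomial.degree_neg, Polynomial.degree_X_add_C]
        exact_mod_cast hp.one_lt
      rw [Polynomial.degree_add_eq_left_of_degree_lt (by rwa [Polynomial.degree_X_pow]),
        Polynomial.degree_X_pow]
      exact_mod_cast hp.ne_zero)
  refine ⟨z, ?_⟩
  have : z ^ p + (-z - c) = 0 := by simpa using hz
  linear_combination this

/-- If the span S of the fixed vectors were proper, F would act injectively on V / S, since every
vector of S is the image of one in S by extraction of p-th roots. A nonzero fixed class of V / S can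
then be corrected, by an Artin–Schreier equation in S, to a fixed vector outside S. -/
theorem span_fixed_eq_top (F : V →ₛₗ[frobenius k p] V) (hF : Function.Injective F) :
    Submodule.span k {v | F v = v} = ⊤ := by
  set S := Submodule.span k {v | F v = v} with hS
  -- The properties proved below are additive but not stable under scalars, F being only semilinear,
  -- so they are checked on all multiples of fixed vectors.
  have hind : ∀ (P : V → Prop), P 0 → (∀ x y, P x → P y → P (x + y)) →
      (∀ (a : k) (x : V), F x = x → P (a • x)) → ∀ u ∈ S, P u := by
    intro P h0 hadd hsmul u hu
    have : ∀ a : k, P (a • u) := by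
      induction hu using Submodule.span_induction with
      | mem x hx => exact fun a => hsmul a x hx
      | zero => exact fun a => by rwa [smul_zero]
      | add x y _ _ hx hy => exact fun a => by rw [smul_add]; exact hadd _ _ (hx a) (hy a)
      | smul b x _ hx => exact fun a => by rw [smul_smul]; exact hx _
    simpa using this 1
  have hfix {x : V} (hx : F x = x) (a : k) : a • x ∈ S :=
    Submodule.smul_mem _ _ (Submodule.subset_span hx)
  have hsolve : ∀ u ∈ S, ∃ z ∈ S, F z - z = u := by
    refine hind _ ⟨0, zero_mem _, by simp⟩ ?_ ?_
    · rintro _ _ ⟨z, hz, rfl⟩ ⟨z', hz', rfl⟩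
      exact ⟨z + z', add_mem hz hz', by rw [map_add]; abel⟩
    · intro a x hx
      obtain ⟨c, hc⟩ := exists_artinSchreier (p := p) a
      refine ⟨c • x, hfix hx c, ?_⟩
      rw [map_smulₛₗ, hx, ← sub_smul, frobenius_def, hc]
  have hpre : ∀ u ∈ S, ∃ z ∈ S, F z = u := by
    refine hind _ ⟨0, zero_mem _, by simp⟩ ?_ ?_
    · rintro _ _ ⟨z, hz, rfl⟩ ⟨z', hz', rfl⟩
      exact ⟨z + z', add_mem hz hz', by rw [map_add]⟩
    · intro a x hx
      obtain ⟨c, hc⟩ := IsAlgClosed.exists_pow_nat_eq a (Fact.out : p.Prime).pos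
      refine ⟨c • x, hfix hx c, ?_⟩
      rw [map_smulₛₗ, hx, frobenius_def, hc]
  have hle : S ≤ S.comap F := by
    refine hind _ (zero_mem _) (fun _ _ => add_mem) fun a x hx => ?_
    rw [Submodule.mem_comap, map_smulₛₗ, hx]
    exact hfix hx _
  by_contra hne
  have : Nontrivial (V ⧸ S) := Submodule.Quotient.nontrivial_iff.2 hne
  obtain ⟨w, hw0, hw⟩ := exists_fixed_ne_zero (S.mapQ S F hle) (by
    rw [injective_iff_map_eq_zero]
    intro w
    obtain ⟨w, rfl⟩ := S.mkQ_surjective w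
    rw [Submodule.mkQ_apply, Submodule.mapQ_apply, Submodule.Quotient.mk_eq_zero,
      Submodule.Quotient.mk_eq_zero]
    intro h
    obtain ⟨z, hz, hz'⟩ := hpre _ h
    rwa [← hF hz'])
  obtain ⟨w, rfl⟩ := S.mkQ_surjective w
  rw [Submodule.mkQ_apply, Submodule.mapQ_apply, Submodule.Quotient.eq] at hw
  obtain ⟨z, hz, hz'⟩ := hsolve _ hw
  refine hw0 ((Submodule.Quotient.mk_eq_zero S).2 ?_)
  have h1 : w - z ∈ S := Submodule.subset_span (by
    rw [Set.mem_ofPred_eq, map_sub, sub_eq_sub_iff_sub_eq_sub, hz'])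
  simpa using add_mem h1 hz

open Matrix in
/-- Lang's theorem for `GL_r`. -/
theorem exists_lang_matrix {r : Type*} [Fintype r] [DecidableEq r] (g : Matrix r r k)
    (hg : IsUnit g.det) : ∃ x : Matrix r r k, IsUnit x.det ∧ g * x.map (frobenius k p) = x := by
  let F : (r → k) →ₛₗ[frobenius k p] (r → k) :=
    { toFun := fun v => g *ᵥ (fun i => frobenius k p (v i))
      map_add' := fun v w => by
        rw [← mulVec_add]; congr 1; funext i; simp
      map_smul' := fun a v => by
        rw [← mulVec_smul]; congr 1; funext i; simp [mul_pow, frobenius_def] }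
  have hF : Function.Injective F := by
    rw [injective_iff_map_eq_zero]
    intro v hv
    have h1 : (fun i => frobenius k p (v i)) = 0 :=
      (Matrix.mulVec_injective_iff_isUnit.2 ((isUnit_iff_isUnit_det g).2 hg))
        (hv.trans (mulVec_zero g).symm)
    funext i
    exact (map_eq_zero _).1 (congrFun h1 i)
  obtain ⟨b, hbs, hbspan, hb⟩ := exists_linearIndependent k {v | F v = v}
  rw [span_fixed_eq_top F hF] at hbspan
  let e : Module.Basis b k (r → k) := Module.Basis.mk hb (by rw [Subtype.range_coe, hbspan])
  let e' := e.reindex (e.indexEquiv (Pi.basisFun k r))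
  have he' (i : r) : F (e' i) = e' i := by
    rw [Module.Basis.reindex_apply, Module.Basis.mk_apply]
    exact hbs (Subtype.coe_prop _)
  refine ⟨(Pi.basisFun k r).toMatrix e', ?_, ?_⟩
  · rw [← Module.Basis.det_apply]
    exact (Pi.basisFun k r).isUnit_det e'
  · ext i j
    have := congrFun (he' j) i
    simpa [F, Matrix.mul_apply, mulVec, dotProduct, Module.Basis.toMatrix_apply] using this

end Lang

end CY3

end

noncomputable section

set_option linter.unusedSectionVars false

namespace CY3

open Matrix

theorem matrix_map_nsmul {ι κ R S : Type*} [NonAssocSemiring R] [NonAssocSemiring S] (f : R →+* S)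
    (m : ℕ) (z : Matrix ι κ R) : (m • z).map f = m • z.map f := by
  ext1 i j
  simp only [Matrix.map_apply, Matrix.smul_apply, map_nsmul]

/-! ### Frobenius-fixed frames over `W(k)` and `W(k)[[t]]` -/

section WittFrames

variable {p : ℕ} [Fact p.Prime] {k : Type u} [Field k] [CharP k p] [IsAlgClosed k]

theorem constantCoeff_frobenius (x : WittVector p k) :
    WittVector.constantCoeff (WittVector.frobenius x) =
      _root_.frobenius k p (WittVector.constantCoeff x) := by
  rw [WittVector.constantCoeff_apply, WittVector.constantCoeff_apply,
    WittVector.coeff_frobenius_charP, frobenius_def]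

theorem exists_eq_p_mul_of_constantCoeff_eq_zero {x : WittVector p k}
    (h : WittVector.constantCoeff x = 0) : ∃ y, x = p * y := by
  rwa [← RingHom.mem_ker, WittVector.ker_constantCoeff, Ideal.mem_span_singleton] at h

theorem matrix_exists_eq_p_smul {ι κ : Type*} {x y : Matrix ι κ (WittVector p k)}
    (h : x.map WittVector.constantCoeff = y.map WittVector.constantCoeff) :
    ∃ z : Matrix ι κ (WittVector p k), x = y + p • z := by
  have (i : ι) (j : κ) : ∃ z, x i j - y i j = p * z :=
    exists_eq_p_mul_of_constantCoeff_eq_zero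
      (by rw [map_sub, sub_eq_zero]; exact congrFun (congrFun h i) j)
  choose z hz using this
  refine ⟨Matrix.of z, ?_⟩
  ext1 i j
  rw [Matrix.add_apply, Matrix.smul_apply, Matrix.of_apply, nsmul_eq_mul, ← hz]
  ring

theorem isUnit_witt_iff {x : WittVector p k} : IsUnit x ↔ WittVector.constantCoeff x ≠ 0 :=
  ⟨fun h => (h.map WittVector.constantCoeff).ne_zero,
    fun h => WittVector.isUnit_of_coeff_zero_ne_zero x h⟩

theorem isUnit_det_of_map_constantCoeff {r : Type*} [Fintype r] [DecidableEq r]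
    {x : Matrix r r (WittVector p k)} (h : IsUnit (x.map WittVector.constantCoeff).det) :
    IsUnit x.det := by
  rw [isUnit_witt_iff, RingHom.map_det]
  exact h.ne_zero

theorem map_constantCoeff_surjective {ι κ : Type*} (x : Matrix ι κ k) :
    ∃ y : Matrix ι κ (WittVector p k), y.map WittVector.constantCoeff = x := by
  refine ⟨Matrix.of fun i j => WittVector.teichmuller p (x i j), ?_⟩
  ext i j
  simp

/-- Lang's theorem over `W(k)`. -/
theorem exists_witt_frame {r : Type*} [Fintype r] [DecidableEq r]
    (g : Matrix r r (WittVector p k)) (hg : IsUnit g.det) :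
    ∃ x : Matrix r r (WittVector p k), IsUnit x.det ∧ g * x.map WittVector.frobenius = x := by
  have hcf {ι κ : Type _} (x : Matrix ι κ (WittVector p k)) :
      (x.map WittVector.frobenius).map WittVector.constantCoeff =
        (x.map WittVector.constantCoeff).map (_root_.frobenius k p) := by
    ext i j
    exact constantCoeff_frobenius _
  obtain ⟨x₀, hx₀, hx₀'⟩ := exists_lang_matrix (p := p) (g.map WittVector.constantCoeff)
    (by simpa [RingHom.map_det] using hg.map WittVector.constantCoeff)
  obtain ⟨x, rfl⟩ := map_constantCoeff_surjective (p := p) x₀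
  have hx := isUnit_det_of_map_constantCoeff hx₀
  obtain ⟨e, he⟩ : ∃ e, g * x.map WittVector.frobenius = x + p • e := by
    apply matrix_exists_eq_p_smul
    rw [Matrix.map_mul, hcf, hx₀']
  -- the twisted matrix `1 + p c`
  set c := x⁻¹ * e with hc
  have hg' : x⁻¹ * g * x.map WittVector.frobenius = 1 + p • c := by
    rw [Matrix.mul_assoc, he, Matrix.mul_add, Matrix.nonsing_inv_mul _ hx, Matrix.mul_smul]
  let L : Matrix r r (WittVector p k) →+ Matrix r r (WittVector p k) :=
    { toFun := fun z => (1 + p • c) * z.map WittVector.frobenius - z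
      map_zero' := by simp [Matrix.map_zero]
      map_add' := fun z w => by
        rw [Matrix.map_add _ (map_add _), Matrix.mul_add]; abel }
  -- Modulo p the operator is z ↦ σ(z) - z, surjective by Artin–Schreier.
  have hL : Function.Surjective L := by
    refine surjective_of_surjective_mod (p := p) ((witt_pcomplete p k).matrix r r)
      ((witt_pseparated p k).matrix r r) L fun d => ?_
    choose z₀ hz₀ using fun i j =>
      exists_artinSchreier (p := p) (WittVector.constantCoeff (d i j) : k)
    obtain ⟨z, hz⟩ := map_constantCoeff_surjective (p := p) (Matrix.of z₀)
    obtain ⟨w, hw⟩ : ∃ w, z.map WittVector.frobenius - z = d + p • w := by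
      apply matrix_exists_eq_p_smul
      rw [Matrix.map_sub _ (map_sub _), hcf, hz]
      ext i j
      exact hz₀ i j
    refine ⟨z, w + c * z.map WittVector.frobenius, ?_⟩
    change (1 + p • c) * z.map WittVector.frobenius - z = _
    rw [Matrix.add_mul, Matrix.one_mul, Matrix.smul_mul, smul_add, ← add_assoc, ← hw]
    abel
  -- The requirement (1 + pc) σ(1 + pz) = 1 + pz, after subtracting 1 + pz and dividing by p,
  -- becomes L z = -c.
  obtain ⟨z, hz⟩ := hL (-c)
  have hz : (1 + p • c) * z.map WittVector.frobenius - z = -c := hz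
  have hy : (1 + p • c) * (1 + p • z).map WittVector.frobenius = 1 + p • z := by
    have : (1 + p • z).map WittVector.frobenius = 1 + p • z.map WittVector.frobenius := by
      rw [Matrix.map_add _ (map_add _), Matrix.map_one _ (map_zero _) (map_one _),
        matrix_map_nsmul]
    rw [this, Matrix.mul_add, Matrix.mul_one, Matrix.mul_smul, sub_eq_iff_eq_add.1 hz, smul_add,
      smul_neg]
    abel
  refine ⟨x * (1 + p • z), ?_, ?_⟩
  · rw [Matrix.det_mul]
    refine hx.mul (isUnit_det_of_map_constantCoeff ?_)
    have : (1 + p • z).map WittVector.constantCoeff = (1 : Matrix r r k) := by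
      rw [Matrix.map_add _ (map_add _), Matrix.map_one _ (map_zero _) (map_one _),
        matrix_map_nsmul]
      ext1 i j
      simp only [Matrix.add_apply, Matrix.smul_apply]
      rw [nsmul_eq_mul, CharP.cast_eq_zero, zero_mul, add_zero]
    rw [this, Matrix.det_one]
    exact isUnit_one
  · have h1 : g * x.map WittVector.frobenius = x * (1 + p • c) := by
      rw [← hg', Matrix.mul_assoc x⁻¹, ← Matrix.mul_assoc x, Matrix.mul_nonsing_inv _ hx,
        Matrix.one_mul]
    rw [Matrix.map_mul, ← Matrix.mul_assoc, h1, Matrix.mul_assoc, hy]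

end WittFrames

/-! ### Fixed points in power series rings; Frobenius frames over W(k)[[t]]. -/

section PowerSeries

/-- A self-map of a family of power series that increases the order of agreement has a fixed
point. -/
theorem exists_fixedPoint_powerSeries {ι σ R : Type*} [CommRing R]
    (F : (ι → MvPowerSeries σ R) → ι → MvPowerSeries σ R)
    (hF : ∀ (m : ℕ) (x y : ι → MvPowerSeries σ R),
      (∀ i (d : σ →₀ ℕ), d.degree < m →
        MvPowerSeries.coeff d (x i) = MvPowerSeries.coeff d (y i)) →
      ∀ i (d : σ →₀ ℕ), d.degree < m + 1 →
        MvPowerSeries.coeff d (F x i) = MvPowerSeries.coeff d (F y i)) :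
    ∃ x, F x = x := by
  have key (m : ℕ) : ∀ i (d : σ →₀ ℕ), d.degree < m →
      MvPowerSeries.coeff d (F^[m + 1] 0 i) = MvPowerSeries.coeff d (F^[m] 0 i) := by
    induction m with
    | zero => intro i d hd; omega
    | succ m ih =>
      rw [Function.iterate_succ_apply' F (m + 1), Function.iterate_succ_apply' F m]
      rw [Function.iterate_succ_apply' F m] at ih
      exact hF m _ _ ih
  have key' (m l : ℕ) (hml : m ≤ l) : ∀ i (d : σ →₀ ℕ), d.degree < m →
      MvPowerSeries.coeff d (F^[l] 0 i) = MvPowerSeries.coeff d (F^[m] 0 i) := by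
    induction l, hml using Nat.le_induction with
    | base => exact fun _ _ _ => rfl
    | succ l hml ih => exact fun i d hd => (key l i d (hd.trans_le hml)).trans (ih i d hd)
  let x : ι → MvPowerSeries σ R := fun i d => MvPowerSeries.coeff d (F^[d.degree + 1] 0 i)
  have hx (m : ℕ) (i : ι) (d : σ →₀ ℕ) (hd : d.degree < m) :
      MvPowerSeries.coeff d (x i) = MvPowerSeries.coeff d (F^[m] 0 i) :=
    (key' _ m hd i d (Nat.lt_succ_self _)).symm
  refine ⟨x, funext fun i => MvPowerSeries.ext fun d => ?_⟩
  rw [hF d.degree x (F^[d.degree] 0) (hx _) i d (Nat.lt_succ_self _),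
    ← Function.iterate_succ_apply' F]
  rfl

theorem coeff_mul_congr {σ R : Type*} [CommRing R] {f g g' : MvPowerSeries σ R} {m : ℕ}
    (h : ∀ d : σ →₀ ℕ, d.degree < m → MvPowerSeries.coeff d g = MvPowerSeries.coeff d g')
    {d : σ →₀ ℕ} (hd : d.degree < m) :
    MvPowerSeries.coeff d (f * g) = MvPowerSeries.coeff d (f * g') := by
  classical
  rw [MvPowerSeries.coeff_mul, MvPowerSeries.coeff_mul]
  refine Finset.sum_congr rfl fun x hx => ?_
  rw [h]
  have := congrArg Finsupp.degree (Finset.HasAntidiagonal.mem_antidiagonal.1 hx)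
  rw [map_add] at this
  omega

variable {p : ℕ} [Fact p.Prime] {k : Type u} [Field k] [CharP k p] {n : ℕ}

theorem stdLift_apply (a : PS p k n) : (stdLift p k n).hom a =
    MvPowerSeries.expand p (Fact.out : p.Prime).ne_zero
      (MvPowerSeries.map WittVector.frobenius a) := rfl

theorem constantCoeff_stdLift (a : PS p k n) :
    MvPowerSeries.constantCoeff ((stdLift p k n).hom a) =
      WittVector.frobenius (MvPowerSeries.constantCoeff a) := by
  rw [stdLift_apply, MvPowerSeries.constantCoeff_expand, MvPowerSeries.constantCoeff_map]

/-- The substitution t ↦ t^p multiplies degrees by p, so among series with equal constant terms the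
standard lift increases the order of agreement. This is the contraction property in the t-adic
direction. -/
theorem coeff_stdLift_congr {a b : PS p k n} {m : ℕ} (h0 : MvPowerSeries.constantCoeff a =
    MvPowerSeries.constantCoeff b) (h : ∀ d : Fin n →₀ ℕ, d.degree < m →
      MvPowerSeries.coeff d a = MvPowerSeries.coeff d b) {d : Fin n →₀ ℕ} (hd : d.degree < m + 1) :
    MvPowerSeries.coeff d ((stdLift p k n).hom a) =
      MvPowerSeries.coeff d ((stdLift p k n).hom b) := by
  have hp : p.Prime := Fact.out
  rw [stdLift_apply, stdLift_apply]
  by_cases hdvd : ∀ i, p ∣ d i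
  · obtain ⟨d', rfl⟩ : ∃ d', d = p • d' := by
      choose e he using hdvd
      exact ⟨Finsupp.equivFunOnFinite.symm e, by ext i; simp [he i]⟩
    rw [MvPowerSeries.coeff_expand_smul, MvPowerSeries.coeff_expand_smul,
      MvPowerSeries.coeff_map, MvPowerSeries.coeff_map]
    congr 1
    by_cases hd' : d' = 0
    · subst hd'; exact h0
    · apply h
      have h1 : 0 < d'.degree := Nat.pos_of_ne_zero fun h => hd' ((Finsupp.degree_eq_zero_iff d').1 h)
      rw [map_nsmul, smul_eq_mul] at hd
      nlinarith [hp.two_le]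
  · push Not at hdvd
    obtain ⟨i, hi⟩ := hdvd
    rw [MvPowerSeries.coeff_expand_of_not_dvd _ _ _ hi,
      MvPowerSeries.coeff_expand_of_not_dvd _ _ _ hi]

theorem exists_fixed_powerSeries {r : Type*} [Fintype r] (M : Matrix r r (PS p k n))
    (v : r → WittVector p k)
    (hv : M.map MvPowerSeries.constantCoeff *ᵥ (fun i => WittVector.frobenius (v i)) = v) :
    ∃ x : r → PS p k n, (∀ i, MvPowerSeries.constantCoeff (x i) = v i) ∧
      M *ᵥ (fun i => (stdLift p k n).hom (x i)) = x := by
  -- Resetting the constant term to v before applying the Frobenius makes the map contracting on all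
  -- families, not only on those with the right constant term; the hypothesis on v then makes the
  -- fixed point genuine.
  let F : (r → PS p k n) → r → PS p k n := fun x =>
    M *ᵥ (fun i => (stdLift p k n).hom
      (x i - MvPowerSeries.C (MvPowerSeries.constantCoeff (x i)) + MvPowerSeries.C (v i)))
  have hF0 (x : r → PS p k n) (i : r) : MvPowerSeries.constantCoeff (F x i) = v i := by
    simp only [F, mulVec, dotProduct, map_sum, map_mul, constantCoeff_stdLift]
    simpa [mulVec, dotProduct] using congrFun hv i
  obtain ⟨x, hx⟩ := exists_fixedPoint_powerSeries F (fun m x y hxy i d hd => by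
    simp only [F, mulVec, dotProduct, map_sum]
    refine Finset.sum_congr rfl fun j _ => coeff_mul_congr (fun d hd => ?_) hd
    refine coeff_stdLift_congr (by simp) (fun d hd => ?_) hd
    have h0 := hxy j 0 (by rw [map_zero]; omega)
    rw [MvPowerSeries.coeff_zero_eq_constantCoeff_apply,
      MvPowerSeries.coeff_zero_eq_constantCoeff_apply] at h0
    rw [map_add, map_add, map_sub, map_sub, hxy j d hd, h0])
  have hx0 (i : r) : MvPowerSeries.constantCoeff (x i) = v i := by
    rw [← hF0 x, hx]
  refine ⟨x, hx0, ?_⟩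
  nth_rewrite 2 [← hx]
  simp only [F, hx0, sub_add_cancel]

/-- A matrix in `GL_r(W(k)[[t]])` is a coboundary for the standard lift of Frobenius. -/
theorem exists_frame [IsAlgClosed k] {r : Type*} [Fintype r] [DecidableEq r]
    (M : Matrix r r (PS p k n)) (hM : IsUnit M.det) :
    ∃ x : Matrix r r (PS p k n), IsUnit x.det ∧ M * x.map (stdLift p k n).hom = x := by
  obtain ⟨y, hy, hy'⟩ := exists_witt_frame (M.map MvPowerSeries.constantCoeff)
    (by simpa [RingHom.map_det] using hM.map MvPowerSeries.constantCoeff)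
  have (j : r) := exists_fixed_powerSeries M (fun i => y i j) (by
    funext i
    exact congrFun (congrFun hy' i) j)
  choose x hx hx' using this
  refine ⟨Matrix.of fun i j => x j i, ?_, ?_⟩
  · rw [MvPowerSeries.isUnit_iff_constantCoeff, RingHom.map_det]
    convert hy using 2
    ext1 i j
    exact hx j i
  · ext1 i j
    exact congrFun (hx' j) i

end PowerSeries

end CY3

end

noncomputable section

set_option linter.unusedSectionVars false

namespace CY3

/-! ### Consequences of the Taylor formula -/

theorem prod_ofFn_pow_add_single {M : Type*} [Monoid M] {n : ℕ} (f : Fin n → M)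
    (hf : ∀ i j, Commute (f i) (f j)) (m m' : Fin n → ℕ) (j : Fin n)
    (hm : ∀ i, m' i = m i + if i = j then 1 else 0) :
    (List.ofFn fun i => f i ^ m' i).prod = (List.ofFn fun i => f i ^ m i).prod * f j := by
  induction n with
  | zero => exact j.elim0
  | succ n ih =>
    rw [List.ofFn_succ, List.ofFn_succ, List.prod_cons, List.prod_cons]
    cases j using Fin.cases with
    | zero =>
      have h1 : ∀ i : Fin n, m' i.succ = m i.succ := fun i => by simp [hm, Fin.succ_ne_zero]
      have h2 : Commute (List.ofFn fun i : Fin n => f i.succ ^ m i.succ).prod (f 0) := by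
        refine Commute.list_prod_left _ _ fun a ha => ?_
        obtain ⟨i, rfl⟩ := (List.mem_ofFn' _ _).1 ha
        exact (hf _ _).pow_left _
      simp only [h1, hm 0, if_true, pow_succ, mul_assoc, h2.eq]
    | succ j =>
      rw [ih (fun i => f i.succ) (fun i i' => hf _ _) (fun i => m i.succ) (fun i => m' i.succ) j
        (fun i => by simp [hm]), hm 0, if_neg (Fin.succ_ne_zero j).symm, add_zero, mul_assoc]

namespace FCrystal

variable {p : ℕ} [Fact p.Prime] {k : Type u} [Field k] {n : ℕ}
variable {H : Type v} [AddCommGroup H] [Module (PS p k n) H]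
  [Module.Free (PS p k n) H] [Module.Finite (PS p k n) H]

/-- The differential operator `D_1 ^ m_1 ⋯ D_n ^ m_n`. -/
def Dpow (C : FCrystal p k n H) (m : Fin n →₀ ℕ) : AddMonoid.End H :=
  (List.ofFn fun j => C.D j ^ m j).prod

theorem Dpow_zero (C : FCrystal p k n H) : C.Dpow 0 = 1 := by
  simp [Dpow]

theorem Dpow_add_single (C : FCrystal p k n H) (m : Fin n →₀ ℕ) (j : Fin n) (x : H) :
    C.Dpow (m + Finsupp.single j 1) x = C.Dpow m (C.D j x) := by
  have := prod_ofFn_pow_add_single C.D C.integrable m (DFunLike.coe (m + Finsupp.single j 1 : Fin n →₀ ℕ)) j fun i => by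
    rw [Finsupp.add_apply, Finsupp.single_apply]
    simp only [eq_comm]
  exact DFunLike.congr_fun this x

theorem exists_eq_add_single {n : ℕ} {m : Fin n →₀ ℕ} (hm : m ≠ 0) :
    ∃ (m' : Fin n →₀ ℕ) (j : Fin n), m = m' + Finsupp.single j 1 := by
  obtain ⟨j, hj⟩ := Finsupp.ne_iff.1 hm
  refine ⟨m - Finsupp.single j 1, j, (tsub_add_cancel_of_le ?_).symm⟩
  rw [Finsupp.single_le_iff]
  exact Nat.one_le_iff_ne_zero.2 hj

theorem Dpow_mem (C : FCrystal p k n H) (N : Submodule (PS p k n) H)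
    (hN : ∀ j, ∀ x ∈ N, C.D j x ∈ N) (m : Fin n →₀ ℕ) : ∀ x ∈ N, C.Dpow m x ∈ N := by
  induction hd : m.degree generalizing m with
  | zero =>
    intro x hx
    rw [(Finsupp.degree_eq_zero_iff m).1 hd, Dpow_zero]
    exact hx
  | succ d ih =>
    intro x hx
    obtain ⟨m', j, rfl⟩ := exists_eq_add_single (m := m) (by rintro rfl; simp at hd)
    rw [Dpow_add_single]
    rw [map_add, Finsupp.degree_single] at hd
    exact ih m' (by omega) _ (hN j x hx)

variable [CharP k p] [PerfectRing k p]

/-- The Taylor formula expresses F(φ) x as a p-adic limit of combinations of the F(ψ) D^m x, and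
submodules are closed. Containments therefore need checking for one lift only. -/
theorem Φ_mem_of_Φ_mem (C : FCrystal p k n H) (φ ψ : FrobLift p k n)
    {N N' : Submodule (PS p k n) H} (hN : ∀ j, ∀ x ∈ N, C.D j x ∈ N)
    (h : ∀ x ∈ N, C.Φ ψ x ∈ N') {x : H} (hx : x ∈ N) : C.Φ φ x ∈ N' := by
  obtain ⟨c, -, hc⟩ := C.taylor φ ψ
  refine mem_of_forall_add_pow N' fun m => ?_
  obtain ⟨S, hS⟩ := hc x m
  obtain ⟨y, -, hy⟩ := hS S subset_rfl
  exact ⟨_, N'.sum_mem fun i _ => N'.smul_mem _ (h _ (C.Dpow_mem N hN i x hx)), y,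
    sub_eq_iff_eq_add'.1 hy⟩

theorem D_Φ_stdLift (C : FCrystal p k n H) (i : Fin n) (x : H) :
    C.D i (C.Φ (stdLift p k n) x) =
      ((p : PS p k n) * MvPowerSeries.X i ^ (p - 1)) • C.Φ (stdLift p k n) (C.D i x) := by
  rw [C.horizontal, Finset.sum_eq_single i]
  · rw [dA_stdLift_X, if_pos rfl]
  · intro j _ hj
    rw [dA_stdLift_X, if_neg hj, zero_smul]
  · simp

/-- Since D_i Φ = p t_i^{p-1} Φ D_i for the standard lift, D_i x = p t_i^{p-1} Φ(D_i x) for a fixed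
vector x, and iteration makes D_i x infinitely p-divisible. -/
theorem flat_of_Φ_stdLift_eq (C : FCrystal p k n H) {x : H} (hx : C.Φ (stdLift p k n) x = x)
    (i : Fin n) : C.D i x = 0 := by
  refine pseparated_of_finite p k n H _ fun m => ?_
  induction m with
  | zero => exact ⟨C.D i x, by simp⟩
  | succ m ih =>
    obtain ⟨z, hz⟩ := ih
    refine ⟨(MvPowerSeries.X i : PS p k n) ^ (p - 1) • C.Φ (stdLift p k n) z, ?_⟩
    conv_lhs => rw [← hx, D_Φ_stdLift, hz, map_nsmul, mul_smul, Nat.cast_smul_eq_nsmul]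
    rw [smul_comm _ (p ^ m), smul_smul, pow_succ']

end FCrystal

open Matrix in
/-- A unit `F`-crystal over `k[[t]]`, `k` algebraically closed, is trivial. -/
theorem FCrystal.IsUnit.exists_basis {p : ℕ} [Fact p.Prime] {k : Type u} [Field k] [CharP k p]
    [IsAlgClosed k] {n r : ℕ} {V : FCrystal p k n (Fin r → PS p k n)} (hV : V.IsUnit) :
    ∃ b : Module.Basis (Fin r) (PS p k n) (Fin r → PS p k n),
      (∀ i, V.Φ (stdLift p k n) (b i) = b i) ∧ ∀ j i, V.D j (b i) = 0 := by
  obtain ⟨M, hM⟩ : ∃ M : Matrix (Fin r) (Fin r) (PS p k n), ∀ x : Fin r → PS p k n,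
      V.Φ (stdLift p k n) x = M *ᵥ (fun i => (stdLift p k n).hom (x i)) := by
    refine ⟨Matrix.of fun i j => V.Φ (stdLift p k n) (Pi.single j 1) i, fun x => ?_⟩
    have hx : x = ∑ j, x j • (Pi.single j 1 : Fin r → PS p k n) := by
      simpa using ((Pi.basisFun (PS p k n) (Fin r)).sum_repr x).symm
    conv_lhs => rw [hx, map_sum]
    funext i
    rw [Finset.sum_apply]
    refine Finset.sum_congr rfl fun j _ => ?_
    rw [map_smulₛₗ, Pi.smul_apply, smul_eq_mul, mul_comm]
    rfl
  have hdet : _root_.IsUnit M.det := by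
    rw [← isUnit_iff_isUnit_det, ← Matrix.mulVec_surjective_iff_isUnit]
    intro y
    have hy : y ∈ V.imF (stdLift p k n) := by rw [hV (stdLift p k n)]; trivial
    have hle : V.imF (stdLift p k n) ≤ LinearMap.range M.mulVecLin := by
      rw [FCrystal.imF, Submodule.span_le]
      rintro _ ⟨x, rfl⟩
      exact ⟨fun i => (stdLift p k n).hom (x i), (hM x).symm⟩
    exact hle hy
  obtain ⟨x, hx, hx'⟩ := exists_frame M hdet
  have hbij : Function.Bijective x.mulVecLin := by
    rw [← isUnit_iff_isUnit_det] at hx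
    rw [Matrix.coe_mulVecLin]
    exact ⟨Matrix.mulVec_injective_of_isUnit hx, Matrix.mulVec_surjective_iff_isUnit.2 hx⟩
  let b := (Pi.basisFun (PS p k n) (Fin r)).map (LinearEquiv.ofBijective x.mulVecLin hbij)
  have hb (i : Fin r) : b i = fun l => x l i := by
    funext l
    simp [b]
  have hfix (i : Fin r) : V.Φ (stdLift p k n) (b i) = b i := by
    rw [hM, hb]
    funext l
    exact congrFun (congrFun hx' l) i
  exact ⟨b, hfix, fun j i => V.flat_of_Φ_stdLift_eq (hfix i) j⟩

end CY3

end

noncomputable section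

set_option linter.unusedSectionVars false

namespace CY3

/-! ### Linear algebra for the unit root filtration -/

/-- Coordinates for a decomposition `H = U ⊕ ⨁ R v_j ⊕ E` with `E` free. -/
theorem exists_coordinates {R M ι κ : Type*} [CommRing R] [AddCommGroup M] [Module R M]
    [Fintype ι] [Fintype κ] [DecidableEq ι] [DecidableEq κ] {U E : Submodule R M} (v : ι → M)
    (f : Module.Basis κ R E)
    (hc : IsCompl (U ⊔ Submodule.span R (Set.range v)) E)
    (hv : ∀ a : ι → R, ∑ j, a j • v j ∈ U → a = 0) :
    ∃ (α : M →ₗ[R] ι → R) (β : M →ₗ[R] κ → R),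
      (∀ x, x - ∑ j, α x j • v j - ∑ l, β x l • (f l : M) ∈ U) ∧
      (∀ x ∈ U, α x = 0) ∧ (∀ x ∈ U, β x = 0) ∧ (∀ j, α (v j) = Pi.single j 1) ∧
      (∀ j, β (v j) = 0) ∧ (∀ x ∈ E, α x = 0) ∧ ∀ l, β (f l) = Pi.single l 1 := by
  let Ψ : (U × (ι → R)) × E →ₗ[R] M :=
    (U.subtype.coprod (Fintype.linearCombination R v)).coprod E.subtype
  have hΨ (u : U) (a : ι → R) (e : E) : Ψ ((u, a), e) = u + ∑ j, a j • v j + e := by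
    simp [Ψ, Fintype.linearCombination_apply]
  have hmem (a : ι → R) : ∑ j, a j • v j ∈ Submodule.span R (Set.range v) :=
    Submodule.sum_mem _ fun j _ => Submodule.smul_mem _ _ (Submodule.subset_span ⟨j, rfl⟩)
  have hinj : Function.Injective Ψ := by
    rw [injective_iff_map_eq_zero]
    rintro ⟨⟨u, a⟩, e⟩ h
    rw [hΨ] at h
    have h1 : (u + ∑ j, a j • v j : M) = 0 := by
      refine Submodule.disjoint_def.1 hc.disjoint _ (Submodule.add_mem_sup u.2 (hmem a)) ?_
      rw [eq_neg_of_add_eq_zero_left h]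
      exact E.neg_mem e.2
    have ha : a = 0 := by
      refine hv a ?_
      rw [eq_neg_of_add_eq_zero_right h1]
      exact U.neg_mem u.2
    subst ha
    have hu : u = 0 := by ext; simpa using h1
    subst hu
    have he : e = 0 := by ext; simpa using h
    subst he
    rfl
  have hsurj : Function.Surjective Ψ := by
    intro x
    obtain ⟨y, hy, e, he, rfl⟩ := Submodule.mem_sup.1
      (hc.sup_eq_top ▸ Submodule.mem_top : x ∈ (U ⊔ Submodule.span R (Set.range v)) ⊔ E)
    obtain ⟨u, hu, w, hw, rfl⟩ := Submodule.mem_sup.1 hy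
    obtain ⟨a, rfl⟩ := (Submodule.mem_span_range_iff_exists_fun R).1 hw
    exact ⟨((⟨u, hu⟩, a), ⟨e, he⟩), hΨ _ _ _⟩
  let Θ := LinearEquiv.ofBijective Ψ ⟨hinj, hsurj⟩
  have hΘ (u : U) (a : ι → R) (e : E) :
      Θ.symm (u + ∑ j, a j • v j + e) = ((u, a), e) := by
    rw [LinearEquiv.symm_apply_eq]
    exact (hΨ u a e).symm
  have hΘU {x : M} (hx : x ∈ U) : Θ.symm x = ((⟨x, hx⟩, 0), 0) := by
    simpa using hΘ ⟨x, hx⟩ 0 0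
  have hΘE {x : M} (hx : x ∈ E) : Θ.symm x = ((0, 0), ⟨x, hx⟩) := by
    simpa using hΘ 0 0 ⟨x, hx⟩
  have hΘv (j : ι) : Θ.symm (v j) = ((0, Pi.single j 1), 0) := by
    have := hΘ 0 (Pi.single j 1) 0
    simpa [Pi.single_apply, ite_smul] using this
  refine ⟨LinearMap.snd R U (ι → R) ∘ₗ LinearMap.fst R (U × (ι → R)) E ∘ₗ Θ.symm.toLinearMap,
    f.equivFun.toLinearMap ∘ₗ LinearMap.snd R (U × (ι → R)) E ∘ₗ Θ.symm.toLinearMap,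
    fun x => ?_, fun x hx => ?_, fun x hx => ?_, fun j => ?_, fun j => ?_, fun x hx => ?_,
    fun l => ?_⟩
  · obtain ⟨⟨⟨u, a⟩, e⟩, rfl⟩ := hsurj x
    rw [hΨ]
    simp only [LinearMap.comp_apply, LinearEquiv.coe_coe, hΘ, LinearMap.fst_apply,
      LinearMap.snd_apply]
    have : (e : M) = ∑ l, f.equivFun e l • (f l : M) := by
      have h := congrArg E.subtype (f.sum_equivFun e)
      rw [map_sum] at h
      exact h.symm
    rw [← this, add_sub_right_comm, add_sub_assoc, sub_self, add_zero, add_sub_assoc, sub_self,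
      add_zero]
    exact u.2
  all_goals simp only [LinearMap.comp_apply, LinearEquiv.coe_coe, LinearMap.fst_apply,
    LinearMap.snd_apply]
  · rw [hΘU hx]
  · rw [hΘU hx, map_zero]
  · rw [hΘv]
  · rw [hΘv, map_zero]
  · rw [hΘE hx]
  · rw [hΘE (f l).2]
    ext i
    simp [Pi.single_apply, eq_comm]

/-! ### Invertibility modulo p and the graph transform. -/

section Graph

variable {p : ℕ} [Fact p.Prime] {k : Type u} [Field k] [CharP k p] [PerfectRing k p] {n : ℕ}

theorem isUnit_of_isUnit_reduce {a : PS p k n} (h : IsUnit (reduce p k n a)) : IsUnit a := by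
  rw [MvPowerSeries.isUnit_iff_constantCoeff] at h ⊢
  refine WittVector.isUnit_of_coeff_zero_ne_zero _ ?_
  have := h.ne_zero
  rwa [reduce, MvPowerSeries.constantCoeff_map, WittVector.constantCoeff_apply] at this

theorem isUnit_det_congr {r : Type*} [Fintype r] [DecidableEq r] {a : Matrix r r (PS p k n)}
    (ha : IsUnit a.det) (z : Matrix r r (PS p k n)) : IsUnit (a + p • z).det := by
  refine isUnit_of_isUnit_reduce ?_
  have h : (a + p • z).map (reduce p k n) = a.map (reduce p k n) := by
    ext1 i j
    simp only [Matrix.map_apply, Matrix.add_apply, Matrix.smul_apply]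
    rw [nsmul_eq_mul, map_add, map_mul, reduce_natCast, zero_mul, add_zero]
  have h' := ha.map (reduce p k n)
  rw [RingHom.map_det] at h' ⊢
  rwa [RingHom.mapMatrix_apply, h]

/-- The graph transform: an invariant graph for `(a, p b; c, p d)` with `a` invertible. -/
theorem exists_invariant_graph {r s : Type*} [Fintype r] [DecidableEq r] [Fintype s]
    (φ : PS p k n →+* PS p k n) (a : Matrix r r (PS p k n)) (b : Matrix r s (PS p k n))
    (c : Matrix s r (PS p k n)) (d : Matrix s s (PS p k n)) (ha : IsUnit a.det) :
    ∃ X : Matrix s r (PS p k n), c + p • (d * X.map φ) = X * (a + p • (b * X.map φ)) := by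
  -- Invariance of the graph means X = (c + p d φ(X)) (a + p b φ(X))⁻¹. As X enters the right-hand
  -- side only through p φ(X), that side is a p-adic contraction.
  obtain ⟨X, hX⟩ := exists_fixedPoint ((ps_pcomplete p k n).matrix s r)
    ((ps_pseparated p k n).matrix s r)
    (fun X => (c + p • (d * X.map φ)) * (a + p • (b * X.map φ))⁻¹) (by
      intro m X Y Z h
      have hX : X.map φ = Y.map φ + p ^ m • Z.map φ := by
        rw [sub_eq_iff_eq_add'.1 h, Matrix.map_add _ (map_add _), matrix_map_nsmul]
      set ΔX := a + p • (b * X.map φ) with hΔX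
      set ΔY := a + p • (b * Y.map φ) with hΔY
      have hXu : IsUnit ΔX.det := isUnit_det_congr ha _
      have hYu : IsUnit ΔY.det := isUnit_det_congr ha _
      have h1 : ΔX = ΔY + p ^ (m + 1) • (b * Z.map φ) := by
        rw [hΔX, hΔY, hX, Matrix.mul_add, smul_add, Matrix.mul_smul, smul_smul, pow_succ',
          add_assoc]
      have h2 : c + p • (d * X.map φ) = (c + p • (d * Y.map φ)) + p ^ (m + 1) • (d * Z.map φ) := by
        rw [hX, Matrix.mul_add, smul_add, Matrix.mul_smul, smul_smul, pow_succ', add_assoc]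
      -- The resolvent identity.
      have h3 : ΔX⁻¹ = ΔY⁻¹ - p ^ (m + 1) • (ΔX⁻¹ * (b * Z.map φ) * ΔY⁻¹) := by
        have : ΔX⁻¹ * ΔX * ΔY⁻¹ = ΔX⁻¹ * (ΔY + p ^ (m + 1) • (b * Z.map φ)) * ΔY⁻¹ := by rw [← h1]
        rw [Matrix.nonsing_inv_mul _ hXu, Matrix.one_mul, Matrix.mul_add, Matrix.add_mul,
          Matrix.mul_assoc, Matrix.mul_nonsing_inv _ hYu, Matrix.mul_one, Matrix.mul_smul,
          Matrix.smul_mul] at this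
        exact eq_sub_of_add_eq this.symm
      refine ⟨(d * Z.map φ) * ΔX⁻¹ -
        (c + p • (d * Y.map φ)) * (ΔX⁻¹ * (b * Z.map φ) * ΔY⁻¹), ?_⟩
      change (c + p • (d * X.map φ)) * ΔX⁻¹ - (c + p • (d * Y.map φ)) * ΔY⁻¹ = _
      rw [h2, Matrix.add_mul, smul_sub, Matrix.smul_mul]
      nth_rewrite 1 [h3]
      rw [Matrix.mul_sub, Matrix.mul_smul]
      abel)
  refine ⟨X, ?_⟩
  have hu : IsUnit (a + p • (b * X.map φ)).det := isUnit_det_congr ha _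
  nth_rewrite 2 [← hX]
  rw [Matrix.mul_assoc, Matrix.nonsing_inv_mul _ hu, Matrix.mul_one]

end Graph

end CY3

end

noncomputable section

set_option linter.unusedSectionVars false

namespace CY3

/-! ### The part of H of slopes below i, and lifts of a basis of gr_i H_0. -/

section Slope

variable {p : ℕ} [Fact p.Prime] {k : Type u} [Field k] [CharP k p] [PerfectRing k p] {n : ℕ}
variable {H : Type v} [AddCommGroup H] [Module (PS p k n) H]
  [Module.Free (PS p k n) H] [Module.Finite (PS p k n) H]

namespace FCrystal

variable (C : FCrystal p k n H)

/-- `F` for the standard lift. -/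
abbrev Φ₀ : H →ₛₗ[(stdLift p k n).hom] H := C.Φ (stdLift p k n)

theorem conjFil_mono (i : ℕ) : C.conjFil i ≤ C.conjFil (i + 1) := by
  rw [conjFil, conjFil]
  refine Submodule.map_mono fun x hx => ?_
  simp only [Submodule.mem_comap, LinearMap.lsmul_apply] at hx ⊢
  rw [pow_succ', mul_smul]
  exact Submodule.smul_mem _ _ hx

theorem mem_conjFil {i : ℕ} {x : H} (hx : p ^ i • x ∈ C.imF (stdLift p k n)) :
    (pPow p k n H 1).mkQ x ∈ C.conjFil i :=
  Submodule.mem_map_of_mem (by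
    rwa [Submodule.mem_comap, LinearMap.lsmul_apply, cast_pow_smul])

theorem mkQ_eq_iff {x y : H} :
    (pPow p k n H 1).mkQ x = (pPow p k n H 1).mkQ y ↔ ∃ z, x = y + p • z := by
  rw [← sub_eq_zero, ← map_sub, Submodule.mkQ_apply, Submodule.Quotient.mk_eq_zero, mem_pPow_one]
  simp only [sub_eq_iff_eq_add']

theorem mem_hodgeFil {i : ℕ} {x : H} (hx : (pPow p k n H 1).mkQ x ∈ C.hodgeFil i) :
    ∃ l z y : H, x = l + p • z ∧ C.Φ₀ l = p ^ i • y := by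
  obtain ⟨l, hl, hlx⟩ := hx
  obtain ⟨z, hz⟩ := mkQ_eq_iff.1 hlx.symm
  obtain ⟨y, hy⟩ := mem_pPow.1 hl
  exact ⟨l, z, y, hz, hy⟩

/-- `gr_i H_0` free: a basis lifts to vectors `v_j` of `H` with `p ^ i v_j ∈ Im F`. -/
theorem exists_lifts_of_hasHodgeNumber {i r : ℕ} (h : C.HasHodgeNumber i r) :
    ∃ v : Fin r → H, (∀ j, p ^ i • v j ∈ C.imF (stdLift p k n)) ∧
      (∀ x ∈ C.conjFil i, ∃ a : Fin r → PS p k n,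
        x - (pPow p k n H 1).mkQ (∑ j, a j • v j) ∈ C.conjFilPred i) ∧
      ∀ a : Fin r → PS p k n, (pPow p k n H 1).mkQ (∑ j, a j • v j) ∈ C.conjFilPred i →
        ∃ b : Fin r → PS p k n, ∀ j, a j = p * b j := by
  obtain ⟨E⟩ := h
  have hv (j : Fin r) : ∃ v : H, ∃ hv : (pPow p k n H 1).mkQ v ∈ C.conjFil i,
      p ^ i • v ∈ C.imF (stdLift p k n) ∧
      E (((C.conjFilPred i).submoduleOf (C.conjFil i)).mkQ ⟨(pPow p k n H 1).mkQ v, hv⟩) = Pi.single j 1 := by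
    obtain ⟨⟨w, hw⟩, hw'⟩ := Submodule.Quotient.mk_surjective _ (E.symm (Pi.single j 1))
    obtain ⟨v, hv, rfl⟩ := hw
    refine ⟨v, ⟨v, hv, rfl⟩, ?_, ?_⟩
    · simpa [cast_pow_smul] using hv
    · rw [Submodule.mkQ_apply, hw', LinearEquiv.apply_symm_apply]
  choose v hvmem hvim hvE using hv
  have hsum (a : Fin r → PS p k n) : (pPow p k n H 1).mkQ (∑ j, a j • v j) ∈ C.conjFil i := by
    rw [map_sum]
    exact Submodule.sum_mem _ fun j _ => by
      rw [map_smul]; exact Submodule.smul_mem _ _ (hvmem j)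
  have hE (a : Fin r → PS p k n) :
      E (((C.conjFilPred i).submoduleOf (C.conjFil i)).mkQ
        ⟨(pPow p k n H 1).mkQ (∑ j, a j • v j), hsum a⟩) =
        fun j => Ideal.Quotient.mk _ (a j) := by
    have h1 : (⟨(pPow p k n H 1).mkQ (∑ j, a j • v j), hsum a⟩ : C.conjFil i) =
        ∑ j, a j • ⟨(pPow p k n H 1).mkQ (v j), hvmem j⟩ := by
      ext
      simp [map_sum]
    rw [h1, map_sum, map_sum]
    funext l
    simp only [LinearMap.map_smul, LinearEquiv.map_smul, hvE]
    rw [Finset.sum_apply, Finset.sum_eq_single l]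
    · rw [Pi.smul_apply, Pi.single_eq_same]
      exact congrArg (Ideal.Quotient.mk (Ideal.span {(p : PS p k n)})) (mul_one (a l))
    · intro j _ hj
      rw [Pi.smul_apply, Pi.single_eq_of_ne hj.symm, smul_zero]
    · simp
  refine ⟨v, hvim, fun x hx => ?_, fun a ha => ?_⟩
  · choose a ha using fun j => Ideal.Quotient.mk_surjective (E (Submodule.Quotient.mk ⟨x, hx⟩) j)
    refine ⟨a, ?_⟩
    have h1 := (hE a).trans (funext ha)
    have h2 := (Submodule.Quotient.eq _).1 (E.injective h1).symm
    exact h2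
  · have h1 : (Submodule.Quotient.mk ⟨(pPow p k n H 1).mkQ (∑ j, a j • v j), hsum a⟩ :
        C.conjFil i ⧸ (C.conjFilPred i).submoduleOf (C.conjFil i)) = 0 :=
      (Submodule.Quotient.mk_eq_zero _).2 ha
    have h2 := hE a
    rw [Submodule.mkQ_apply, h1, map_zero] at h2
    have h3 (j : Fin r) : ∃ b, a j = p * b := by
      have := (congrFun h2 j).symm
      rw [Pi.zero_apply, Ideal.Quotient.eq_zero_iff_mem, Ideal.mem_span_singleton] at this
      exact this
    choose b hb using h3
    exact ⟨b, hb⟩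

variable {C}

/-- `U` is the part of `H` of slopes `< i`, a complement of `Fil^i`. -/
structure IsSlopePart (𝓕 : HodgeFiltration C) (i : ℕ) (U : Submodule (PS p k n) H) : Prop where
  compl : IsCompl U (𝓕.fil i)
  stable : ∀ x ∈ U, C.Φ₀ x ∈ U
  -- For `i = 0` the truncated exponent does no harm, since then `compl` forces `U = ⊥`.
  slope : ∀ x ∈ U, p ^ (i - 1) • x ∈ Submodule.span (PS p k n) (C.Φ₀ '' U)

namespace IsSlopePart

variable {𝓕 : HodgeFiltration C} {i : ℕ} {U : Submodule (PS p k n) H}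

theorem saturated (h : IsSlopePart 𝓕 i U) {m : ℕ} {x : H} (hx : p ^ m • x ∈ U) : x ∈ U :=
  mem_of_pow_smul_mem h.compl.disjoint h.compl.sup_eq_top hx

theorem span_le (h : IsSlopePart 𝓕 i U) : Submodule.span (PS p k n) (C.Φ₀ '' U) ≤ U := by
  rw [Submodule.span_le]
  rintro _ ⟨x, hx, rfl⟩
  exact h.stable x hx

/-- `H` is the sum of `U` and of `{l | F l ∈ p ^ i H}`. -/
theorem exists_add (h : IsSlopePart 𝓕 i U) (x : H) :
    ∃ u ∈ U, ∃ l y, x = u + l ∧ C.Φ₀ l = p ^ i • y := by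
  have key : U ⊔ (pPow p k n H i).comap C.Φ₀ = ⊤ := by
    refine eq_top_of_sup_pPow (eq_top_iff.2 fun x _ => ?_)
    obtain ⟨u, hu, f, hf, rfl⟩ := Submodule.mem_sup.1
      (h.compl.sup_eq_top ▸ Submodule.mem_top : x ∈ U ⊔ 𝓕.fil i)
    obtain ⟨l, z, y, rfl, hl⟩ := C.mem_hodgeFil
      ((𝓕.lifts i).1 ▸ Submodule.mem_map_of_mem hf : (pPow p k n H 1).mkQ f ∈ C.hodgeFil i)
    rw [← add_assoc]
    exact Submodule.add_mem_sup (Submodule.add_mem_sup hu (mem_pPow.2 ⟨y, hl⟩))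
      (mem_pPow_one.2 ⟨z, rfl⟩)
  obtain ⟨u, hu, l, hl, rfl⟩ := Submodule.mem_sup.1 (key ▸ Submodule.mem_top : x ∈ U ⊔ _)
  obtain ⟨y, hy⟩ := mem_pPow.1 hl
  exact ⟨u, hu, l, y, rfl, hy⟩

theorem exists_Φ₀_eq (h : IsSlopePart 𝓕 i U) (x : H) : ∃ u ∈ U, ∃ y, C.Φ₀ x = u + p ^ i • y := by
  obtain ⟨u, hu, l, y, rfl, hl⟩ := h.exists_add x
  exact ⟨_, h.stable u hu, y, by rw [map_add, hl]⟩

theorem eq_bot (h : IsSlopePart 𝓕 0 U) : U = ⊥ := by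
  have := h.compl
  rw [𝓕.fil_zero] at this
  exact eq_bot_of_isCompl_top this

/-- The slope condition places U mod p inside Fil_{i-1} H_0. Both are complements of Fil^i H_0, so
modularity of the submodule lattice makes them equal. -/
theorem lifts (hO : C.IsOrdinary) (h : IsSlopePart 𝓕 i U) : LiftsTo U (C.conjFilPred i) := by
  refine ⟨?_, fun x hx hx' => ?_⟩
  · cases i with
    | zero => rw [h.eq_bot, Submodule.map_bot]; rfl
    | succ i =>
      refine eq_of_le_of_inf_le_of_sup_le (z := C.hodgeFil (i + 1)) ?_ ?_ ?_
      · rintro _ ⟨x, hx, rfl⟩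
        refine C.mem_conjFil ?_
        refine Submodule.span_mono (Set.image_subset_range _ _) (h.slope x hx)
      · change C.conjFil i ⊓ _ ≤ _
        rw [(hO.2 i).inf_eq_bot]
        exact bot_le
      · rw [← (𝓕.lifts (i + 1)).1, ← Submodule.map_sup, h.compl.sup_eq_top, Submodule.map_top,
          Submodule.range_mkQ]
        exact le_top
  · obtain ⟨y, rfl⟩ := mem_pPow_one.1 hx'
    exact ⟨y, h.saturated (m := 1) (by rwa [pow_one]), rfl⟩

theorem bot (𝓕 : HodgeFiltration C) : IsSlopePart 𝓕 0 ⊥ where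
  compl := by rw [𝓕.fil_zero]; exact isCompl_bot_top
  stable x hx := by
    rw [(Submodule.mem_bot _).1 hx, map_zero]; exact zero_mem _
  slope x hx := by
    rw [(Submodule.mem_bot _).1 hx, smul_zero]; exact zero_mem _

/-- Complement of `Fil^{i+1}` obtained by lifting a basis of `gr_i H_0`. -/
theorem exists_lifts (hO : C.IsOrdinary) (h : IsSlopePart 𝓕 i U) {r : ℕ}
    (hr : C.HasHodgeNumber i r) :
    ∃ v : Fin r → H, (∀ j, p ^ i • v j ∈ C.imF (stdLift p k n)) ∧
      IsCompl (U ⊔ Submodule.span (PS p k n) (Set.range v)) (𝓕.fil (i + 1)) ∧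
      ∀ a : Fin r → PS p k n, ∑ j, a j • v j ∈ U → a = 0 := by
  obtain ⟨v, hv1, hv2, hv3⟩ := C.exists_lifts_of_hasHodgeNumber hr
  have hU := h.lifts hO
  -- The v_j are a basis of gr_i H_0, so a combination lying in U + pH has all its coefficients
  -- divisible by p.
  have hp1 (a : Fin r → PS p k n) (ha : ∑ j, a j • v j ∈ U ⊔ pPow p k n H 1) :
      ∃ b : Fin r → PS p k n, a = p • b := by
    obtain ⟨u, hu, z, hz, huz⟩ := Submodule.mem_sup.1 ha
    obtain ⟨z, rfl⟩ := mem_pPow_one.1 hz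
    obtain ⟨b, hb⟩ := hv3 a (by
      rw [mkQ_eq_iff.2 ⟨z, huz.symm⟩, ← hU.1]
      exact Submodule.mem_map_of_mem hu)
    exact ⟨b, by funext j; rw [hb, Pi.smul_apply, nsmul_eq_mul]⟩
  have hsmul (b : Fin r → PS p k n) : ∑ j, (p • b) j • v j = p • ∑ j, b j • v j := by
    rw [Finset.smul_sum]
    exact Finset.sum_congr rfl fun j _ => by rw [Pi.smul_apply, smul_assoc]
  refine ⟨v, hv1, isCompl_of_liftsTo (N₀ := C.conjFil i) ⟨le_antisymm ?_ ?_, ?_⟩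
    (𝓕.lifts (i + 1)) (hO.2 i), fun a ha => ?_⟩
  · have hle : C.conjFilPred i ≤ C.conjFil i := by
      cases i with
      | zero => exact bot_le
      | succ i => exact C.conjFil_mono i
    rw [Submodule.map_sup, hU.1, sup_le_iff, Submodule.map_span_le]
    refine ⟨hle, ?_⟩
    rintro _ ⟨j, rfl⟩
    exact C.mem_conjFil (hv1 j)
  · intro x hx
    obtain ⟨a, ha⟩ := hv2 x hx
    rw [← hU.1] at ha
    obtain ⟨u, hu, hux⟩ := ha
    refine ⟨u + ∑ j, a j • v j, Submodule.add_mem_sup hu (Submodule.sum_mem _ fun j _ =>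
      Submodule.smul_mem _ _ (Submodule.subset_span ⟨j, rfl⟩)), ?_⟩
    rw [map_add, hux, sub_add_cancel]
  · intro x hx hx'
    obtain ⟨u, hu, w, hw, rfl⟩ := Submodule.mem_sup.1 hx
    obtain ⟨a, rfl⟩ := (Submodule.mem_span_range_iff_exists_fun _).1 hw
    obtain ⟨b, rfl⟩ := hp1 a (by
      have := Submodule.add_mem_sup (U.neg_mem hu) hx'
      rwa [neg_add_cancel_left] at this)
    rw [hsmul] at hx' ⊢
    obtain ⟨u', hu', rfl⟩ := hU.2 u hu (by
      have := Submodule.sub_mem _ hx'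
        (mem_pPow_one.2 ⟨∑ j, b j • v j, rfl⟩ : p • ∑ j, b j • v j ∈ pPow p k n H 1)
      rwa [add_sub_cancel_right] at this)
    exact ⟨u' + ∑ j, b j • v j, Submodule.add_mem_sup hu' (Submodule.sum_mem _ fun j _ =>
      Submodule.smul_mem _ _ (Submodule.subset_span ⟨j, rfl⟩)), by rw [smul_add]⟩
  · refine (ps_pseparated p k n).pi a fun m => ?_
    -- Dividing by p, which saturation of U permits, and repeating shows that the coefficients are
    -- infinitely p-divisible.
    induction m generalizing a with
    | zero => exact ⟨a, by simp⟩
    | succ m ih =>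
      obtain ⟨b, rfl⟩ := hp1 a (Submodule.mem_sup_left ha)
      rw [hsmul] at ha
      obtain ⟨z, rfl⟩ := ih b (h.saturated (m := 1) (by rwa [pow_one]))
      exact ⟨z, by rw [smul_smul, pow_succ']⟩

end IsSlopePart

end FCrystal

end Slope

end CY3

end

noncomputable section

set_option linter.unusedSectionVars false

namespace CY3

/-! ### Block form of the Frobenius modulo U and the invariant graph. -/

section Slope

variable {p : ℕ} [Fact p.Prime] {k : Type u} [Field k] [CharP k p] [PerfectRing k p] {n : ℕ}
variable {H : Type v} [AddCommGroup H] [Module (PS p k n) H]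
  [Module.Free (PS p k n) H] [Module.Finite (PS p k n) H]

namespace FCrystal.IsSlopePart

variable {C : FCrystal p k n H} {𝓕 : HodgeFiltration C} {i : ℕ} {U : Submodule (PS p k n) H}

/-- Write x = l + p z with F l divisible by p^{i+1}. Since F z lies in U + p^i H, the term p F z
also gains the exponent i + 1. This is the extra factor p in the columns of Fil^{i+1}. -/
theorem exists_Φ₀_fil_eq (h : IsSlopePart 𝓕 i U) {x : H} (hx : x ∈ 𝓕.fil (i + 1)) :
    ∃ u ∈ U, ∃ y, C.Φ₀ x = u + p ^ (i + 1) • y := by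
  obtain ⟨l, z, y, rfl, hl⟩ := C.mem_hodgeFil
    ((𝓕.lifts (i + 1)).1 ▸ Submodule.mem_map_of_mem hx :
      (pPow p k n H 1).mkQ x ∈ C.hodgeFil (i + 1))
  obtain ⟨u, hu, y', hy'⟩ := h.exists_Φ₀_eq z
  refine ⟨p • u, U.smul_of_tower_mem p hu, y + y', ?_⟩
  rw [map_add, hl, map_nsmul, hy', smul_add, smul_add, smul_smul, pow_succ']
  abel

/-- The matrix of `p ^ (-i) F` modulo `U` in a basis adapted to `H = U ⊕ ⟨v⟩ ⊕ Fil^{i+1}`. -/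
theorem exists_blocks (h : IsSlopePart 𝓕 i U) {r s : Type*} [Fintype r] [Fintype s]
    [DecidableEq r] [DecidableEq s] {v : r → H} {f : s → H} (hf : ∀ l, f l ∈ 𝓕.fil (i + 1))
    {α : H →ₗ[PS p k n] r → PS p k n} {β : H →ₗ[PS p k n] s → PS p k n}
    (hαU : ∀ x ∈ U, α x = 0) (hβU : ∀ x ∈ U, β x = 0) :
    ∃ (a : Matrix r r (PS p k n)) (b : Matrix r s (PS p k n)) (c : Matrix s r (PS p k n))
      (d : Matrix s s (PS p k n)),
      (∀ j, α (C.Φ₀ (v j)) = p ^ i • fun q => a q j) ∧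
      (∀ j, β (C.Φ₀ (v j)) = p ^ i • fun q => c q j) ∧
      (∀ j, α (C.Φ₀ (f j)) = p ^ (i + 1) • fun q => b q j) ∧
      (∀ j, β (C.Φ₀ (f j)) = p ^ (i + 1) • fun q => d q j) := by
  choose u hu y hy using fun j => h.exists_Φ₀_eq (v j)
  choose u' hu' y' hy' using fun j => h.exists_Φ₀_fil_eq (hf j)
  refine ⟨Matrix.of fun q j => α (y j) q, Matrix.of fun q j => α (y' j) q,
    Matrix.of fun q j => β (y j) q, Matrix.of fun q j => β (y' j) q, ?_, ?_, ?_, ?_⟩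
  · intro j; rw [hy, map_add, hαU _ (hu j), zero_add, map_nsmul]; rfl
  · intro j; rw [hy, map_add, hβU _ (hu j), zero_add, map_nsmul]; rfl
  · intro j; rw [hy', map_add, hαU _ (hu' j), zero_add, map_nsmul]; rfl
  · intro j; rw [hy', map_add, hβU _ (hu' j), zero_add, map_nsmul]; rfl

theorem Φ₀_sum {r : Type*} [Fintype r] (a : r → PS p k n) (v : r → H) :
    C.Φ₀ (∑ j, a j • v j) = ∑ j, (stdLift p k n).hom (a j) • C.Φ₀ (v j) := by
  rw [map_sum]
  exact Finset.sum_congr rfl fun j _ => map_smulₛₗ _ _ _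

/-- Modulo U and p^{i+1}, the v-components of the image of F are p^i times values of a. As p^i v_j
lies in that image, a has a right inverse modulo p, hence a unit determinant. -/
theorem isUnit_det_block {r s : Type*} [Fintype r] [Fintype s]
    [DecidableEq r] [DecidableEq s] {v : r → H} {f : s → H}
    (hstable : ∀ x ∈ U, C.Φ₀ x ∈ U)
    {α : H →ₗ[PS p k n] r → PS p k n} {β : H →ₗ[PS p k n] s → PS p k n}
    (hαU : ∀ x ∈ U, α x = 0)
    (hdec : ∀ x, x - ∑ j, α x j • v j - ∑ l, β x l • f l ∈ U)
    (hαv : ∀ j, α (v j) = Pi.single j 1)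
    {a : Matrix r r (PS p k n)} {b : Matrix r s (PS p k n)}
    (ha : ∀ j, α (C.Φ₀ (v j)) = p ^ i • fun q => a q j)
    (hb : ∀ j, α (C.Φ₀ (f j)) = p ^ (i + 1) • fun q => b q j)
    (hv : ∀ j, p ^ i • v j ∈ C.imF (stdLift p k n)) : _root_.IsUnit a.det := by
  have key : ∀ y ∈ C.imF (stdLift p k n), ∃ w w' : r → PS p k n,
      α y = p ^ i • (a.mulVec w + p • w') := by
    intro y hy
    induction hy using Submodule.span_induction with
    | mem y hy =>
      obtain ⟨x, rfl⟩ := hy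
      have hx : C.Φ₀ x = C.Φ₀ (x - ∑ j, α x j • v j - ∑ l, β x l • f l) +
          (∑ j, (stdLift p k n).hom (α x j) • C.Φ₀ (v j)) +
          ∑ j, (stdLift p k n).hom (β x j) • C.Φ₀ (f j) := by
        rw [← Φ₀_sum, ← Φ₀_sum, ← map_add, ← map_add]
        congr 1
        abel
      refine ⟨fun j => (stdLift p k n).hom (α x j),
        b.mulVec fun j => (stdLift p k n).hom (β x j), ?_⟩
      rw [show C.Φ (stdLift p k n) x = C.Φ₀ x from rfl, hx, map_add, map_add,
        hαU _ (hstable _ (hdec x)), zero_add, map_sum, map_sum]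
      simp only [map_smul, ha, hb]
      rw [smul_add, smul_smul, ← pow_succ]
      funext q
      simp only [Pi.add_apply, Finset.sum_apply, Pi.smul_apply, Matrix.mulVec, dotProduct,
        Finset.smul_sum]
      congr 1 <;> refine Finset.sum_congr rfl fun j _ => ?_ <;>
        rw [smul_comm, smul_eq_mul, mul_comm]
    | zero => exact ⟨0, 0, by simp⟩
    | add x y _ _ hx hy =>
      obtain ⟨w, w', hx⟩ := hx
      obtain ⟨z, z', hy⟩ := hy
      refine ⟨w + z, w' + z', ?_⟩
      rw [map_add, hx, hy, Matrix.mulVec_add]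
      simp only [smul_add]
      abel
    | smul c x _ hx =>
      obtain ⟨w, w', hx⟩ := hx
      refine ⟨c • w, c • w', ?_⟩
      rw [map_smul, hx, Matrix.mulVec_smul, smul_comm c, smul_add, smul_comm c p]
  choose w w' hw using fun j => key _ (hv j)
  have h1 : a * Matrix.of (fun q j => w j q) = 1 + p • -Matrix.of (fun q j => w' j q) := by
    ext1 q j
    have h2 := hw j
    rw [map_nsmul, hαv] at h2
    have h3 := congrFun h2 q
    rw [Pi.smul_apply, Pi.smul_apply] at h3
    have h4 : (Pi.single j 1 : r → PS p k n) q = (a.mulVec (w j) + p • w' j) q :=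
      pow_smul_cancel k n h3
    rw [Pi.add_apply, Pi.smul_apply] at h4
    rw [Matrix.add_apply, Matrix.smul_apply, Matrix.neg_apply, Matrix.of_apply, smul_neg,
      ← sub_eq_add_neg, eq_sub_iff_add_eq, Matrix.one_apply]
    rw [Pi.single_apply] at h4
    exact h4.symm
  have h2 : _root_.IsUnit (a * Matrix.of (fun q j => w j q)).det := by
    rw [h1]
    exact isUnit_det_congr (by rw [Matrix.det_one]; exact isUnit_one) _
  rw [Matrix.det_mul] at h2
  exact isUnit_of_mul_isUnit_left h2

/-- Vectors spanning, together with `U`, the part of slopes `≤ i`. -/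
theorem exists_frame_of_lifts (h : IsSlopePart 𝓕 i U) {r : ℕ} {v : Fin r → H}
    (hv : ∀ j, p ^ i • v j ∈ C.imF (stdLift p k n))
    (hc : IsCompl (U ⊔ Submodule.span (PS p k n) (Set.range v)) (𝓕.fil (i + 1)))
    (hind : ∀ a : Fin r → PS p k n, ∑ j, a j • v j ∈ U → a = 0) :
    ∃ (w : Fin r → H) (α : H →ₗ[PS p k n] Fin r → PS p k n) (Δ : Matrix (Fin r) (Fin r) (PS p k n)),
      (∀ x ∈ U, α x = 0) ∧ (∀ j, α (w j) = Pi.single j 1) ∧ (∀ x ∈ 𝓕.fil (i + 1), α x = 0) ∧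
      IsCompl (U ⊔ Submodule.span (PS p k n) (Set.range w)) (𝓕.fil (i + 1)) ∧
      _root_.IsUnit Δ.det ∧ ∀ j, C.Φ₀ (w j) - p ^ i • ∑ q, Δ q j • w q ∈ U := by
  classical
  have : Module.Free (PS p k n) (𝓕.fil (i + 1)) := 𝓕.free (i + 1)
  let f := Module.Free.chooseBasis (PS p k n) (𝓕.fil (i + 1))
  obtain ⟨α, β, hdec, hαU, hβU, hαv, hβv, hαE, hβf⟩ := exists_coordinates v f hc hind
  obtain ⟨a, b, c, d, ha, hc', hb, hd⟩ := h.exists_blocks (v := v) (fun l => (f l).2) hαU hβU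
  have hdet := isUnit_det_block h.stable hαU hdec hαv ha hb hv
  obtain ⟨X, hX⟩ := exists_invariant_graph (stdLift p k n).hom a b c d hdet
  set Δ := a + p • (b * X.map (stdLift p k n).hom) with hΔ
  -- The graph of X over the span of v: modulo U, Frobenius sends w_j to p^i ∑ Δ_{qj} w_q.
  let w : Fin r → H := fun j => v j + ∑ l, X l j • (f l : H)
  have hfil (j : Fin r) : ∑ l, X l j • (f l : H) ∈ 𝓕.fil (i + 1) :=
    Submodule.sum_mem _ fun l _ => Submodule.smul_mem _ _ (f l).2
  have hαw (j : Fin r) : α (w j) = Pi.single j 1 := by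
    rw [map_add, hαv, hαE _ (hfil j), add_zero]
  have hβw (j : Fin r) : β (w j) = fun l => X l j := by
    rw [map_add, hβv, zero_add, map_sum]
    simp only [map_smul, hβf]
    funext l
    simp [Finset.sum_apply, Pi.single_apply]
  have hΦw (j : Fin r) : C.Φ₀ (w j) =
      C.Φ₀ (v j) + ∑ l, (stdLift p k n).hom (X l j) • C.Φ₀ (f l : H) := by
    rw [map_add, Φ₀_sum]
  have hαΦ (j : Fin r) : α (C.Φ₀ (w j)) = p ^ i • fun q => Δ q j := by
    rw [hΦw, map_add, map_sum]
    simp only [map_smul, ha, hb, hΔ]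
    funext q
    simp only [Pi.add_apply, Finset.sum_apply, Pi.smul_apply, Matrix.add_apply, Matrix.smul_apply,
      Matrix.mul_apply, Matrix.map_apply, smul_add, Finset.smul_sum]
    congr 1
    refine Finset.sum_congr rfl fun l _ => ?_
    rw [smul_smul, ← pow_succ, smul_comm, smul_eq_mul, mul_comm]
  have hβΦ (j : Fin r) : β (C.Φ₀ (w j)) = p ^ i • fun q => (X * Δ) q j := by
    rw [← hX, hΦw, map_add, map_sum]
    simp only [map_smul, hc', hd]
    funext q
    simp only [Pi.add_apply, Finset.sum_apply, Pi.smul_apply, Matrix.add_apply, Matrix.smul_apply,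
      Matrix.mul_apply, Matrix.map_apply, smul_add, Finset.smul_sum]
    congr 1
    refine Finset.sum_congr rfl fun l _ => ?_
    rw [smul_smul, ← pow_succ, smul_comm, smul_eq_mul, mul_comm]
  refine ⟨w, α, Δ, hαU, hαw, hαE, ⟨?_, ?_⟩, isUnit_det_congr hdet _, fun j => ?_⟩
  · rw [Submodule.disjoint_def]
    intro x hx hxE
    obtain ⟨u, hu, y, hy, rfl⟩ := Submodule.mem_sup.1 hx
    obtain ⟨e, rfl⟩ := (Submodule.mem_span_range_iff_exists_fun _).1 hy
    have h0 : e = 0 := by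
      have h1 := hαE _ hxE
      rw [map_add, hαU u hu, zero_add, map_sum] at h1
      simp only [map_smul, hαw] at h1
      rw [← h1]
      funext q
      simp [Finset.sum_apply, Pi.single_apply]
    subst h0
    refine Submodule.disjoint_def.1 hc.disjoint _ ?_ hxE
    simpa using Submodule.mem_sup_left hu
  · rw [codisjoint_iff, eq_top_iff, ← hc.sup_eq_top]
    refine sup_le (sup_le (le_sup_left.trans le_sup_left) ?_) le_sup_right
    rw [Submodule.span_le]
    rintro _ ⟨j, rfl⟩
    have : v j = w j + -∑ l, X l j • (f l : H) := by simp [w]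
    rw [this]
    exact Submodule.add_mem_sup (Submodule.mem_sup_right (Submodule.subset_span ⟨j, rfl⟩))
      (Submodule.neg_mem _ (hfil j))
  · have h1 := hdec (C.Φ₀ (w j))
    have h2 : ∑ q, α (C.Φ₀ (w j)) q • v q + ∑ l, β (C.Φ₀ (w j)) l • (f l : H) =
        p ^ i • ∑ q, Δ q j • w q := by
      rw [hαΦ, hβΦ]
      simp only [w, smul_add, Finset.sum_add_distrib, Pi.smul_apply, Finset.smul_sum, smul_assoc,
        Matrix.mul_apply, Finset.sum_smul]
      congr 1
      rw [Finset.sum_comm]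
      refine Finset.sum_congr rfl fun q _ => Finset.sum_congr rfl fun l _ => ?_
      rw [smul_smul, mul_comm]
    rwa [sub_sub, h2] at h1

end FCrystal.IsSlopePart

end Slope

end CY3

end

noncomputable section

set_option linter.unusedSectionVars false

namespace CY3

/-! ### Induction over the slopes; stability under the connection. -/

section Slope

variable {p : ℕ} [Fact p.Prime] {k : Type u} [Field k] [CharP k p] [PerfectRing k p] {n : ℕ}
variable {H : Type v} [AddCommGroup H] [Module (PS p k n) H]
  [Module.Free (PS p k n) H] [Module.Finite (PS p k n) H]

namespace FCrystal.IsSlopePart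

variable {C : FCrystal p k n H} {𝓕 : HodgeFiltration C} {i : ℕ} {U : Submodule (PS p k n) H}

theorem pow_smul_mem_span (h : IsSlopePart 𝓕 i U) {x : H} (hx : x ∈ U) :
    p ^ i • x ∈ Submodule.span (PS p k n) (C.Φ₀ '' U) := by
  have : p ^ i • x = p ^ (i - (i - 1)) • p ^ (i - 1) • x := by
    rw [smul_smul, ← pow_add, Nat.sub_add_cancel (Nat.sub_le i 1)]
  rw [this]
  exact Submodule.smul_of_tower_mem _ _ (h.slope x hx)

/-- The new piece is U together with the invariant graph. Stability and complementarity come with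
the graph; the point to prove is that p^i U' is spanned by F(U'), which uses the inverse of Δ. -/
theorem exists_succ (hO : C.IsOrdinary) (h : IsSlopePart 𝓕 i U) :
    ∃ U', U ≤ U' ∧ IsSlopePart 𝓕 (i + 1) U' ∧ ∃ (r : ℕ) (α : H →ₗ[PS p k n] Fin r → PS p k n),
      (∀ x ∈ U', α x = 0 ↔ x ∈ U) ∧ ∀ a, ∃ x ∈ U', α x = a := by
  obtain ⟨r, hr⟩ := hO.1 i
  obtain ⟨v, hv, hc, hind⟩ := h.exists_lifts hO hr
  obtain ⟨w, α, Δ, hαU, hαw, -, hcompl, hΔ, hΦ⟩ := h.exists_frame_of_lifts hv hc hind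
  set U' := U ⊔ Submodule.span (PS p k n) (Set.range w) with hU'
  have hUU' : U ≤ U' := le_sup_left
  have hw (j : Fin r) : w j ∈ U' := Submodule.mem_sup_right (Submodule.subset_span ⟨j, rfl⟩)
  have hαsum (a : Fin r → PS p k n) : α (∑ j, a j • w j) = a := by
    rw [map_sum]
    simp only [map_smul, hαw]
    funext q
    simp [Finset.sum_apply, Pi.single_apply]
  have hsumw (a : Fin r → PS p k n) : ∑ j, a j • w j ∈ U' :=
    Submodule.sum_mem _ fun j _ => Submodule.smul_mem _ _ (hw j)
  have hsat {m : ℕ} {x : H} (hx : p ^ m • x ∈ U') : x ∈ U' :=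
    mem_of_pow_smul_mem hcompl.disjoint hcompl.sup_eq_top hx
  have hstable : ∀ x ∈ U', C.Φ₀ x ∈ U' := by
    have : U' ≤ U'.comap C.Φ₀ := by
      refine sup_le (fun x hx => hUU' (h.stable x hx)) ?_
      rw [Submodule.span_le]
      rintro _ ⟨j, rfl⟩
      have h1 := add_mem (hUU' (hΦ j)) (U'.smul_of_tower_mem (p ^ i) (hsumw fun q => Δ q j))
      rwa [sub_add_cancel] at h1
    exact this
  have hdec (x : H) (hx : x ∈ U') :
      ∃ u ∈ U, ∃ l ∈ U', ∃ y ∈ U', x = u + l ∧ C.Φ₀ l = p ^ i • y := by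
    obtain ⟨u, hu, l, y, rfl, hl⟩ := h.exists_add x
    have hl' : l ∈ U' := by
      have := sub_mem hx (hUU' hu)
      rwa [add_sub_cancel_left] at this
    exact ⟨u, hu, l, hl', y, hsat (hl ▸ hstable l hl'), rfl, hl⟩
  set S := Submodule.span (PS p k n) (C.Φ₀ '' U') with hS
  have hSU : Submodule.span (PS p k n) (C.Φ₀ '' U) ≤ S :=
    Submodule.span_mono (Set.image_mono hUU')
  have hslope_w (q : Fin r) : p ^ i • w q ∈ S := by
    have hinv : Δ * Δ⁻¹ = 1 := Matrix.mul_nonsing_inv _ hΔ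
    -- Inverting Δ expresses p^i w_q by the F(w_j) up to an error in U, which need not be in the
    -- span of F(U). Splitting w_j = u_j + l_j with F(l_j) = p^i y_j turns the error into p^i times
    -- an element, in U by saturation, and the slope condition on U applies to it.
    choose u hu l hl y hy hwl hly using fun j => hdec (w j) (hw j)
    -- `p ^ i w q` in terms of the `F (w j)`, modulo `U`
    have h1 : p ^ i • w q - ∑ j, Δ⁻¹ j q • C.Φ₀ (w j) ∈ U := by
      have h2 : w q = ∑ j, Δ⁻¹ j q • ∑ q', Δ q' j • w q' := by
        simp only [Finset.smul_sum, smul_smul]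
        rw [Finset.sum_comm]
        simp only [← Finset.sum_smul]
        rw [Finset.sum_eq_single q]
        · have := congrFun (congrFun hinv q) q
          rw [Matrix.mul_apply, Matrix.one_apply_eq] at this
          rw [Finset.sum_congr rfl fun j _ => mul_comm _ _, this, one_smul]
        · intro q' _ hq'
          have := congrFun (congrFun hinv q') q
          rw [Matrix.mul_apply, Matrix.one_apply_ne hq'] at this
          rw [Finset.sum_congr rfl fun j _ => mul_comm _ _, this, zero_smul]
        · simp
      have h3 : p ^ i • w q - ∑ j, Δ⁻¹ j q • C.Φ₀ (w j) =
          -∑ j, Δ⁻¹ j q • (C.Φ₀ (w j) - p ^ i • ∑ q', Δ q' j • w q') := by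
        conv_lhs => rw [h2]
        simp only [smul_sub, Finset.sum_sub_distrib]
        rw [neg_sub, Finset.smul_sum]
        congr 1
        exact Finset.sum_congr rfl fun j _ => smul_comm _ _ _
      rw [h3]
      exact U.neg_mem (Submodule.sum_mem _ fun j _ => U.smul_mem _ (hΦ j))
    have h2 : p ^ i • (w q - ∑ j, Δ⁻¹ j q • y j) ∈ U := by
      have h3 : p ^ i • (w q - ∑ j, Δ⁻¹ j q • y j) =
          (p ^ i • w q - ∑ j, Δ⁻¹ j q • C.Φ₀ (w j)) + ∑ j, Δ⁻¹ j q • C.Φ₀ (u j) := by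
        have h4 (j : Fin r) : C.Φ₀ (w j) = C.Φ₀ (u j) + p ^ i • y j := by
          rw [← hly, ← map_add, ← hwl]
        simp only [h4, smul_add, smul_sub, Finset.sum_add_distrib, Finset.smul_sum]
        rw [Finset.sum_congr rfl fun j _ => smul_comm (p ^ i) (Δ⁻¹ j q) (y j)]
        abel
      rw [h3]
      exact add_mem h1 (Submodule.sum_mem _ fun j _ => U.smul_mem _ (h.stable _ (hu j)))
    have h3 := hSU (h.pow_smul_mem_span (h.saturated h2))
    have h4 : p ^ i • w q = p ^ i • (w q - ∑ j, Δ⁻¹ j q • y j) + ∑ j, Δ⁻¹ j q • C.Φ₀ (l j) := by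
      simp only [hly]
      rw [smul_sub, Finset.smul_sum,
        Finset.sum_congr rfl fun j _ => smul_comm (p ^ i) (Δ⁻¹ j q) (y j), sub_add_cancel]
    rw [h4]
    exact add_mem h3 (Submodule.sum_mem _ fun j _ =>
      Submodule.smul_mem _ _ (Submodule.subset_span ⟨l j, hl j, rfl⟩))
  refine ⟨U', hUU', ⟨hcompl, hstable, ?_⟩, r, α, fun x hx => ⟨fun h0 => ?_, fun hxU => hαU x hxU⟩,
    fun a => ⟨_, hsumw a, hαsum a⟩⟩
  · intro x hx
    rw [Nat.add_sub_cancel]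
    obtain ⟨u, hu, y, hy, rfl⟩ := Submodule.mem_sup.1 hx
    obtain ⟨e, rfl⟩ := (Submodule.mem_span_range_iff_exists_fun _).1 hy
    rw [smul_add, Finset.smul_sum]
    refine add_mem (hSU (h.pow_smul_mem_span hu)) (Submodule.sum_mem _ fun j _ => ?_)
    rw [smul_comm]
    exact Submodule.smul_mem _ _ (hslope_w j)
  · obtain ⟨u, hu, y, hy, rfl⟩ := Submodule.mem_sup.1 hx
    obtain ⟨e, rfl⟩ := (Submodule.mem_span_range_iff_exists_fun _).1 hy
    rw [map_add, hαU u hu, zero_add, hαsum] at h0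
    subst h0
    simpa using hu

/-- Suppose D_j maps U into U + p^N H. The relation D_j F = p t_j^{p-1} F D_j and the inclusion F(H)
⊆ U + p^{i+1} H put D_j of the span of F(U) into U + p^{i+N+1} H. That span contains p^i U, so p^i
can be cancelled by saturation, and N has become N + 1. Closedness of U concludes. -/
theorem D_mem (h : IsSlopePart 𝓕 (i + 1) U) (j : Fin n) {x : H} (hx : x ∈ U) : C.D j x ∈ U := by
  refine mem_of_forall_add_pow U fun N => ?_
  suffices ∀ N, ∀ x ∈ U, ∃ u ∈ U, ∃ y, C.D j x = u + p ^ N • y from this N x hx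
  clear hx x N
  intro N
  induction N with
  | zero => exact fun x _ => ⟨0, zero_mem _, C.D j x, by simp⟩
  | succ N ih =>
    intro x hx
    have key : ∀ y ∈ Submodule.span (PS p k n) (C.Φ₀ '' U),
        ∃ u ∈ U, ∃ z, C.D j y = u + p ^ (i + (N + 1)) • z := by
      intro y hy
      induction hy using Submodule.span_induction with
      | mem y hy =>
        obtain ⟨x, hx, rfl⟩ := hy
        obtain ⟨u, hu, z, hz⟩ := ih x hx
        obtain ⟨u', hu', z', hz'⟩ := h.exists_Φ₀_eq z
        refine ⟨((p : PS p k n) * MvPowerSeries.X j ^ (p - 1)) • (C.Φ₀ u + p ^ N • u'),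
          U.smul_mem _ (add_mem (h.stable u hu) (U.smul_of_tower_mem (p ^ N) hu')),
          ((p : PS p k n) * MvPowerSeries.X j ^ (p - 1)) • z', ?_⟩
        rw [show C.D j (C.Φ₀ x) = _ from C.D_Φ_stdLift j x, hz, map_add, map_nsmul, hz',
          smul_comm (p ^ (i + (N + 1))), ← smul_add, smul_add (p ^ N), smul_smul (p ^ N), ← pow_add,
          add_assoc, show N + (i + 1) = i + (N + 1) by ring]
      | zero => exact ⟨0, zero_mem _, 0, by simp⟩
      | add y y' _ _ hy hy' =>
        obtain ⟨u, hu, z, hz⟩ := hy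
        obtain ⟨u', hu', z', hz'⟩ := hy'
        exact ⟨u + u', add_mem hu hu', z + z', by rw [map_add, hz, hz', smul_add]; abel⟩
      | smul c y hmem hy =>
        obtain ⟨u, hu, z, hz⟩ := hy
        refine ⟨dA p k n j c • y + c • u, add_mem (U.smul_mem _ (h.span_le hmem)) (U.smul_mem _ hu),
          c • z, ?_⟩
        rw [C.leibniz, hz, smul_add, add_assoc, smul_comm c]
    obtain ⟨u, hu, z, hz⟩ := key _ (h.slope x hx)
    rw [Nat.add_sub_cancel, map_nsmul, pow_add, mul_smul] at hz
    have h1 : p ^ i • (C.D j x - p ^ (N + 1) • z) = u := by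
      rw [smul_sub, hz, add_sub_cancel_right]
    exact ⟨_, h.saturated (h1 ▸ hu), z, (sub_add_cancel _ _).symm⟩

/-- The slope filtration, in the indexing of `IsSlopePart`. -/
theorem exists_filtration (hO : C.IsOrdinary) (𝓕 : HodgeFiltration C) :
    ∃ S : ℕ → Submodule (PS p k n) H, S 0 = ⊥ ∧ ∀ i, IsSlopePart 𝓕 i (S i) ∧ S i ≤ S (i + 1) ∧
      ∃ (r : ℕ) (α : H →ₗ[PS p k n] Fin r → PS p k n),
        (∀ x ∈ S (i + 1), α x = 0 ↔ x ∈ S i) ∧ ∀ a, ∃ x ∈ S (i + 1), α x = a := by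
  choose next hle hnext hα using
    fun (i : ℕ) (U : {U // IsSlopePart 𝓕 i U}) => exists_succ hO U.2
  let S : ∀ i : ℕ, {U // IsSlopePart 𝓕 i U} := fun i =>
    Nat.rec ⟨⊥, IsSlopePart.bot 𝓕⟩ (fun i U => ⟨next i U, hnext i U⟩) i
  exact ⟨fun i => (S i).1, rfl, fun i => ⟨(S i).2, hle i (S i), hα i (S i)⟩⟩

end FCrystal.IsSlopePart

end Slope

end CY3

end

noncomputable section

set_option linter.unusedSectionVars false

namespace CY3

/-! ### Graded pieces as twisted unit F-crystals; existence of the filtration. -/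

section Graded

variable {p : ℕ} [Fact p.Prime] {k : Type u} [Field k] [CharP k p] [PerfectRing k p] {n : ℕ}
variable {H : Type v} [AddCommGroup H] [Module (PS p k n) H]
  [Module.Free (PS p k n) H] [Module.Finite (PS p k n) H]

namespace FCrystal

/-- The subquotient `U' / U`, twisted by `i`, as a unit `F`-crystal. -/
theorem exists_graded (C : FCrystal p k n H) {i r : ℕ} {U U' : Submodule (PS p k n) H}
    (hUD : ∀ j, ∀ x ∈ U, C.D j x ∈ U) (hUD' : ∀ j, ∀ x ∈ U', C.D j x ∈ U')
    (hUΦ : ∀ φ, ∀ x ∈ U, C.Φ φ x ∈ U) (hUΦ' : ∀ φ, ∀ x ∈ U', C.Φ φ x ∈ U')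
    (α : H →ₗ[PS p k n] Fin r → PS p k n) (hα0 : ∀ x ∈ U', α x = 0 ↔ x ∈ U)
    (hα : ∀ a, ∃ x ∈ U', α x = a) (hdiv : ∀ φ, ∀ x ∈ U', ∃ y, α (C.Φ φ x) = p ^ i • y)
    (hspan : ∀ φ, ∀ x ∈ U', p ^ i • x ∈ Submodule.span (PS p k n) (C.Φ φ '' U')) :
    ∃ V : FCrystal p k n (Fin r → PS p k n), V.IsUnit ∧
      (∀ j, ∀ x ∈ U', α (C.D j x) = V.D j (α x)) ∧
      ∀ φ, ∀ x ∈ U', α (C.Φ φ x) = p ^ i • V.Φ φ (α x) := by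
  -- σ is a set-theoretic section only. The operators on the quotient are defined through it and do
  -- not depend on it, because U is stable and α vanishes there.
  choose σ hσ hασ using hα
  have hdiff (x : H) (hx : x ∈ U') : x - σ (α x) ∈ U :=
    (hα0 _ (sub_mem hx (hσ _))).1 (by rw [map_sub, hασ, sub_self])
  have hzero {x : H} (hx : x ∈ U') (h : x ∈ U) : α x = 0 := (hα0 x hx).2 h
  have hD (j : Fin n) (x : H) (hx : x ∈ U') : α (C.D j x) = α (C.D j (σ (α x))) := by
    rw [← sub_eq_zero, ← map_sub, ← map_sub]
    exact hzero (hUD' j _ (sub_mem hx (hσ _))) (hUD j _ (hdiff x hx))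
  have hΦ (φ : FrobLift p k n) (x : H) (hx : x ∈ U') : α (C.Φ φ x) = α (C.Φ φ (σ (α x))) := by
    rw [← sub_eq_zero, ← map_sub, ← map_sub]
    exact hzero (hUΦ' φ _ (sub_mem hx (hσ _))) (hUΦ φ _ (hdiff x hx))
  obtain ⟨D, hDα⟩ : ∃ D : Fin n → AddMonoid.End (Fin r → PS p k n),
      ∀ j, ∀ x ∈ U', α (C.D j x) = D j (α x) := by
    refine ⟨fun j => AddMonoidHom.mk' (fun a => α (C.D j (σ a))) fun a b => ?_,
      fun j x hx => hD j x hx⟩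
    have := hD j (σ a + σ b) (add_mem (hσ _) (hσ _))
    rw [map_add, map_add, map_add, hασ, hασ] at this
    exact this.symm
  choose Φ' hΦ' using fun φ a => hdiv φ (σ a) (hσ a)
  have hΦ'α (φ : FrobLift p k n) (x : H) (hx : x ∈ U') : α (C.Φ φ x) = p ^ i • Φ' φ (α x) := by
    rw [hΦ φ x hx, hΦ']
  have hcancel {a b : Fin r → PS p k n} (h : p ^ i • a = p ^ i • b) : a = b :=
    pow_smul_cancel k n h
  obtain ⟨F, hFα⟩ : ∃ F : (φ : FrobLift p k n) → (Fin r → PS p k n) →ₛₗ[φ.hom] (Fin r → PS p k n),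
      ∀ φ, ∀ x ∈ U', α (C.Φ φ x) = p ^ i • F φ (α x) := by
    refine ⟨fun φ => ⟨⟨Φ' φ, fun a b => hcancel ?_⟩, fun c a => hcancel ?_⟩,
      fun φ x hx => hΦ'α φ x hx⟩
    · have := hΦ'α φ (σ a + σ b) (add_mem (hσ _) (hσ _))
      rw [map_add, map_add, map_add, hασ, hασ, hΦ', hΦ'] at this
      rw [smul_add, this]
    · have := hΦ'α φ (c • σ a) (U'.smul_mem _ (hσ _))
      rw [map_smulₛₗ, map_smul, map_smul, hασ, hΦ'] at this
      rw [← this, smul_comm]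
  have hpowD (j : Fin n) (m : ℕ) : ∀ x ∈ U', (C.D j ^ m) x ∈ U' ∧
      α ((C.D j ^ m) x) = (D j ^ m) (α x) := by
    induction m with
    | zero => exact fun x hx => ⟨hx, rfl⟩
    | succ m ih =>
      intro x hx
      rw [pow_succ', pow_succ']
      change C.D j ((C.D j ^ m) x) ∈ U' ∧ α (C.D j ((C.D j ^ m) x)) = D j ((D j ^ m) (α x))
      exact ⟨hUD' j _ (ih x hx).1, by rw [hDα j _ (ih x hx).1, (ih x hx).2]⟩
  have hprodD (l : List (AddMonoid.End H × AddMonoid.End (Fin r → PS p k n)))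
      (hl : ∀ q ∈ l, ∀ x ∈ U', q.1 x ∈ U' ∧ α (q.1 x) = q.2 (α x)) :
      ∀ x ∈ U', (l.map Prod.fst).prod x ∈ U' ∧
        α ((l.map Prod.fst).prod x) = (l.map Prod.snd).prod (α x) := by
    induction l with
    | nil => exact fun x hx => ⟨hx, rfl⟩
    | cons q l ih =>
      intro x hx
      have h1 := ih (fun q hq => hl q (List.mem_cons_of_mem _ hq)) x hx
      have h2 := hl q List.mem_cons_self _ h1.1
      rw [List.map_cons, List.map_cons, List.prod_cons, List.prod_cons]
      change q.1 ((l.map Prod.fst).prod x) ∈ U' ∧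
        α (q.1 ((l.map Prod.fst).prod x)) = q.2 ((l.map Prod.snd).prod (α x))
      rw [← h1.2]
      exact h2
  have hDpow (m : Fin n →₀ ℕ) (x : H) (hx : x ∈ U') :
      (List.ofFn fun j => C.D j ^ m j).prod x ∈ U' ∧
      α ((List.ofFn fun j => C.D j ^ m j).prod x) = (List.ofFn fun j => D j ^ m j).prod (α x) := by
    have := hprodD (List.ofFn fun j => (C.D j ^ m j, D j ^ m j)) (by
      intro q hq
      obtain ⟨j, rfl⟩ := (List.mem_ofFn' _ _).1 hq
      exact hpowD j (m j)) x hx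
    simpa only [List.map_ofFn, Function.comp_def] using this
  have htop (φ : FrobLift p k n) (a : Fin r → PS p k n) :
      a ∈ Submodule.span (PS p k n) (Set.range (F φ)) := by
    have key : ∀ y ∈ Submodule.span (PS p k n) (C.Φ φ '' U'),
        ∃ b ∈ Submodule.span (PS p k n) (Set.range (F φ)), α y = p ^ i • b := by
      intro y hy
      induction hy using Submodule.span_induction with
      | mem y hy =>
        obtain ⟨x, hx, rfl⟩ := hy
        exact ⟨_, Submodule.subset_span ⟨α x, rfl⟩, hFα φ x hx⟩
      | zero => exact ⟨0, zero_mem _, by simp⟩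
      | add y y' _ _ hy hy' =>
        obtain ⟨b, hb, hb'⟩ := hy
        obtain ⟨c, hc, hc'⟩ := hy'
        exact ⟨b + c, add_mem hb hc, by rw [map_add, hb', hc', smul_add]⟩
      | smul c y _ hy =>
        obtain ⟨b, hb, hb'⟩ := hy
        exact ⟨c • b, Submodule.smul_mem _ _ hb, by rw [map_smul, hb', smul_comm]⟩
    obtain ⟨b, hb, hb'⟩ := key _ (hspan φ _ (hσ a))
    rw [map_nsmul, hασ] at hb'
    rwa [hcancel hb']
  let V : FCrystal p k n (Fin r → PS p k n) :=
    { D := D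
      leibniz := fun j c a => by
        have := hDα j (c • σ a) (U'.smul_mem _ (hσ _))
        rw [C.leibniz, map_add, map_smul, map_smul, hDα j _ (hσ a), map_smul, hασ] at this
        exact this.symm
      integrable := fun j l => by
        ext1 a
        have h1 := hDα j _ (hUD' l _ (hσ a))
        have h2 := hDα l _ (hUD' j _ (hσ a))
        rw [hDα l _ (hσ a), hασ] at h1
        rw [hDα j _ (hσ a), hασ] at h2
        change D j (D l a) = D l (D j a)
        rw [← h1, ← h2]
        exact congrArg α (DFunLike.congr_fun (C.integrable j l) (σ a))
      nilpotent := fun j N => by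
        obtain ⟨M, hM⟩ := C.nilpotent j N
        refine ⟨M, fun m hm a => ?_⟩
        obtain ⟨y, hy⟩ := hM m hm (σ a)
        refine ⟨α y, ?_⟩
        rw [← map_nsmul, ← hy, (hpowD j m _ (hσ a)).2, hασ]
      Φ := F
      horizontal := fun φ l a => hcancel <| by
        have h1 := hDα l _ (hUΦ' φ _ (hσ a))
        rw [hFα φ _ (hσ a), hασ, map_nsmul] at h1
        rw [← h1, C.horizontal, map_sum, Finset.smul_sum]
        refine Finset.sum_congr rfl fun j _ => ?_
        rw [map_smul, hFα φ _ (hUD' j _ (hσ a)), hDα j _ (hσ a), hασ, smul_comm]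
      taylor := fun φ ψ => by
        obtain ⟨c, hc, hsum⟩ := C.taylor φ ψ
        refine ⟨c, hc, fun a N => ?_⟩
        -- The precision i + N leaves N after the division by p^i that defines the Frobenius of V.
        obtain ⟨S₀, hS₀⟩ := hsum (σ a) (i + N)
        refine ⟨S₀, fun S hS => ?_⟩
        obtain ⟨y, -, hy⟩ := hS₀ S hS
        refine ⟨α y, trivial, hcancel ?_⟩
        have h1 := congrArg α hy
        rw [map_sub, map_sum, hFα φ _ (hσ a), hασ, map_nsmul, pow_add, mul_smul] at h1
        rw [← h1, smul_sub, Finset.smul_sum]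
        congr 1
        refine Finset.sum_congr rfl fun m _ => ?_
        rw [map_smul, hFα ψ _ (hDpow m _ (hσ a)).1, (hDpow m _ (hσ a)).2, hασ, smul_comm]
      isogeny := fun φ => ⟨0, fun a => htop φ _⟩ }
  refine ⟨V, fun φ => ?_, hDα, hFα⟩
  rw [eq_top_iff]
  exact fun a _ => htop φ a

theorem free_of_isCompl {N E : Submodule (PS p k n) H} (h : IsCompl N E) :
    Module.Free (PS p k n) N := by
  have : Module.Projective (PS p k n) N :=
    Module.Projective.of_split N.subtype (N.projectionOnto E h) (by
      ext x
      simp)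
  exact Module.free_of_flat_of_isLocalRing

/-- An ordinary `F`-crystal with a Hodge filtration has a unit root filtration. -/
theorem exists_isUnitRootFiltration {C : FCrystal p k n H} (hO : C.IsOrdinary)
    (𝓕 : HodgeFiltration C) : ∃ U, C.IsUnitRootFiltration U := by
  obtain ⟨S, hS0, hS⟩ := IsSlopePart.exists_filtration hO 𝓕
  have hSP (i : ℕ) : IsSlopePart 𝓕 i (S i) := (hS i).1
  have hD (i : ℕ) : ∀ j, ∀ x ∈ S i, C.D j x ∈ S i := by
    cases i with
    | zero =>
      intro j x hx
      rw [hS0, Submodule.mem_bot] at hx ⊢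
      rw [hx, map_zero]
    | succ i => exact fun j x hx => (hSP (i + 1)).D_mem j hx
  have hΦ (i : ℕ) (φ : FrobLift p k n) : ∀ x ∈ S i, C.Φ φ x ∈ S i := fun x hx =>
    C.Φ_mem_of_Φ_mem φ (stdLift p k n) (hD i) (hSP i).stable hx
  -- S i has the slopes < i, whereas U_i has the slopes ≤ i; hence the shift.
  refine ⟨fun i => S (i + 1), monotone_nat_of_le_succ fun i => (hS (i + 1)).2.1,
    fun i => free_of_isCompl (hSP (i + 1)).compl, fun i => inferInstance,
    fun i j x hx => hD (i + 1) j x hx, fun i φ x hx => hΦ (i + 1) φ x hx,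
    fun i => (hSP (i + 1)).lifts hO, fun i => ?_⟩
  obtain ⟨r, α, hα0, hα⟩ := (hS i).2.2
  have hpred : pred (fun i => S (i + 1)) i = S i := by
    cases i with
    | zero => exact hS0.symm
    | succ i => rfl
  obtain ⟨V, hV, hVD, hVΦ⟩ := C.exists_graded (i := i) (hD i) (hD (i + 1)) (hΦ i) (hΦ (i + 1)) α hα0
    hα (by
      intro φ x hx
      have h1 : C.Φ φ x ∈ S i ⊔ pPow p k n H i := by
        refine C.Φ_mem_of_Φ_mem φ (stdLift p k n) (N := ⊤) (fun _ _ _ => trivial) (fun x _ => ?_)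
          trivial
        obtain ⟨u, hu, y, hy⟩ := (hSP i).exists_Φ₀_eq x
        rw [show C.Φ (stdLift p k n) x = _ from hy]
        exact Submodule.add_mem_sup hu (mem_pPow.2 ⟨y, rfl⟩)
      obtain ⟨u, hu, z, hz, huz⟩ := Submodule.mem_sup.1 h1
      obtain ⟨y, rfl⟩ := mem_pPow.1 hz
      refine ⟨α y, ?_⟩
      rw [← huz, map_add, (hα0 u ((hS i).2.1 hu)).2 hu, zero_add, map_nsmul]) (by
      intro φ x hx
      have h1 : Submodule.span (PS p k n) (C.Φ₀ '' S (i + 1)) ≤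
          Submodule.span (PS p k n) (C.Φ φ '' S (i + 1)) := by
        rw [Submodule.span_le]
        rintro _ ⟨y, hy, rfl⟩
        exact C.Φ_mem_of_Φ_mem (stdLift p k n) φ
          (N' := Submodule.span (PS p k n) (C.Φ φ '' S (i + 1))) (hD (i + 1))
          (fun z hz => Submodule.subset_span (Set.mem_image_of_mem _ hz)) hy
      exact h1 ((hSP (i + 1)).slope x hx))
  refine ⟨r, V, α.domRestrict (S (i + 1)), hV, fun a => ?_, fun x => ?_, fun j x y hxy => ?_,
    fun φ x y hxy => ?_⟩
  · obtain ⟨x, hx, rfl⟩ := hα a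
    exact ⟨⟨x, hx⟩, rfl⟩
  · rw [hpred]
    exact hα0 x x.2
  · rw [LinearMap.domRestrict_apply, LinearMap.domRestrict_apply, hxy]
    exact hVD j x x.2
  · rw [LinearMap.domRestrict_apply, LinearMap.domRestrict_apply, hxy]
    exact hVΦ φ x x.2

end FCrystal

end Graded

end CY3

end

noncomputable section

set_option linter.unusedSectionVars false

namespace CY3

/-! ### An arbitrary unit root filtration: ranks, frames, orthogonality. -/

section Filtrations

variable {p : ℕ} [Fact p.Prime] {k : Type u} [Field k] [CharP k p] [PerfectRing k p] {n h : ℕ}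
variable {H : Type v} [AddCommGroup H] [Module (PS p k n) H]
  [Module.Free (PS p k n) H] [Module.Finite (PS p k n) H]
variable {C : FCrystal p k n H} {𝓕 : HodgeFiltration C} {B : LinearMap.BilinForm (PS p k n) H}
variable {U : ℕ → Submodule (PS p k n) H}

open FCrystal

namespace FCrystal.IsUnitRootFiltration

theorem isCompl (hU : C.IsUnitRootFiltration U) (hO : C.IsOrdinary) (𝓕 : HodgeFiltration C)
    (i : ℕ) : IsCompl (U i) (𝓕.fil (i + 1)) :=
  isCompl_of_liftsTo (hU.lifts i) (𝓕.lifts (i + 1)) (hO.2 i)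

theorem pred_le (hU : C.IsUnitRootFiltration U) (i : ℕ) : pred U i ≤ U i := by
  cases i with
  | zero => exact bot_le
  | succ i => exact hU.mono (Nat.le_succ i)

theorem isCompl_pred (hU : C.IsUnitRootFiltration U) (hO : C.IsOrdinary) (𝓕 : HodgeFiltration C)
    (i : ℕ) : IsCompl (pred U i) (𝓕.fil i) := by
  cases i with
  | zero => rw [𝓕.fil_zero]; exact isCompl_bot_top
  | succ i => exact hU.isCompl hO 𝓕 i

theorem lifts_pred (hU : C.IsUnitRootFiltration U) (i : ℕ) : LiftsTo (pred U i) (C.conjFilPred i) := by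
  cases i with
  | zero =>
    refine ⟨Submodule.map_bot _, fun x hx _ => ⟨0, zero_mem _, ?_⟩⟩
    rw [smul_zero]
    exact (Submodule.mem_bot _).1 hx
  | succ i => exact hU.lifts i

theorem exists_add_fil (hU : C.IsUnitRootFiltration U) (hO : C.IsOrdinary) {i : ℕ} {x : H}
    (hx : x ∈ 𝓕.fil i) : ∃ y ∈ U i ⊓ 𝓕.fil i, ∃ z ∈ 𝓕.fil (i + 1), x = y + z := by
  obtain ⟨y, hy, z, hz, rfl⟩ := Submodule.mem_sup.1
    ((hU.isCompl hO 𝓕 i).sup_eq_top ▸ Submodule.mem_top : x ∈ U i ⊔ 𝓕.fil (i + 1))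
  refine ⟨y, ⟨hy, ?_⟩, z, hz, rfl⟩
  simpa using sub_mem hx (𝓕.anti (Nat.le_succ i) hz)

theorem exists_add_pred (hU : C.IsUnitRootFiltration U) (hO : C.IsOrdinary)
    (𝓕 : HodgeFiltration C) {i : ℕ} {x : H}
    (hx : x ∈ U i) : ∃ y ∈ U i ⊓ 𝓕.fil i, ∃ z ∈ pred U i, x = y + z := by
  obtain ⟨z, hz, y, hy, rfl⟩ := Submodule.mem_sup.1
    ((hU.isCompl_pred hO 𝓕 i).sup_eq_top ▸ Submodule.mem_top : x ∈ pred U i ⊔ 𝓕.fil i)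
  refine ⟨y, ⟨?_, hy⟩, z, hz, add_comm _ _⟩
  simpa using sub_mem hx (hU.pred_le i hz)

/-- `p ^ i U_i` is contained in the image of `F` on `U_i`, modulo `U_{i-1}`. -/
theorem exists_slope (hU : C.IsUnitRootFiltration U) {i : ℕ} {x : H} (hx : x ∈ U i) :
    ∃ s ∈ Submodule.span (PS p k n) (C.Φ₀ '' U i), ∃ z ∈ pred U i, p ^ i • x = s + z := by
  obtain ⟨r, V, π, hV, hπ, hker, -, hΦ⟩ := hU.graded i
  have key : ∀ v ∈ V.imF (stdLift p k n), ∃ s : U i,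
      (s : H) ∈ Submodule.span (PS p k n) (C.Φ₀ '' U i) ∧ π s = p ^ i • v := by
    intro v hv
    induction hv using Submodule.span_induction with
    | mem v hv =>
      obtain ⟨w, rfl⟩ := hv
      obtain ⟨y, rfl⟩ := hπ w
      exact ⟨⟨C.Φ₀ y, hU.stable_Φ i _ y y.2⟩, Submodule.subset_span ⟨y, y.2, rfl⟩,
        hΦ _ y _ rfl⟩
    | zero => exact ⟨0, zero_mem _, by simp⟩
    | add v w _ _ hv hw =>
      obtain ⟨s, hs, hs'⟩ := hv
      obtain ⟨t, ht, ht'⟩ := hw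
      exact ⟨s + t, add_mem hs ht, by rw [map_add, hs', ht', smul_add]⟩
    | smul a v _ hv =>
      obtain ⟨s, hs, hs'⟩ := hv
      exact ⟨a • s, Submodule.smul_mem _ a hs, by rw [map_smul, hs', smul_comm]⟩
  obtain ⟨s, hs, hs'⟩ := key (π ⟨x, hx⟩) (by rw [hV]; trivial)
  refine ⟨s, hs, p ^ i • x - s, ?_, by abel⟩
  have := (hker (p ^ i • ⟨x, hx⟩ - s)).1 (by rw [map_sub, hs', map_nsmul, sub_self])
  simpa using this

/-- The rank of the graded piece is the Hodge number. -/
theorem rank_eq (hU : C.IsUnitRootFiltration U) {i r s : ℕ} (hr : C.HasHodgeNumber i r)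
    (π : U i →ₗ[PS p k n] (Fin s → PS p k n)) (hπ : Function.Surjective π)
    (hker : ∀ x : U i, π x = 0 ↔ (x : H) ∈ pred U i) : s = r := by
  obtain ⟨E⟩ := hr
  have hI : Nontrivial (PS p k n ⧸ Ideal.span {(p : PS p k n)}) := by
    refine Ideal.Quotient.nontrivial_iff.2 ?_
    rw [Ne, Ideal.span_singleton_eq_top]
    exact (IsLocalRing.mem_maximalIdeal _).1 p_mem_maximalIdeal
  let q : U i →ₗ[PS p k n] C.conjFil i := LinearMap.codRestrict _
    ((pPow p k n H 1).mkQ ∘ₗ (U i).subtype) fun x => by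
      rw [← (hU.lifts i).1]
      exact Submodule.mem_map_of_mem x.2
  have hq : Function.Surjective q := by
    rintro ⟨y, hy⟩
    rw [← (hU.lifts i).1] at hy
    obtain ⟨x, hx, rfl⟩ := hy
    exact ⟨⟨x, hx⟩, rfl⟩
  let f : U i →ₗ[PS p k n] (Fin r → PS p k n ⧸ Ideal.span {(p : PS p k n)}) :=
    E.toLinearMap ∘ₗ ((C.conjFilPred i).submoduleOf (C.conjFil i)).mkQ ∘ₗ q
  have hf : Function.Surjective f :=
    E.surjective.comp ((Submodule.mkQ_surjective _).comp hq)
  let g : U i →ₗ[PS p k n] (Fin s → PS p k n ⧸ Ideal.span {(p : PS p k n)}) :=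
    (Ideal.span {(p : PS p k n)}).mkQ.compLeft (Fin s) ∘ₗ π
  have hg : Function.Surjective g := by
    intro y
    choose z hz using fun l => Submodule.mkQ_surjective _ (y l)
    obtain ⟨x, rfl⟩ := hπ z
    exact ⟨x, funext hz⟩
  -- Both kernels are U_{i-1} + p U_i. Hence the two free modules over A/p are isomorphic and have
  -- the same rank.
  have hfg : LinearMap.ker f = LinearMap.ker g := by
    ext x
    have h1 : x ∈ LinearMap.ker f ↔ (pPow p k n H 1).mkQ x ∈ C.conjFilPred i := by
      rw [LinearMap.mem_ker]
      change E _ = 0 ↔ _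
      rw [LinearEquiv.map_eq_zero_iff]
      change Submodule.Quotient.mk (q x) = 0 ↔ _
      rw [Submodule.Quotient.mk_eq_zero]
      rfl
    have h2 : x ∈ LinearMap.ker g ↔ ∃ b, π x = p • b := by
      rw [LinearMap.mem_ker]
      constructor
      · intro hx
        have (l : Fin s) : ∃ b, π x l = p * b := by
          have := congrFun hx l
          change Submodule.Quotient.mk (π x l) = 0 at this
          rwa [Submodule.Quotient.mk_eq_zero, Ideal.mem_span_singleton] at this
        choose b hb using this
        refine ⟨b, funext fun l => ?_⟩
        rw [hb, Pi.smul_apply, nsmul_eq_mul]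
      · rintro ⟨b, hb⟩
        funext l
        change Submodule.Quotient.mk (π x l) = 0
        rw [Submodule.Quotient.mk_eq_zero, Ideal.mem_span_singleton, hb, Pi.smul_apply,
          nsmul_eq_mul]
        exact dvd_mul_right _ _
    rw [h1, h2]
    constructor
    · intro hx
      rw [← (hU.lifts_pred i).1] at hx
      obtain ⟨u, hu, hux⟩ := hx
      obtain ⟨z, hz⟩ := mkQ_eq_iff.1 hux.symm
      have hz' : p • z ∈ U i := by
        rw [← sub_eq_iff_eq_add'.2 hz]
        exact sub_mem x.2 (hU.pred_le i hu)
      obtain ⟨y, hy, hzy⟩ := (hU.lifts i).2 _ hz' (mem_pPow_one.2 ⟨z, rfl⟩)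
      refine ⟨π ⟨y, hy⟩, ?_⟩
      rw [← map_nsmul, ← sub_eq_zero, ← map_sub, hker]
      have : ((x - p • ⟨y, hy⟩ : U i) : H) = u := by
        rw [Submodule.coe_sub, hz, hzy]
        simp
      rwa [this]
    · rintro ⟨b, hb⟩
      obtain ⟨y, rfl⟩ := hπ b
      rw [← map_nsmul, ← sub_eq_zero, ← map_sub, hker] at hb
      rw [← (hU.lifts_pred i).1]
      refine ⟨_, hb, mkQ_eq_iff.2 ⟨-y, ?_⟩⟩
      simp [sub_eq_add_neg]
  have e : (Fin s → PS p k n ⧸ Ideal.span {(p : PS p k n)}) ≃ₗ[PS p k n]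
      (Fin r → PS p k n ⧸ Ideal.span {(p : PS p k n)}) :=
    (g.quotKerEquivOfSurjective hg).symm ≪≫ₗ
      (Submodule.quotEquivOfEq _ _ hfg.symm) ≪≫ₗ f.quotKerEquivOfSurjective hf
  have e' := e.extendScalarsOfSurjective
    (S := PS p k n ⧸ Ideal.span {(p : PS p k n)}) Ideal.Quotient.mk_surjective
  simpa using card_eq_of_linearEquiv _ e'

/-- A horizontal frame of the `i`-th graded piece, lifted to `U_i ∩ Fil^i`. -/
theorem exists_graded_frame {p : ℕ} [Fact p.Prime] {k : Type u} [Field k] [CharP k p]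
    [IsAlgClosed k] {n : ℕ} {H : Type v} [AddCommGroup H] [Module (PS p k n) H]
    [Module.Free (PS p k n) H] [Module.Finite (PS p k n) H]
    {C : FCrystal p k n H} {U : ℕ → Submodule (PS p k n) H}
    (hU : C.IsUnitRootFiltration U) (hO : C.IsOrdinary) (𝓕 : HodgeFiltration C)
    {i r : ℕ} (hr : C.HasHodgeNumber i r) :
    ∃ (e : Fin r → H) (f : Fin r → H →ₗ[PS p k n] PS p k n),
      (∀ a, e a ∈ U i ⊓ 𝓕.fil i) ∧ (∀ a b, f a (e b) = if a = b then 1 else 0) ∧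
      (∀ x ∈ U i ⊓ 𝓕.fil i, (∀ a, f a x = 0) → x = 0) ∧
      (∀ a j, C.D j (e a) ∈ pred U i) ∧ ∀ a, C.Φ₀ (e a) - p ^ i • e a ∈ pred U i := by
  obtain ⟨s, V, π, hV, hπ, hker, hD, hΦ⟩ := hU.graded i
  obtain rfl := hU.rank_eq hr π hπ hker
  obtain ⟨b, hbΦ, hbD⟩ := hV.exists_basis
  have (a : Fin s) : ∃ y : U i, (y : H) ∈ 𝓕.fil i ∧ π y = b a := by
    obtain ⟨x, hx⟩ := hπ (b a)
    obtain ⟨y, hy, z, hz, hyz⟩ := hU.exists_add_pred hO 𝓕 x.2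
    refine ⟨⟨y, hy.1⟩, hy.2, ?_⟩
    rw [← hx, ← sub_eq_zero, ← map_sub, hker, Submodule.coe_sub, hyz]
    simpa using hz
  choose e heF heπ using this
  have hc := hU.isCompl hO 𝓕 i
  have hproj (x : U i) : (U i).projectionOnto (𝓕.fil (i + 1)) hc x = x := by simp
  refine ⟨fun a => e a, fun a => b.coord a ∘ₗ π ∘ₗ (U i).projectionOnto (𝓕.fil (i + 1)) hc,
    fun a => ⟨(e a).2, heF a⟩, fun a c => ?_, fun x hx h0 => ?_, fun a j => ?_, fun a => ?_⟩
  · simp only [LinearMap.comp_apply, hproj, heπ, Module.Basis.coord_apply,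
      Module.Basis.repr_self, Finsupp.single_apply]
    simp only [eq_comm]
  · have h1 : π ⟨x, hx.1⟩ = 0 := by
      refine b.ext_elem fun a => ?_
      have := h0 a
      rw [LinearMap.comp_apply, LinearMap.comp_apply, show x = ((⟨x, hx.1⟩ : U i) : H) from rfl,
        hproj] at this
      rw [map_zero, Finsupp.zero_apply]
      exact this
    exact Submodule.disjoint_def.1 (hU.isCompl_pred hO 𝓕 i).disjoint _ ((hker _).1 h1) hx.2
  · have := hD j (e a) ⟨C.D j (e a), hU.stable_D i j _ (e a).2⟩ rfl
    rw [heπ, hbD, hker] at this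
    exact this
  · have := hΦ (stdLift p k n) (e a) ⟨C.Φ₀ (e a), hU.stable_Φ i _ _ (e a).2⟩ rfl
    rw [heπ, hbΦ, ← heπ, ← map_nsmul, ← sub_eq_zero, ← map_sub, hker] at this
    simpa using this

end FCrystal.IsUnitRootFiltration

namespace IsOrdinaryCY3

/-- Fil^4 reduces to Fil^4 H_0 = 0, hence Fil^4 = p Fil^4, which is zero by separatedness. -/
theorem fil_eq_bot (hC : IsOrdinaryCY3 C 𝓕 B h) : 𝓕.fil 4 = ⊥ := by
  have h1 : ∀ x ∈ 𝓕.fil 4, ∃ y ∈ 𝓕.fil 4, x = p • y := by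
    intro x hx
    refine (𝓕.lifts 4).2 x hx ?_
    have : (pPow p k n H 1).mkQ x ∈ C.hodgeFil 4 := by
      rw [← (𝓕.lifts 4).1]
      exact Submodule.mem_map_of_mem hx
    rwa [hC.level.2, Submodule.mem_bot, Submodule.mkQ_apply, Submodule.Quotient.mk_eq_zero] at this
  rw [eq_bot_iff]
  intro x hx
  rw [Submodule.mem_bot]
  have key (m : ℕ) : ∀ x ∈ 𝓕.fil 4, ∃ y, x = p ^ m • y := by
    induction m with
    | zero => exact fun x _ => ⟨x, by simp⟩
    | succ m ih =>
      intro x hx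
      obtain ⟨y, hy, rfl⟩ := h1 x hx
      obtain ⟨z, rfl⟩ := ih y hy
      exact ⟨z, by rw [smul_smul, pow_succ']⟩
  exact pseparated_of_finite p k n H x fun m => key m x hx

theorem form_fil (hC : IsOrdinaryCY3 C 𝓕 B h) {i j : ℕ} (hij : 4 ≤ i + j) {x y : H}
    (hx : x ∈ 𝓕.fil i) (hy : y ∈ 𝓕.fil j) : B x y = 0 := by
  have h31 {x y : H} (hx : x ∈ 𝓕.fil 3) (hy : y ∈ 𝓕.fil 1) : B x y = 0 := by
    rw [← hC.riemann_three] at hy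
    exact hy x hx
  have h22 {x y : H} (hx : x ∈ 𝓕.fil 2) (hy : y ∈ 𝓕.fil 2) : B x y = 0 := by
    rw [← hC.riemann_two] at hy
    exact hy x hx
  have h13 {x y : H} (hx : x ∈ 𝓕.fil 1) (hy : y ∈ 𝓕.fil 3) : B x y = 0 := by
    rw [← hC.alternating.neg_eq, h31 hy hx, neg_zero]
  have h4 {x : H} {i : ℕ} (hi : 4 ≤ i) (hx : x ∈ 𝓕.fil i) : x = 0 := by
    have := 𝓕.anti hi hx
    rwa [hC.fil_eq_bot] at this
  rcases Nat.lt_or_ge i 4 with hi | hi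
  · rcases Nat.lt_or_ge j 4 with hj | hj
    · by_cases h3 : i = 3
      · exact h31 (h3 ▸ hx) (𝓕.anti (by omega) hy)
      · by_cases h3 : j = 3
        · exact h13 (𝓕.anti (by omega) hx) (h3 ▸ hy)
        · exact h22 (𝓕.anti (by omega) hx) (𝓕.anti (by omega) hy)
    · rw [h4 hj hy, map_zero]
  · rw [h4 hi hx, map_zero, LinearMap.zero_apply]

/-- By induction on i + j, pairings involving U_{i-1} or U_{j-1} vanish. Modulo these, p^i x and p^j
y lie in the spans of F(U_i) and F(U_j), where the form takes values in p^3 times Frobenius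
transforms of ⟨U_i, U_j⟩. Since i + j < 3, divisibility of the pairing by p^m improves to p^{m+1},
and so on without end. -/
theorem form_U (hC : IsOrdinaryCY3 C 𝓕 B h) (hU : C.IsUnitRootFiltration U) {i j : ℕ}
    (hij : i + j ≤ 2) : ∀ x ∈ U i, ∀ y ∈ U j, B x y = 0 := by
  induction hd : i + j using Nat.strong_induction_on generalizing i j with
  | _ d ih =>
    subst hd
    have hl : ∀ x ∈ pred U i, ∀ y ∈ U j, B x y = 0 := by
      intro x hx y hy
      cases i with
      | zero => rw [(Submodule.mem_bot _).1 hx, map_zero, LinearMap.zero_apply]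
      | succ i => exact ih (i + j) (by omega) (by omega) rfl x hx y hy
    have hr : ∀ x ∈ U i, ∀ y ∈ pred U j, B x y = 0 := by
      intro x hx y hy
      cases j with
      | zero => rw [(Submodule.mem_bot _).1 hy, map_zero]
      | succ j => exact ih (i + j) (by omega) (by omega) rfl x hx y hy
    have hspan (i : ℕ) {s : H} (hs : s ∈ Submodule.span (PS p k n) (C.Φ₀ '' U i)) : s ∈ U i := by
      refine Submodule.span_le.2 ?_ hs
      rintro _ ⟨x, hx, rfl⟩
      exact hU.stable_Φ i _ x hx
    have key (m : ℕ) : ∀ x ∈ U i, ∀ y ∈ U j, ∃ a, B x y = p ^ m • a := by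
      induction m with
      | zero => exact fun x _ y _ => ⟨B x y, by simp⟩
      | succ m ihm =>
        have hst : ∀ s ∈ Submodule.span (PS p k n) (C.Φ₀ '' U i),
            ∀ t ∈ Submodule.span (PS p k n) (C.Φ₀ '' U j), (p : PS p k n) ^ (3 + m) ∣ B s t := by
          intro s hs t ht
          induction hs using Submodule.span_induction with
          | mem s hs =>
            obtain ⟨x, hx, rfl⟩ := hs
            induction ht using Submodule.span_induction with
            | mem t ht =>
              obtain ⟨y, hy, rfl⟩ := ht
              obtain ⟨a, ha⟩ := ihm x hx y hy
              refine ⟨(stdLift p k n).hom a, ?_⟩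
              rw [hC.form_Φ, ha, map_nsmul, nsmul_eq_mul, Nat.cast_pow, pow_add, mul_assoc]
            | zero => rw [map_zero]; exact dvd_zero _
            | add t t' _ _ h1 h2 => rw [map_add]; exact dvd_add h1 h2
            | smul a t _ h1 => rw [map_smul, smul_eq_mul]; exact h1.mul_left a
          | zero => rw [map_zero, LinearMap.zero_apply]; exact dvd_zero _
          | add s s' _ _ h1 h2 => rw [map_add, LinearMap.add_apply]; exact dvd_add h1 h2
          | smul a s _ h1 =>
            rw [map_smul, LinearMap.smul_apply, smul_eq_mul]; exact h1.mul_left a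
        intro x hx y hy
        obtain ⟨s, hs, u, hu, hsu⟩ := hU.exists_slope hx
        obtain ⟨t, ht, w, hw, htw⟩ := hU.exists_slope hy
        obtain ⟨a, ha⟩ := hst s hs t ht
        have h1 : B (p ^ i • x) (p ^ j • y) = (p : PS p k n) ^ (3 + m) * a := by
          rw [hsu, htw, map_add, map_add, LinearMap.add_apply, LinearMap.add_apply,
            hl u hu t (hspan j ht), hl u hu w (hU.pred_le j hw), hr s (hspan i hs) w hw, ha]
          ring
        -- The exponent is (3 + m) - (i + j) - (m + 1).
        refine ⟨p ^ (2 - (i + j)) • a, pow_smul_cancel k n (i := i + j) ?_⟩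
        rw [map_nsmul, LinearMap.map_smul_of_tower, LinearMap.smul_apply, smul_smul,
          ← pow_add, add_comm j i] at h1
        rw [h1, smul_smul, smul_smul, nsmul_eq_mul, ← pow_add, ← pow_add, Nat.cast_pow]
        congr 2
        omega
    exact fun x hx y hy => ps_pseparated p k n _ fun m => key m x hx y hy

end IsOrdinaryCY3

end Filtrations

end CY3

end

noncomputable section

set_option linter.unusedSectionVars false

namespace CY3

/-! ### The Gram matrix and coordinates read off from the form. -/

section Gram

variable {h : ℕ}

/-- The index dual to `a` for the Gram matrix. -/
def dual : Idx h → Idx h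
  | .inl _ => .inr (.inr (.inr ()))
  | .inr (.inl i) => .inr (.inr (.inl i))
  | .inr (.inr (.inl i)) => .inr (.inl i)
  | .inr (.inr (.inr _)) => .inl ()

/-- The non-zero entry of the Gram matrix in the row `a`. -/
def gramSign : Idx h → ℤ
  | .inl _ => -1
  | .inr (.inl _) => 1
  | .inr (.inr (.inl _)) => -1
  | .inr (.inr (.inr _)) => 1

theorem dual_dual (a : Idx h) : dual (dual a) = a := by
  rcases a with _ | _ | _ | _ <;> rfl

theorem deg_dual (a : Idx h) : deg (dual a) + deg a = 3 := by
  rcases a with _ | _ | _ | _ <;> rfl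

theorem gramSign_mul_self (a : Idx h) : gramSign a * gramSign a = 1 := by
  rcases a with _ | _ | _ | _ <;> rfl

theorem gram_apply {R : Type*} [CommRing R] (a b : Idx h) :
    (gram a b : R) = if dual a = b then (gramSign a : R) else 0 := by
  rcases a with _ | _ | _ | _ <;> rcases b with _ | _ | _ | _ <;>
    simp [gram, dual, gramSign]

end Gram

section AdaptedBasis

variable {p : ℕ} [Fact p.Prime] {k : Type u} [Field k] {n h : ℕ}
variable {H : Type v} [AddCommGroup H] [Module (PS p k n) H]
variable {B : LinearMap.BilinForm (PS p k n) H}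

/-- The basis is its own dual up to sign and the involution `dual`, so vanishing of coordinates
becomes orthogonality. -/
theorem form_repr (e : Module.Basis (Idx h) (PS p k n) H)
    (he : (Matrix.of fun a b => B (e a) (e b)) = gram) (a : Idx h) (x : H) :
    B (e a) x = gramSign a * e.repr x (dual a) := by
  conv_lhs => rw [← e.sum_repr x]
  rw [map_sum, Finset.sum_eq_single (dual a)]
  · have : B (e a) (e (dual a)) = gram a (dual a) := by rw [← he]; rfl
    rw [map_smul, smul_eq_mul, this, gram_apply, if_pos rfl, mul_comm]
  · intro b _ hb
    have : B (e a) (e b) = gram a b := by rw [← he]; rfl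
    rw [map_smul, smul_eq_mul, this, gram_apply, if_neg hb.symm, mul_zero]
  · simp

theorem repr_eq_zero (e : Module.Basis (Idx h) (PS p k n) H)
    (he : (Matrix.of fun a b => B (e a) (e b)) = gram) {a : Idx h} {x : H}
    (hx : B (e (dual a)) x = 0) : e.repr x a = 0 := by
  rw [form_repr e he, dual_dual] at hx
  have := congrArg (fun y => (gramSign (dual a) : PS p k n) * y) hx
  simpa only [← mul_assoc, ← Int.cast_mul, gramSign_mul_self, Int.cast_one, one_mul,
    mul_zero] using this

end AdaptedBasis

/-! ### The basis adapted to both filtrations and to the form. -/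

section Existence

variable {p : ℕ} [Fact p.Prime] {k : Type u} [Field k] [CharP k p] [IsAlgClosed k] {n h : ℕ}
variable {H : Type v} [AddCommGroup H] [Module (PS p k n) H]
  [Module.Free (PS p k n) H] [Module.Finite (PS p k n) H]
variable {C : FCrystal p k n H} {𝓕 : HodgeFiltration C} {B : LinearMap.BilinForm (PS p k n) H}
variable {U : ℕ → Submodule (PS p k n) H}

open FCrystal

namespace IsOrdinaryCY3

theorem form_inf (hC : IsOrdinaryCY3 C 𝓕 B h) (hU : C.IsUnitRootFiltration U) {i j : ℕ}
    (hij : i + j ≠ 3) {x y : H} (hx : x ∈ U i ⊓ 𝓕.fil i) (hy : y ∈ U j ⊓ 𝓕.fil j) :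
    B x y = 0 := by
  rcases Nat.lt_or_gt_of_ne hij with hij | hij
  · exact hC.form_U hU (by omega) x hx.1 y hy.1
  · exact hC.form_fil (by omega) hx.2 hy.2

theorem exists_decomposition (hC : IsOrdinaryCY3 C 𝓕 B h) (hU : C.IsUnitRootFiltration U) (x : H) :
    ∃ x₀ ∈ U 0 ⊓ 𝓕.fil 0, ∃ x₁ ∈ U 1 ⊓ 𝓕.fil 1, ∃ x₂ ∈ U 2 ⊓ 𝓕.fil 2, ∃ x₃ ∈ U 3 ⊓ 𝓕.fil 3,
      x = x₀ + x₁ + x₂ + x₃ := by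
  obtain ⟨x₀, h₀, y₁, hy₁, rfl⟩ := hU.exists_add_fil hC.ordinary (𝓕 := 𝓕) (i := 0) (x := x)
    (by rw [𝓕.fil_zero]; trivial)
  obtain ⟨x₁, h₁, y₂, hy₂, rfl⟩ := hU.exists_add_fil hC.ordinary hy₁
  obtain ⟨x₂, h₂, y₃, hy₃, rfl⟩ := hU.exists_add_fil hC.ordinary hy₂
  obtain ⟨x₃, h₃, y₄, hy₄, rfl⟩ := hU.exists_add_fil hC.ordinary hy₃
  rw [show 3 + 1 = 4 from rfl, hC.fil_eq_bot, Submodule.mem_bot] at hy₄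
  refine ⟨x₀, h₀, x₁, h₁, x₂, h₂, x₃, h₃, ?_⟩
  rw [hy₄, add_zero, add_assoc, add_assoc]

/-- Perfectness of the form represents f by some vector of H, and H^i sees only the component of
that vector in H^j. -/
theorem exists_dual (hC : IsOrdinaryCY3 C 𝓕 B h) (hU : C.IsUnitRootFiltration U) {i j : ℕ}
    (hij : i + j = 3) (f : H →ₗ[PS p k n] PS p k n) :
    ∃ y ∈ U j ⊓ 𝓕.fil j, ∀ x ∈ U i ⊓ 𝓕.fil i, B x y = f x := by
  obtain ⟨y, hy⟩ := hC.nondegenerate.2 (-f)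
  have hy' (x : H) : B x y = f x := by
    rw [← hC.alternating.neg_eq, hy, LinearMap.neg_apply, neg_neg]
  obtain ⟨y₀, h₀, y₁, h₁, y₂, h₂, y₃, h₃, rfl⟩ := hC.exists_decomposition hU y
  have key {j' : ℕ} (hj : i + j' ≠ 3) {x y : H} (hx : x ∈ U i ⊓ 𝓕.fil i)
    (hy : y ∈ U j' ⊓ 𝓕.fil j') : B x y = 0 := hC.form_inf hU hj hx hy
  obtain rfl | rfl | rfl | rfl : j = 0 ∨ j = 1 ∨ j = 2 ∨ j = 3 := by omega
  · refine ⟨y₀, h₀, fun x hx => ?_⟩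
    rw [← hy', map_add, map_add, map_add, key (by omega) hx h₁, key (by omega) hx h₂,
      key (by omega) hx h₃, add_zero, add_zero, add_zero]
  · refine ⟨y₁, h₁, fun x hx => ?_⟩
    rw [← hy', map_add, map_add, map_add, key (by omega) hx h₀, key (by omega) hx h₂,
      key (by omega) hx h₃, add_zero, add_zero, zero_add]
  · refine ⟨y₂, h₂, fun x hx => ?_⟩
    rw [← hy', map_add, map_add, map_add, key (by omega) hx h₀, key (by omega) hx h₁,
      key (by omega) hx h₃, add_zero, add_zero, zero_add]
  · refine ⟨y₃, h₃, fun x hx => ?_⟩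
    rw [← hy', map_add, map_add, map_add, key (by omega) hx h₀, key (by omega) hx h₁,
      key (by omega) hx h₂, add_zero, add_zero, zero_add]

theorem eq_zero_of_form (hC : IsOrdinaryCY3 C 𝓕 B h) (hU : C.IsUnitRootFiltration U) {i j : ℕ}
    (hij : i + j = 3) {y : H} (hy : y ∈ U j ⊓ 𝓕.fil j) (h0 : ∀ x ∈ U i ⊓ 𝓕.fil i, B x y = 0) :
    y = 0 := by
  refine hC.nondegenerate.1 ?_
  rw [map_zero]
  refine LinearMap.ext fun x => ?_
  rw [← hC.alternating.neg_eq, LinearMap.zero_apply, neg_eq_zero]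
  obtain ⟨x₀, h₀, x₁, h₁, x₂, h₂, x₃, h₃, rfl⟩ := hC.exists_decomposition hU x
  have key {i' : ℕ} {x : H} (hx : x ∈ U i' ⊓ 𝓕.fil i') : B x y = 0 := by
    by_cases hi : i' = i
    · exact h0 x (hi ▸ hx)
    · exact hC.form_inf hU (by omega) hx hy
  rw [map_add, map_add, map_add, LinearMap.add_apply, LinearMap.add_apply, LinearMap.add_apply,
    key h₀, key h₁, key h₂, key h₃]
  simp

/-- A basis adapted to the unit root filtration, the Hodge filtration and the bilinear form,
horizontal on the graded pieces of the unit root filtration. -/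
theorem exists_basis (hC : IsOrdinaryCY3 C 𝓕 B h) (hU : C.IsUnitRootFiltration U) :
    ∃ e : Module.Basis (Idx h) (PS p k n) H, (∀ a, e a ∈ U (deg a) ⊓ 𝓕.fil (deg a)) ∧
      (Matrix.of fun a b => B (e a) (e b)) = gram ∧
      ∀ a, deg a ≤ 1 → (∀ j, C.D j (e a) ∈ pred U (deg a)) ∧
        C.Φ₀ (e a) - p ^ deg a • e a ∈ pred U (deg a) := by
  obtain ⟨e₀, f₀, he₀, hf₀, hz₀, hD₀, hΦ₀⟩ := hU.exists_graded_frame hC.ordinary 𝓕 hC.hodge_zero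
  obtain ⟨e₁, f₁, he₁, hf₁, hz₁, hD₁, hΦ₁⟩ := hU.exists_graded_frame hC.ordinary 𝓕 hC.hodge_one
  choose e₂ he₂ hB₂ using fun a => hC.exists_dual hU (i := 1) (j := 2) rfl (f₁ a)
  -- The minus sign produces the entry -1 in the top right corner of the Gram matrix.
  obtain ⟨e₃, he₃, hB₃⟩ := hC.exists_dual hU (i := 0) (j := 3) rfl (-f₀ 0)
  let E : Idx h → H
    | .inl _ => e₀ 0
    | .inr (.inl i) => e₁ i
    | .inr (.inr (.inl i)) => e₂ i
    | .inr (.inr (.inr _)) => e₃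
  have hE (a : Idx h) : E a ∈ U (deg a) ⊓ 𝓕.fil (deg a) := by
    rcases a with _ | i | i | _
    · exact he₀ 0
    · exact he₁ i
    · exact he₂ i
    · exact he₃
  have hB (a b : Idx h) : B (E a) (E b) = gram a b := by
    have h03 : B (e₀ 0) e₃ = -1 := by
      rw [hB₃ _ (he₀ 0), LinearMap.neg_apply, hf₀, if_pos rfl]
    have h12 (i j : Fin h) : B (e₁ i) (e₂ j) = if i = j then 1 else 0 := by
      rw [hB₂ j _ (he₁ i), hf₁]
      simp only [eq_comm]
    have h21 (i j : Fin h) : B (e₂ i) (e₁ j) = if i = j then -1 else 0 := by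
      rw [← hC.alternating.neg_eq, h12]
      simp only [eq_comm]
      split_ifs <;> simp
    have h30 : B e₃ (e₀ 0) = 1 := by rw [← hC.alternating.neg_eq, h03, neg_neg]
    by_cases hab : deg a + deg b = 3
    · rcases a with _ | i | i | _ <;> rcases b with _ | j | j | _ <;> simp only [deg] at hab <;>
        first
          | omega
          | exact h03
          | exact h30
          | exact h12 _ _
          | exact h21 _ _
    · rw [hC.form_inf hU hab (hE a) (hE b), gram_apply, if_neg]
      rintro rfl
      exact hab (by rw [add_comm]; exact deg_dual a)
  have hli : LinearIndependent (PS p k n) E := by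
    rw [Fintype.linearIndependent_iff]
    intro g hg a
    have h1 := congrArg (B (E (dual a))) hg
    rw [map_sum, map_zero, Finset.sum_eq_single a] at h1
    · rw [map_smul, hB, gram_apply, if_pos (dual_dual a), smul_eq_mul] at h1
      have := congrArg (fun y => y * (gramSign (dual a) : PS p k n)) h1
      simpa only [mul_assoc, ← Int.cast_mul, gramSign_mul_self, Int.cast_one, mul_one,
        zero_mul] using this
    · intro b _ hb
      rw [map_smul, hB, gram_apply, dual_dual, if_neg hb.symm, smul_zero]
    · simp
  have hmem (a : Idx h) : E a ∈ Submodule.span (PS p k n) (Set.range E) :=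
    Submodule.subset_span ⟨a, rfl⟩
  have hsp : ⊤ ≤ Submodule.span (PS p k n) (Set.range E) := by
    intro x _
    -- A vector orthogonal to every E c is zero: pairing with e₃ and e₂ gives the coordinates of its
    -- components in H^0 and H^1, and those in H^2 and H^3 are killed by nondegeneracy, because e₁
    -- and e₀ span H^1 and H^0.
    have key : ∀ y : H, (∀ c, B (E c) y = 0) → y = 0 := by
      intro y hy
      obtain ⟨y₀, h₀, y₁, h₁, y₂, h₂, y₃, h₃, rfl⟩ := hC.exists_decomposition hU y
      have hy' (c : Idx h) : B (E c) y₀ + B (E c) y₁ + B (E c) y₂ + B (E c) y₃ = 0 := by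
        rw [← hy c, map_add, map_add, map_add]
      have z₀ : y₀ = 0 := by
        refine hz₀ _ h₀ fun a => ?_
        have := hy' (.inr (.inr (.inr ())))
        rw [hC.form_inf hU (by decide) he₃ h₁, hC.form_inf hU (by decide) he₃ h₂,
          hC.form_inf hU (by decide) he₃ h₃, add_zero, add_zero, add_zero,
          ← hC.alternating.neg_eq] at this
        change -B y₀ e₃ = 0 at this
        rw [hB₃ _ h₀, LinearMap.neg_apply, neg_neg] at this
        rw [Subsingleton.elim a 0, this]
      have z₁ : y₁ = 0 := by
        refine hz₁ _ h₁ fun a => ?_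
        have := hy' (.inr (.inr (.inl a)))
        rw [hC.form_inf hU (by decide) (he₂ a) h₀, hC.form_inf hU (by decide) (he₂ a) h₂,
          hC.form_inf hU (by decide) (he₂ a) h₃, add_zero, add_zero, zero_add,
          ← hC.alternating.neg_eq, neg_eq_zero] at this
        rwa [← hB₂ a _ h₁]
      have z₂ : y₂ = 0 := by
        refine hC.eq_zero_of_form hU (i := 1) (j := 2) rfl h₂ fun x hx => ?_
        obtain ⟨c, rfl⟩ : ∃ c : Fin h → PS p k n, x = ∑ a, c a • e₁ a := by
          refine ⟨fun a => f₁ a x, sub_eq_zero.1 <| hz₁ _ (sub_mem hx (sum_mem fun a _ =>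
            Submodule.smul_mem _ _ (he₁ a))) fun a => ?_⟩
          simp [hf₁]
        rw [map_sum, LinearMap.sum_apply]
        refine Finset.sum_eq_zero fun a _ => ?_
        have := hy' (.inr (.inl a))
        rw [z₀, z₁, hC.form_inf hU (by decide) (he₁ a) h₃, map_zero, add_zero, zero_add,
          zero_add] at this
        rw [map_smul, LinearMap.smul_apply]
        change c a • B (e₁ a) y₂ = 0
        rw [show B (e₁ a) y₂ = 0 from this, smul_zero]
      have z₃ : y₃ = 0 := by
        refine hC.eq_zero_of_form hU (i := 0) (j := 3) rfl h₃ fun x hx => ?_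
        obtain ⟨c, rfl⟩ : ∃ c : PS p k n, x = c • e₀ 0 := by
          refine ⟨f₀ 0 x, sub_eq_zero.1 <|
            hz₀ _ (sub_mem hx (Submodule.smul_mem _ _ (he₀ 0))) fun a => ?_⟩
          rw [Subsingleton.elim a 0, map_sub, map_smul, hf₀, if_pos rfl, smul_eq_mul, mul_one,
            sub_self]
        have := hy' (.inl ())
        rw [z₀, z₁, z₂, map_zero, zero_add, zero_add, zero_add] at this
        rw [map_smul, LinearMap.smul_apply, show B (e₀ 0) y₃ = 0 from this, smul_zero]
      rw [z₀, z₁, z₂, z₃, add_zero, add_zero, add_zero]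
    have hx : x - ∑ a, ((gramSign (dual a) : PS p k n) * B (E (dual a)) x) • E a = 0 := by
      refine key _ fun c => ?_
      rw [map_sub, map_sum, Finset.sum_eq_single (dual c)]
      · rw [map_smul, hB, gram_apply, if_pos rfl, dual_dual, smul_eq_mul, mul_right_comm,
          ← Int.cast_mul, gramSign_mul_self, Int.cast_one, one_mul, sub_self]
      · intro b _ hb
        rw [map_smul, hB, gram_apply, if_neg hb.symm, smul_zero]
      · simp
    rw [sub_eq_zero.1 hx]
    exact sum_mem fun a _ => Submodule.smul_mem _ _ (hmem a)
  refine ⟨Module.Basis.mk hli hsp, fun a => by rw [Module.Basis.mk_apply]; exact hE a, ?_, ?_⟩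
  · ext1 a b
    rw [Matrix.of_apply, Module.Basis.mk_apply, Module.Basis.mk_apply]
    exact hB a b
  · intro a ha
    rw [Module.Basis.mk_apply]
    rcases a with _ | i | i | _
    · exact ⟨hD₀ 0, hΦ₀ 0⟩
    · exact ⟨hD₁ i, hΦ₁ i⟩
    · simp [deg] at ha
    · simp [deg] at ha

section Coordinates

variable (e : Module.Basis (Idx h) (PS p k n) H)

theorem repr_eq_zero_of_mem_U (hC : IsOrdinaryCY3 C 𝓕 B h) (hU : C.IsUnitRootFiltration U)
    (he : ∀ a, e a ∈ U (deg a) ⊓ 𝓕.fil (deg a))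
    (hB : (Matrix.of fun a b => B (e a) (e b)) = gram) {i : ℕ} {x : H} (hx : x ∈ U i) {a : Idx h}
    (ha : i < deg a) : e.repr x a = 0 :=
  repr_eq_zero e hB (hC.form_U hU (by have := deg_dual a; omega) _ (he _).1 _ hx)

theorem repr_eq_zero_of_mem_pred (hC : IsOrdinaryCY3 C 𝓕 B h) (hU : C.IsUnitRootFiltration U)
    (he : ∀ a, e a ∈ U (deg a) ⊓ 𝓕.fil (deg a))
    (hB : (Matrix.of fun a b => B (e a) (e b)) = gram) {i : ℕ} {x : H} (hx : x ∈ pred U i)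
    {a : Idx h} (ha : i ≤ deg a) : e.repr x a = 0 := by
  cases i with
  | zero => rw [(Submodule.mem_bot _).1 hx, map_zero, Finsupp.zero_apply]
  | succ i => exact hC.repr_eq_zero_of_mem_U e hU he hB hx ha

theorem mem_fil_iff (hC : IsOrdinaryCY3 C 𝓕 B h) (he : ∀ a, e a ∈ U (deg a) ⊓ 𝓕.fil (deg a))
    (hB : (Matrix.of fun a b => B (e a) (e b)) = gram) {i : ℕ} {x : H} :
    x ∈ 𝓕.fil i ↔ ∀ a, deg a < i → e.repr x a = 0 := by
  constructor
  · intro hx a ha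
    exact repr_eq_zero e hB (hC.form_fil (by have := deg_dual a; omega) (he _).2 hx)
  · intro h0
    rw [← e.sum_repr x]
    refine sum_mem fun a _ => ?_
    by_cases ha : deg a < i
    · rw [h0 a ha, zero_smul]
      exact zero_mem _
    · exact Submodule.smul_mem _ _ (𝓕.anti (not_lt.1 ha) (he a).2)

theorem form_pred (hC : IsOrdinaryCY3 C 𝓕 B h) (hU : C.IsUnitRootFiltration U) {i j : ℕ}
    (hij : i + j ≤ 3) {x y : H} (hx : x ∈ pred U i) (hy : y ∈ U j) : B x y = 0 := by
  cases i with
  | zero => rw [(Submodule.mem_bot _).1 hx, map_zero, LinearMap.zero_apply]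
  | succ i => exact hC.form_U hU (by omega) x hx y hy

end Coordinates

/-- A basis adapted to the unit root filtration, the Hodge filtration and the bilinear form, in
which the connection has only components of degree `-1` and the Frobenius is upper triangular. -/
theorem exists_adapted_basis (hC : IsOrdinaryCY3 C 𝓕 B h) (hU : C.IsUnitRootFiltration U) :
    ∃ e : Module.Basis (Idx h) (PS p k n) H, (∀ a, e a ∈ U (deg a) ⊓ 𝓕.fil (deg a)) ∧
      (Matrix.of fun a b => B (e a) (e b)) = gram ∧
      (∀ j a b, deg a + 1 ≠ deg b → e.repr (C.D j (e b)) a = 0) ∧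
      ∀ a b, deg b ≤ deg a →
        e.repr (C.Φ₀ (e b)) a = if a = b then (p : PS p k n) ^ deg b else 0 := by
  obtain ⟨e, he, hB, hD⟩ := hC.exists_basis hU
  have hBe (a b : Idx h) : B (e a) (e b) = gram a b := by rw [← hB]; rfl
  refine ⟨e, he, hB, fun j a b hab => ?_, fun a b hab => ?_⟩
  · rcases Nat.lt_or_gt_of_ne hab with hab | hab
    · refine (hC.mem_fil_iff e he hB (i := deg b - 1)).1 ?_ a (by omega)
      refine 𝓕.transversal _ _ _ ?_
      rw [Nat.sub_add_cancel (by omega)]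
      exact (he b).2
    · rcases Nat.lt_or_ge (deg b) (deg a) with hlt | hle
      · exact hC.repr_eq_zero_of_mem_U e hU he hB (hU.stable_D _ j _ (he b).1) hlt
      · by_cases hb : deg b ≤ 1
        · exact hC.repr_eq_zero_of_mem_pred e hU he hB ((hD b hb).1 j) (by omega)
        -- In degrees 2 and 3 horizontality is inherited by duality: ⟨e_{dual a}, e_b⟩ is constant
        -- and D_j e_{dual a} is orthogonal to e_b, hence so is D_j e_b to e_{dual a}.
        · refine repr_eq_zero e hB ?_
          have h1 := hC.form_D j (e (dual a)) (e b)
          have h2 := deg_dual a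
          rw [hBe, hC.form_pred hU (by omega) ((hD (dual a) (by omega)).1 j) (he b).1,
            zero_add] at h1
          rw [h1, gram_apply]
          have h3 (z : ℤ) : dA p k n j (z : PS p k n) = 0 := Derivation.map_intCast _ _
          split_ifs
          · exact h3 _
          · simpa using h3 0
  · have hx : e.repr (C.Φ₀ (e b) - p ^ deg b • e b) a = 0 := by
      rcases hab.lt_or_eq with hlt | heq
      · refine hC.repr_eq_zero_of_mem_U e hU he hB (i := deg b) ?_ hlt
        exact sub_mem (hU.stable_Φ _ _ _ (he b).1) ((U (deg b)).smul_of_tower_mem _ (he b).1)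
      · by_cases hb : deg b ≤ 1
        · exact hC.repr_eq_zero_of_mem_pred e hU he hB (hD b hb).2 hab
        -- By duality again: F e_{dual a} may be replaced by p^{deg (dual a)} e_{dual a} in ⟨F
        -- e_{dual a}, F e_b⟩ = p^3 φ⟨e_{dual a}, e_b⟩, and deg (dual a) + deg b = 3.
        · refine repr_eq_zero e hB ?_
          have h2 := deg_dual a
          have h1 := hC.form_Φ (stdLift p k n) (e (dual a)) (e b)
          have h3 := hC.form_pred hU (j := deg b) (by omega) (hD (dual a) (by omega)).2
            (hU.stable_Φ _ (stdLift p k n) _ (he b).1)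
          rw [map_sub, LinearMap.sub_apply, h1, hBe, gram_apply] at h3
          refine pow_smul_cancel k n (i := deg (dual a)) ?_
          have h4 (z : ℤ) : (stdLift p k n).hom (z : PS p k n) = z := map_intCast _ _
          rw [map_sub, smul_sub, smul_zero, map_nsmul, hBe, smul_smul, ← pow_add, gram_apply,
            show deg (dual a) + deg b = 3 by omega]
          rw [LinearMap.map_smul_of_tower, LinearMap.smul_apply, sub_eq_zero] at h3
          rw [sub_eq_zero, ← h3, nsmul_eq_mul, Nat.cast_pow]
          congr 1
          split_ifs
          · exact h4 _
          · simp
    rw [map_sub, Finsupp.sub_apply, sub_eq_zero, map_nsmul, Finsupp.smul_apply,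
      Module.Basis.repr_self, Finsupp.single_apply] at hx
    rw [hx, nsmul_eq_mul, Nat.cast_pow]
    simp only [eq_comm]
    split_ifs <;> simp

end IsOrdinaryCY3

end Existence

end CY3

end

noncomputable section

set_option linter.unusedSectionVars false

namespace CY3

/-! ### The operators σ - p^m on K. -/

section FrobK

variable {p : ℕ} [Fact p.Prime] {k : Type u} [Field k] [CharP k p] [PerfectRing k p]

/-- The Frobenius of `K = Frac W(k)`. -/
abbrev frobK : FractionRing (WittVector p k) →+* FractionRing (WittVector p k) :=
  WittVector.FractionRing.frobeniusRingHom p k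

theorem frobK_algebraMap (w : WittVector p k) :
    frobK (algebraMap (WittVector p k) (FractionRing (WittVector p k)) w) =
      algebraMap _ _ (WittVector.frobenius w) :=
  IsFractionRing.ringEquivOfRingEquiv_algebraMap _ _

theorem cast_p_ne_zero : (p : FractionRing (WittVector p k)) ≠ 0 :=
  Nat.cast_ne_zero.2 (Fact.out : p.Prime).ne_zero

theorem exists_pow_mul_eq (x : FractionRing (WittVector p k)) :
    ∃ (N : ℕ) (w : WittVector p k), (p : FractionRing (WittVector p k)) ^ N * x =
      algebraMap _ _ w := by
  obtain ⟨a, b, hb, rfl⟩ := IsFractionRing.div_surjective (A := WittVector p k) x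
  have hb0 := nonZeroDivisors.ne_zero hb
  obtain ⟨N, c, hc⟩ := WittVector.exists_eq_pow_p_mul' b hb0
  refine ⟨N, a * ↑c⁻¹, ?_⟩
  have hbK : algebraMap (WittVector p k) (FractionRing (WittVector p k)) b ≠ 0 := by
    rwa [Ne, IsFractionRing.to_map_eq_zero_iff]
  rw [mul_div_assoc', div_eq_iff hbK, hc, map_mul, map_mul, map_pow, map_natCast]
  have h1 : algebraMap (WittVector p k) (FractionRing (WittVector p k)) ↑c⁻¹ *
      algebraMap _ _ (c : WittVector p k) = 1 := by
    rw [← map_mul, Units.inv_mul, map_one]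
  linear_combination (-(p : FractionRing (WittVector p k)) ^ N *
    algebraMap (WittVector p k) (FractionRing (WittVector p k)) a) * h1

/-- For m > 0 the operator σ - p^m reduces modulo p to σ, which is bijective as k is perfect. It is
therefore surjective on W(k) by successive approximation, and on K after clearing denominators. -/
theorem exists_frobK_sub {m : ℕ} (hm : m ≠ 0) (c : FractionRing (WittVector p k)) :
    ∃ s, frobK s - (p : FractionRing (WittVector p k)) ^ m * s = c := by
  have hsurj : Function.Surjective ((WittVector.frobenius (p := p) (R := k)).toAddMonoidHom -
      AddMonoidHom.mulLeft ((p : WittVector p k) ^ m)) := by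
    refine surjective_of_surjective_mod (witt_pcomplete p k) (witt_pseparated p k) _ fun w => ?_
    obtain ⟨z, hz⟩ := (WittVector.frobenius_bijective p k).2 w
    refine ⟨z, -((p : WittVector p k) ^ (m - 1) * z), ?_⟩
    change WittVector.frobenius z - (p : WittVector p k) ^ m * z = _
    rw [hz, nsmul_eq_mul, sub_eq_add_neg, mul_neg, ← mul_assoc, ← pow_succ',
      Nat.sub_add_cancel (Nat.pos_of_ne_zero hm)]
  obtain ⟨N, w, hw⟩ := exists_pow_mul_eq c
  obtain ⟨z, hz⟩ := hsurj w
  change WittVector.frobenius z - (p : WittVector p k) ^ m * z = w at hz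
  have hp := pow_ne_zero N (cast_p_ne_zero (p := p) (k := k))
  refine ⟨((p : FractionRing (WittVector p k)) ^ N)⁻¹ * algebraMap _ _ z, ?_⟩
  have h1 := congrArg (algebraMap (WittVector p k) (FractionRing (WittVector p k))) hz
  rw [map_sub, map_mul, map_pow, map_natCast, ← hw] at h1
  rw [map_mul, map_inv₀, map_pow, map_natCast, frobK_algebraMap]
  field_simp
  linear_combination h1

/-- After scaling into W(k), σ(w) = p^m w. As σ is bijective and fixes p, each power of p dividing w
can be raised, so w = 0. -/
theorem eq_zero_of_frobK_eq {m : ℕ} (hm : m ≠ 0) {s : FractionRing (WittVector p k)}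
    (hs : frobK s = (p : FractionRing (WittVector p k)) ^ m * s) : s = 0 := by
  obtain ⟨N, w, hw⟩ := exists_pow_mul_eq s
  have hp := pow_ne_zero N (cast_p_ne_zero (p := p) (k := k))
  have h1 : WittVector.frobenius w = (p : WittVector p k) ^ m * w := by
    apply IsFractionRing.injective (WittVector p k) (FractionRing (WittVector p k))
    rw [← frobK_algebraMap, ← hw, map_mul, map_mul, map_pow, map_natCast, hs, map_pow, map_natCast,
      ← hw]
    ring
  have h2 : w = 0 := by
    refine witt_pseparated p k w fun l => ?_
    induction l with
    | zero => exact ⟨w, by simp⟩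
    | succ l ih =>
      obtain ⟨z, hz⟩ := ih
      obtain ⟨y, hy⟩ := (WittVector.frobenius_bijective p k).2 ((p : WittVector p k) ^ (m - 1) * z)
      refine ⟨y, (WittVector.frobenius_bijective p k).1 ?_⟩
      rw [map_nsmul, hy, h1, hz, nsmul_eq_mul, nsmul_eq_mul, Nat.cast_pow, Nat.cast_pow,
        pow_succ (p : WittVector p k) l, ← Nat.sub_add_cancel (Nat.pos_of_ne_zero hm), pow_succ,
        Nat.add_sub_cancel]
      ring
  rw [h2, map_zero] at hw
  exact (mul_eq_zero.1 hw).resolve_left hp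

end FrobK

/-! ### Diagonalization of a triangular Frobenius matrix over K. -/

section Unipotent

variable {p : ℕ} [Fact p.Prime] {k : Type u} [Field k] [CharP k p] [PerfectRing k p]
variable {ι : Type*} [Fintype ι] [DecidableEq ι]

local notation "K" => FractionRing (WittVector p k)

/-- An upper triangular Frobenius matrix with diagonal `p ^ d a` becomes diagonal after a unipotent
change of basis over `K`. -/
theorem exists_unipotent (d : ι → ℕ) (Q : Matrix ι ι K)
    (hQ : ∀ a b, d b ≤ d a → Q a b = if a = b then (p : K) ^ d b else 0) :
    ∃ T : Matrix ι ι K, (∀ a b, d b ≤ d a → T a b = if a = b then 1 else 0) ∧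
      ∀ a b, (T * Q) a b = (p : K) ^ d a * frobK (T a b) := by
  -- For d b ≤ d a the equation holds automatically, by triangularity of T and Q.
  have low (a : ι) (t : ι → K) (ht : ∀ b, d b ≤ d a → t b = if a = b then 1 else 0) (b : ι)
      (hb : d b ≤ d a) : ∑ c, t c * Q c b = (p : K) ^ d a * frobK (t b) := by
    rw [Finset.sum_eq_single a]
    · rw [ht a le_rfl, if_pos rfl, ht b hb, hQ a b hb]
      split_ifs with h
      · rw [h]; simp
      · simp
    · intro c _ hc
      rcases le_or_gt (d c) (d a) with h | h
      · rw [ht c h, if_neg hc.symm, zero_mul]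
      · rw [hQ c b (by omega), if_neg (by rintro rfl; omega), mul_zero]
    · simp
  have row (a : ι) (N : ℕ) : ∃ t : ι → K, (∀ b, d b ≤ d a → t b = if a = b then 1 else 0) ∧
      ∀ b, d b < N → ∑ c, t c * Q c b = (p : K) ^ d a * frobK (t b) := by
    induction N with
    | zero => exact ⟨fun b => if a = b then 1 else 0, fun b _ => rfl, fun b hb => by omega⟩
    | succ N ih =>
      obtain ⟨t, ht, htQ⟩ := ih
      rcases le_or_gt N (d a) with hN | hN
      · exact ⟨t, ht, fun b hb => low a t ht b (by omega)⟩
      have hp := pow_ne_zero (d a) (cast_p_ne_zero (p := p) (k := k))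
      -- Row a is solved by increasing column degree. In degree N the equation for s = T a b is p^{d
      -- a} σ(s) - p^N s = ∑ over d c < N of T a c * Q c b; dividing by p^{d a} gives the operator σ
      -- - p^{N - d a}.
      choose s hs using fun b => exists_frobK_sub (p := p) (k := k) (m := N - d a) (by omega)
        (((p : K) ^ d a)⁻¹ * ∑ c, if d c < N then t c * Q c b else 0)
      refine ⟨fun b => if d b = N then s b else t b, fun b hb => ?_, fun b hb => ?_⟩
      · simp only [if_neg (show ¬ d b = N by omega)]
        exact ht b hb
      · rcases (Nat.lt_succ_iff.1 hb).lt_or_eq with hb | hb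
        · simp only [if_neg hb.ne]
          rw [← htQ b hb]
          refine Finset.sum_congr rfl fun c _ => ?_
          split_ifs with hc
          · rw [hQ c b (by omega), if_neg (by rintro rfl; omega), mul_zero, mul_zero]
          · rfl
        · simp only [if_pos hb]
          have h1 : ∀ c, (if d c = N then s c else t c) * Q c b =
              (if d c < N then t c * Q c b else 0) + if c = b then s b * (p : K) ^ N else 0 := by
            intro c
            rcases lt_trichotomy (d c) N with hc | hc | hc
            · rw [if_neg hc.ne, if_pos hc, if_neg (by rintro rfl; omega), add_zero]
            · rw [if_pos hc, if_neg (by omega), zero_add, hQ c b (by omega)]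
              split_ifs with h
              · rw [h, hb]
              · rw [mul_zero]
            · have hcb : c ≠ b := by rintro rfl; omega
              rw [hQ c b (by omega), if_neg hcb, if_neg hcb, if_neg (not_lt.2 hc.le), mul_zero,
                add_zero]
          rw [Finset.sum_congr rfl fun c _ => h1 c, Finset.sum_add_distrib, Finset.sum_ite_eq',
            if_pos (Finset.mem_univ _)]
          have h2 := hs b
          rw [eq_inv_mul_iff_mul_eq₀ hp] at h2
          rw [← h2, mul_sub, ← mul_assoc, ← pow_add, Nat.add_sub_cancel' hN.le]
          ring
  choose t ht htQ using fun a => row a (Finset.univ.sup d + 1)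
  exact ⟨Matrix.of t, fun a b hb => ht a b hb, fun a b => htQ a b
    (Nat.lt_succ_iff.2 (Finset.le_sup (Finset.mem_univ b)))⟩

end Unipotent

/-! ### The diagonalizing matrix is symplectic. -/

section Symplectic

variable {p : ℕ} [Fact p.Prime] {k : Type u} [Field k] [CharP k p] [PerfectRing k p] {h : ℕ}

local notation "K" => FractionRing (WittVector p k)

open Matrix

theorem sum_gram {R : Type*} [CommRing R] (x y : Idx h → R) :
    x ⬝ᵥ (gram *ᵥ y) = ∑ a, x a * (gramSign a * y (dual a)) := by
  refine Finset.sum_congr rfl fun a _ => ?_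
  congr 1
  rw [Matrix.mulVec, dotProduct, Finset.sum_eq_single (dual a)]
  · rw [gram_apply, if_pos rfl]
  · intro b _ hb
    rw [gram_apply, if_neg hb.symm, zero_mul]
  · simp

theorem gram_map {R S : Type*} [CommRing R] [CommRing S] (f : R →+* S) :
    (gram : Matrix (Idx h) (Idx h) R).map f = gram := by
  ext1 a b
  rw [Matrix.map_apply, gram_apply, gram_apply]
  split_ifs <;> simp

theorem diagP_mul_gram_mul_diagP {R : Type*} [CommRing R] (p : ℕ) :
    diagP p * (gram : Matrix (Idx h) (Idx h) R) * diagP p = (p : R) ^ 3 • gram := by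
  ext1 a b
  rw [diagP, Matrix.mul_diagonal, Matrix.diagonal_mul, Matrix.smul_apply, gram_apply]
  split_ifs with hab
  · rw [← hab, mul_right_comm, ← pow_add, add_comm, deg_dual, smul_eq_mul]
  · simp

/-- The unipotent matrix that diagonalizes a symplectic Frobenius matrix is symplectic. -/
theorem transpose_mul_gram_mul (Q T : Matrix (Idx h) (Idx h) K)
    (hQ : ∀ a b, deg b ≤ deg a → Q a b = if a = b then (p : K) ^ deg b else 0)
    (hQG : Qᵀ * gram * Q = (p : K) ^ 3 • gram)
    (hT : ∀ a b, deg b ≤ deg a → T a b = if a = b then 1 else 0)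
    (hTQ : T * Q = diagP p * T.map frobK) : Tᵀ * gram * T = gram := by
  rw [← sub_eq_zero]
  set Δ := Tᵀ * gram * T - gram with hΔ
  have hΔQ : Qᵀ * Δ * Q = (p : K) ^ 3 • Δ.map frobK := by
    have h1 : Qᵀ * (Tᵀ * gram * T) * Q = (p : K) ^ 3 • ((Tᵀ * gram * T).map frobK) := by
      calc Qᵀ * (Tᵀ * gram * T) * Q = (T * Q)ᵀ * gram * (T * Q) := by
            rw [Matrix.transpose_mul]; simp only [Matrix.mul_assoc]
        _ = (T.map frobK)ᵀ * (diagP p * gram * diagP p) * T.map frobK := by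
            rw [hTQ, Matrix.transpose_mul, diagP, Matrix.diagonal_transpose]
            simp only [Matrix.mul_assoc]
        _ = _ := by
            rw [diagP_mul_gram_mul_diagP, Matrix.map_mul, Matrix.map_mul, gram_map,
              Matrix.mul_smul, Matrix.smul_mul, Matrix.transpose_map]
    have h2 : Δ.map frobK = (Tᵀ * gram * T).map frobK - gram := by
      rw [hΔ, Matrix.map_sub _ (map_sub _), gram_map]
    rw [h2, smul_sub, ← h1, ← hQG, hΔ, Matrix.mul_sub, Matrix.sub_mul]
  have entry (X Y : Matrix (Idx h) (Idx h) K) (a b : Idx h) :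
      (Xᵀ * Y * X) a b = ∑ d, ∑ c, X c a * Y c d * X d b := by
    rw [Matrix.mul_apply]
    refine Finset.sum_congr rfl fun d _ => ?_
    rw [Matrix.mul_apply, Finset.sum_mul]
    rfl
  -- T is unipotent and the Gram matrix pairs only degrees with sum 3, so in this range only the
  -- term c = a, d = b survives.
  have low (a b : Idx h) (hab : deg a + deg b ≤ 3) : Δ a b = 0 := by
    rw [hΔ, Matrix.sub_apply, sub_eq_zero, entry, Finset.sum_eq_single b,
      Finset.sum_eq_single a]
    · rw [hT a a le_rfl, hT b b le_rfl, if_pos rfl, if_pos rfl, one_mul, mul_one]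
    · intro c _ hc
      rcases le_or_gt (deg a) (deg c) with h | h
      · rw [hT c a h, if_neg hc, zero_mul, zero_mul]
      · rw [gram_apply, if_neg, mul_zero, zero_mul]
        rintro rfl
        have := deg_dual c
        omega
    · simp
    · intro d _ hd
      refine Finset.sum_eq_zero fun c _ => ?_
      rcases le_or_gt (deg b) (deg d) with h | h
      · rw [hT d b h, if_neg hd, mul_zero]
      · rcases le_or_gt (deg a) (deg c) with h' | h'
        · rw [hT c a h']
          split_ifs with hca
          · subst hca
            rw [gram_apply, if_neg, mul_zero, zero_mul]
            rintro rfl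
            have := deg_dual c
            omega
          · rw [zero_mul, zero_mul]
        · rw [gram_apply, if_neg, mul_zero, zero_mul]
          rintro rfl
          have := deg_dual c
          omega
    · simp
  have key (N : ℕ) : ∀ a b, deg a + deg b ≤ N → Δ a b = 0 := by
    induction N with
    | zero => exact fun a b hab => low a b (by omega)
    | succ N ih =>
      intro a b hab
      rcases le_or_gt (deg a + deg b) 3 with h3 | h3
      · exact low a b h3
      -- Entries of Δ of smaller total degree vanish by induction, so only the diagonal of Q
      -- contributes. Since the total degree exceeds 3, injectivity of σ - p^m with m > 0 gives Δ a
      -- b = 0.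
      have h1 : (p : K) ^ (deg a + deg b) * Δ a b = (p : K) ^ 3 * frobK (Δ a b) := by
        have := congrFun (congrFun hΔQ a) b
        rw [entry, Finset.sum_eq_single b, Finset.sum_eq_single a] at this
        · rw [hQ a a le_rfl, hQ b b le_rfl, if_pos rfl, if_pos rfl] at this
          rw [pow_add, mul_right_comm, this]
          rfl
        · intro c _ hc
          rcases le_or_gt (deg a) (deg c) with h | h
          · rw [hQ c a h, if_neg hc, zero_mul, zero_mul]
          · rw [ih c b (by omega), mul_zero, zero_mul]
        · simp
        · intro d _ hd
          refine Finset.sum_eq_zero fun c _ => ?_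
          rcases le_or_gt (deg b) (deg d) with h | h
          · rw [hQ d b h, if_neg hd, mul_zero]
          · rcases le_or_gt (deg a) (deg c) with h' | h'
            · rw [hQ c a h']
              split_ifs with hca
              · subst hca
                rw [ih c d (by omega), mul_zero, zero_mul]
              · rw [zero_mul, zero_mul]
            · rw [ih c d (by omega), mul_zero, zero_mul]
        · simp
      refine eq_zero_of_frobK_eq (m := deg a + deg b - 3) (by omega) ?_
      have hp := pow_ne_zero 3 (cast_p_ne_zero (p := p) (k := k))
      refine mul_left_cancel₀ hp ?_
      rw [← h1, ← mul_assoc, ← pow_add]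
      congr 2
      omega
  ext1 a b
  exact key _ a b le_rfl

end Symplectic

end CY3

end

noncomputable section

set_option linter.unusedSectionVars false

namespace CY3

/-- `m! = ∏ m_j!`. -/
def mfact {n : ℕ} (m : Fin n →₀ ℕ) : ℕ := ∏ j, (m j).factorial

theorem mfact_ne_zero {n : ℕ} (m : Fin n →₀ ℕ) : mfact m ≠ 0 :=
  Finset.prod_ne_zero_iff.2 fun j _ => (m j).factorial_ne_zero

theorem mfact_add_single {n : ℕ} (m : Fin n →₀ ℕ) (j : Fin n) :
    mfact (m + Finsupp.single j 1) = (m j + 1) * mfact m := by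
  rw [mfact, mfact, ← Finset.mul_prod_erase _ _ (Finset.mem_univ j),
    ← Finset.mul_prod_erase _ (fun j => (m j).factorial) (Finset.mem_univ j), ← mul_assoc,
    Finsupp.add_apply, Finsupp.single_eq_same, Nat.factorial_succ]
  congr 1
  refine Finset.prod_congr rfl fun i hi => ?_
  rw [Finsupp.add_apply, Finsupp.single_eq_of_ne (Finset.ne_of_mem_erase hi), add_zero]

/-! ### Derivations of K[[t]], formal differential systems and the standard Frobenius. -/

section Derivations

variable {p : ℕ} [Fact p.Prime] {k : Type u} [Field k] {n : ℕ}

local notation "K" => FractionRing (WittVector p k)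

theorem dK_add (j : Fin n) (f g : KPS p k n) : dK p k n j (f + g) = dK p k n j f + dK p k n j g :=
  map_add _ _ _

theorem dK_sub (j : Fin n) (f g : KPS p k n) : dK p k n j (f - g) = dK p k n j f - dK p k n j g :=
  map_sub _ _ _

theorem dK_sum {ι : Type*} (s : Finset ι) (j : Fin n) (f : ι → KPS p k n) :
    dK p k n j (∑ i ∈ s, f i) = ∑ i ∈ s, dK p k n j (f i) :=
  map_sum _ _ _

theorem dK_mul (j : Fin n) (f g : KPS p k n) :
    dK p k n j (f * g) = f * dK p k n j g + dK p k n j f * g := by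
  rw [dK, Derivation.leibniz, smul_eq_mul, smul_eq_mul, mul_comm g]
  rfl

theorem coeff_dK (j : Fin n) (f : KPS p k n) (m : Fin n →₀ ℕ) :
    MvPowerSeries.coeff m (dK p k n j f) =
      MvPowerSeries.coeff (m + Finsupp.single j 1) f * (m j + 1) :=
  MvPowerSeries.coeff_pderiv f m

theorem dK_toKPS (j : Fin n) (a : PS p k n) :
    dK p k n j (toKPS p k n a) = toKPS p k n (dA p k n j a) := by
  refine MvPowerSeries.ext fun m => ?_
  rw [coeff_dK, toKPS, MvPowerSeries.coeff_map, MvPowerSeries.coeff_map, dA,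
    MvPowerSeries.coeff_pderiv, map_mul, map_add, map_natCast, map_one]

theorem dK_intCast (j : Fin n) (z : ℤ) : dK p k n j z = 0 := Derivation.map_intCast _ _

theorem dK_natCast_pow_mul (j : Fin n) (q i : ℕ) (f : KPS p k n) :
    dK p k n j ((q : KPS p k n) ^ i * f) = (q : KPS p k n) ^ i * dK p k n j f := by
  have h : dK p k n j ((q : KPS p k n) ^ i) = 0 := by
    rw [← Nat.cast_pow]
    exact Derivation.map_natCast _ _
  rw [dK_mul, h, zero_mul, add_zero]

variable [CharP k p]

/-- A differential system with a unique formal solution: a set of power series without constant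
terms that is closed, up to linear combinations, under all derivations consists of `0`. -/
theorem eq_zero_of_dK {S : Set (KPS p k n)} (h0 : ∀ f ∈ S, MvPowerSeries.constantCoeff f = 0)
    (hS : ∀ f ∈ S, ∀ j, dK p k n j f ∈ Ideal.span S) : ∀ f ∈ S, f = 0 := by
  have key (d : ℕ) : ∀ f ∈ S, ∀ m : Fin n →₀ ℕ, m.degree ≤ d → MvPowerSeries.coeff m f = 0 := by
    induction d with
    | zero =>
      intro f hf m hm
      rw [(Finsupp.degree_eq_zero_iff m).1 (Nat.le_zero.1 hm)]
      exact h0 f hf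
    | succ d ih =>
      have ext : ∀ f ∈ Ideal.span S, ∀ m : Fin n →₀ ℕ, m.degree ≤ d →
          MvPowerSeries.coeff m f = 0 := by
        intro f hf
        induction hf using Submodule.span_induction with
        | mem f hf => exact ih f hf
        | zero => exact fun m _ => map_zero _
        | add f g _ _ hf hg =>
          intro m hm
          rw [map_add, hf m hm, hg m hm, add_zero]
        | smul a f _ hf =>
          intro m hm
          rw [smul_eq_mul, MvPowerSeries.coeff_mul]
          refine Finset.sum_eq_zero fun x hx => ?_
          rw [Finset.HasAntidiagonal.mem_antidiagonal] at hx
          rw [hf x.2, mul_zero]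
          rw [← hx, map_add] at hm
          omega
      intro f hf m hm
      by_cases hm0 : m = 0
      · rw [hm0]
        exact h0 f hf
      · obtain ⟨m', j, rfl⟩ := FCrystal.exists_eq_add_single hm0
        have h1 := ext _ (hS f hf j) m' (by
          rw [map_add, Finsupp.degree_single] at hm
          omega)
        rw [coeff_dK] at h1
        exact (mul_eq_zero.1 h1).resolve_right (Nat.cast_add_one_ne_zero _)
  exact fun f hf => MvPowerSeries.ext fun m => key m.degree f hf m le_rfl

variable [PerfectRing k p]

/-- The standard lift of Frobenius on `K[[t]]`. -/
def frobKPS : KPS p k n →+* KPS p k n :=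
  (MvPowerSeries.expand p (Fact.out : p.Prime).ne_zero).toRingHom.comp (MvPowerSeries.map frobK)

theorem coeff_frobKPS_smul (f : KPS p k n) (m : Fin n →₀ ℕ) :
    MvPowerSeries.coeff (p • m) (frobKPS f) = frobK (MvPowerSeries.coeff m f) :=
  (MvPowerSeries.coeff_expand_smul p (Fact.out : p.Prime).ne_zero _ m).trans
    (MvPowerSeries.coeff_map _ _ _)

theorem coeff_frobKPS_of_not_dvd (f : KPS p k n) {m : Fin n →₀ ℕ} {i : Fin n} (h : ¬ p ∣ m i) :
    MvPowerSeries.coeff m (frobKPS f) = 0 :=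
  MvPowerSeries.coeff_expand_of_not_dvd p (Fact.out : p.Prime).ne_zero _ h

/-- The chain rule for t_j ↦ t_j^p. It is checked on coefficients; both sides live on the exponents
m for which p divides every entry of m + `single j 1`. -/
theorem dK_frobKPS (j : Fin n) (f : KPS p k n) : dK p k n j (frobKPS f) =
    toKPS p k n ((p : PS p k n) * MvPowerSeries.X j ^ (p - 1)) * frobKPS (dK p k n j f) := by
  have hp1 : p - 1 + 1 = p := Nat.sub_add_cancel (Fact.out : p.Prime).one_le
  refine MvPowerSeries.ext fun m => ?_
  have h0 : toKPS p k n ((p : PS p k n) * MvPowerSeries.X j ^ (p - 1)) =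
      (p : KPS p k n) * MvPowerSeries.monomial (Finsupp.single j (p - 1)) (1 : K) := by
    rw [map_mul, map_natCast, map_pow, toKPS, MvPowerSeries.map_X, MvPowerSeries.X_pow_eq]
  rw [h0, coeff_dK, mul_assoc, ← nsmul_eq_mul, map_nsmul, MvPowerSeries.coeff_monomial_mul, one_mul]
  by_cases hm : ∀ i, p ∣ (m + Finsupp.single j 1 : Fin n →₀ ℕ) i
  · obtain ⟨q, hq⟩ : ∃ q : Fin n →₀ ℕ, m + Finsupp.single j 1 = p • q := by
      choose q hq using hm
      refine ⟨Finsupp.equivFunOnFinite.symm q, Finsupp.ext fun i => ?_⟩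
      rw [hq]
      simp
    have hqj : m j + 1 = p * q j := by
      have := DFunLike.congr_fun hq j
      simpa using this
    have hqj0 : q j ≠ 0 := by
      intro h0
      rw [h0, mul_zero] at hqj
      omega
    obtain ⟨l, rfl⟩ : ∃ l, q = l + Finsupp.single j 1 :=
      ⟨q - Finsupp.single j 1, (tsub_add_cancel_of_le
        (Finsupp.single_le_iff.2 (Nat.one_le_iff_ne_zero.2 hqj0))).symm⟩
    have hm' : m = p • l + Finsupp.single j (p - 1) := by
      refine add_right_cancel (b := Finsupp.single j 1) ?_
      rw [hq, add_assoc, ← Finsupp.single_add, hp1, smul_add, Finsupp.smul_single, smul_eq_mul,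
        mul_one]
    rw [hq, coeff_frobKPS_smul, if_pos (by rw [hm']; exact le_add_self),
      show m - Finsupp.single j (p - 1) = p • l by rw [hm', add_tsub_cancel_right],
      coeff_frobKPS_smul, coeff_dK, map_mul, map_add, map_natCast, map_one, nsmul_eq_mul]
    have h2 : (m j : K) + 1 = p * (l j + 1) := by
      rw [← Nat.cast_add_one, hqj]
      simp
    rw [h2]
    ring
  · push Not at hm
    obtain ⟨i, hi⟩ := hm
    rw [coeff_frobKPS_of_not_dvd f hi, zero_mul]
    split_ifs with hle
    · rw [coeff_frobKPS_of_not_dvd (i := i), nsmul_zero]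
      intro h
      apply hi
      have h1 : m + Finsupp.single j 1 = m - Finsupp.single j (p - 1) + p • Finsupp.single j 1 := by
        rw [Finsupp.smul_single, smul_eq_mul, mul_one]
        conv_rhs => rw [← hp1, Finsupp.single_add, ← add_assoc, hp1, tsub_add_cancel_of_le hle]
      rw [h1, Finsupp.add_apply, Finsupp.smul_apply, smul_eq_mul]
      exact dvd_add h (dvd_mul_right _ _)
    · rw [nsmul_zero]

theorem constantCoeff_frobKPS (f : KPS p k n) : MvPowerSeries.constantCoeff (frobKPS f) =
    frobK (MvPowerSeries.constantCoeff f) := by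
  have := coeff_frobKPS_smul f 0
  rwa [smul_zero] at this

end Derivations

/-! ### Horizontal extension of functionals from the origin. -/

section TaylorSeries

variable {p : ℕ} [Fact p.Prime] {k : Type u} [Field k] [CharP k p] {n : ℕ}
variable {H : Type v} [AddCommGroup H] [Module (PS p k n) H]
  [Module.Free (PS p k n) H] [Module.Finite (PS p k n) H]

local notation "K" => FractionRing (WittVector p k)

namespace FCrystal

/-- The horizontal extension `∑ ℓ(D ^ m x) t ^ m / m!` of a functional `ℓ` on the fibre of `H` at
the origin. -/
def taylorSeries (C : FCrystal p k n H) (ℓ : H →+ K) (x : H) : KPS p k n :=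
  fun m => (mfact m : K)⁻¹ * ℓ (C.Dpow m x)

variable (C : FCrystal p k n H) (ℓ : H →+ FractionRing (WittVector p k))

theorem coeff_taylorSeries (x : H) (m : Fin n →₀ ℕ) :
    MvPowerSeries.coeff m (C.taylorSeries ℓ x) = (mfact m : K)⁻¹ * ℓ (C.Dpow m x) := rfl

theorem constantCoeff_taylorSeries (x : H) :
    MvPowerSeries.constantCoeff (C.taylorSeries ℓ x) = ℓ x := by
  have := C.coeff_taylorSeries ℓ x 0
  rw [Dpow_zero] at this
  simpa [mfact] using this

theorem taylorSeries_add (x y : H) :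
    C.taylorSeries ℓ (x + y) = C.taylorSeries ℓ x + C.taylorSeries ℓ y := by
  refine MvPowerSeries.ext fun m => ?_
  rw [map_add, coeff_taylorSeries, coeff_taylorSeries, coeff_taylorSeries, map_add, map_add,
    mul_add]

/-- Horizontality of the extended functional: shifting the index m by one cancels one factor of m!.
-/
theorem dK_taylorSeries (j : Fin n) (x : H) :
    dK p k n j (C.taylorSeries ℓ x) = C.taylorSeries ℓ (C.D j x) := by
  refine MvPowerSeries.ext fun m => ?_
  rw [coeff_dK, coeff_taylorSeries, coeff_taylorSeries, Dpow_add_single, mfact_add_single]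
  have h1 : (mfact m : K) ≠ 0 := Nat.cast_ne_zero.2 (mfact_ne_zero m)
  have h2 : (m j : K) + 1 ≠ 0 := Nat.cast_add_one_ne_zero _
  push_cast
  field_simp

/-- The defects of linearity, for all a and x together, have zero constant term, and the Leibniz
rule makes their derivatives sums of such defects; so they vanish. The other identities below are
carried over from the origin in the same way. -/
theorem taylorSeries_smul
    (hℓ : ∀ (a : PS p k n) (x : H),
      ℓ (a • x) = algebraMap _ K (MvPowerSeries.constantCoeff a) * ℓ x) (a : PS p k n) (x : H) :
    C.taylorSeries ℓ (a • x) = toKPS p k n a * C.taylorSeries ℓ x := by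
  have key := eq_zero_of_dK (S := Set.range fun q : PS p k n × H =>
    C.taylorSeries ℓ (q.1 • q.2) - toKPS p k n q.1 * C.taylorSeries ℓ q.2) ?_ ?_ _ ⟨(a, x), rfl⟩
  · exact sub_eq_zero.1 key
  · rintro _ ⟨⟨a, x⟩, rfl⟩
    rw [map_sub, map_mul, constantCoeff_taylorSeries, constantCoeff_taylorSeries, hℓ, toKPS,
      MvPowerSeries.constantCoeff_map, sub_self]
  · rintro _ ⟨⟨a, x⟩, rfl⟩ j
    have h1 := Ideal.subset_span (Set.mem_range_self (f := fun q : PS p k n × H =>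
      C.taylorSeries ℓ (q.1 • q.2) - toKPS p k n q.1 * C.taylorSeries ℓ q.2) (dA p k n j a, x))
    have h2 := Ideal.subset_span (Set.mem_range_self (f := fun q : PS p k n × H =>
      C.taylorSeries ℓ (q.1 • q.2) - toKPS p k n q.1 * C.taylorSeries ℓ q.2) (a, C.D j x))
    convert add_mem h1 h2 using 1
    simp only [dK_sub, dK_mul, dK_taylorSeries, dK_toKPS, C.leibniz, taylorSeries_add]
    ring

/-- The factor p t_j^{p-1} arises both from commuting D_j with the Frobenius of H and from the chain
rule in K[[t]], so the defects form a closed differential system. -/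
theorem taylorSeries_Φ₀ [PerfectRing k p]
    (hℓ : ∀ (a : PS p k n) (x : H),
      ℓ (a • x) = algebraMap _ K (MvPowerSeries.constantCoeff a) * ℓ x) (i : ℕ)
    (hℓΦ : ∀ x, ℓ (C.Φ₀ x) = (p : K) ^ i * frobK (ℓ x)) (x : H) :
    C.taylorSeries ℓ (C.Φ₀ x) = (p : KPS p k n) ^ i * frobKPS (C.taylorSeries ℓ x) := by
  have key := eq_zero_of_dK (S := Set.range fun x : H =>
    C.taylorSeries ℓ (C.Φ₀ x) - (p : KPS p k n) ^ i * frobKPS (C.taylorSeries ℓ x)) ?_ ?_ _ ⟨x, rfl⟩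
  · exact sub_eq_zero.1 key
  · rintro _ ⟨x, rfl⟩
    rw [map_sub, map_mul, constantCoeff_taylorSeries, constantCoeff_frobKPS,
      constantCoeff_taylorSeries, hℓΦ, map_pow, map_natCast, sub_self]
  · rintro _ ⟨x, rfl⟩ j
    have h1 := Ideal.subset_span (Set.mem_range_self (f := fun x : H =>
      C.taylorSeries ℓ (C.Φ₀ x) - (p : KPS p k n) ^ i * frobKPS (C.taylorSeries ℓ x)) (C.D j x))
    convert Ideal.mul_mem_left _
      (toKPS p k n ((p : PS p k n) * MvPowerSeries.X j ^ (p - 1))) h1 using 1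
    rw [dK_sub, dK_natCast_pow_mul, dK_taylorSeries, dK_frobKPS, dK_taylorSeries, C.D_Φ_stdLift,
      C.taylorSeries_smul ℓ hℓ]
    ring

end FCrystal

end TaylorSeries

end CY3

end

noncomputable section

set_option linter.unusedSectionVars false

namespace CY3

open Matrix FCrystal

theorem transpose_mul_gram_mul_apply {R : Type*} [CommRing R] {h : ℕ}
    (X : Matrix (Idx h) (Idx h) R) (a b : Idx h) :
    (Xᵀ * (gram : Matrix (Idx h) (Idx h) R) * X) a b = ∑ c, X c a * (gramSign c * X (dual c) b) := by
  rw [← sum_gram (fun c => X c a) (fun c => X c b), Matrix.mul_assoc, Matrix.mul_apply]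
  rfl

theorem gram_mul_gram {R : Type*} [CommRing R] {h : ℕ} :
    (gram : Matrix (Idx h) (Idx h) R) * gram = -1 := by
  ext1 a b
  rw [Matrix.mul_apply, Finset.sum_eq_single (dual a), gram_apply, gram_apply, if_pos rfl,
    dual_dual, Matrix.neg_apply, Matrix.one_apply]
  · split_ifs with hab
    · rcases a with _ | _ | _ | _ <;> simp [gramSign, dual]
    · simp
  · intro c _ hc
    rw [gram_apply, if_neg hc.symm, zero_mul]
  · simp

theorem isUnit_det_of_transpose_mul_gram_mul {R : Type*} [CommRing R] {h : ℕ}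
    {X : Matrix (Idx h) (Idx h) R}
    (hX : Xᵀ * (gram : Matrix (Idx h) (Idx h) R) * X = gram) : IsUnit X.det := by
  refine Matrix.isUnit_det_of_left_inverse (B := -(gram * (Xᵀ * gram))) ?_
  rw [Matrix.neg_mul, Matrix.mul_assoc, hX, gram_mul_gram, neg_neg]

/-! ### The period functionals of an ordinary CY3 crystal. -/

section Periods

variable {p : ℕ} [Fact p.Prime] {k : Type u} [Field k] [CharP k p] [IsAlgClosed k] {n h : ℕ}
variable {H : Type v} [AddCommGroup H] [Module (PS p k n) H]
  [Module.Free (PS p k n) H] [Module.Finite (PS p k n) H]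
variable {C : FCrystal p k n H} {𝓕 : HodgeFiltration C} {B : LinearMap.BilinForm (PS p k n) H}

local notation "K" => FractionRing (WittVector p k)

theorem form_eq_sum (e : Module.Basis (Idx h) (PS p k n) H)
    (he : (Matrix.of fun a b => B (e a) (e b)) = gram) (x y : H) :
    B x y = ∑ a, e.repr x a * (gramSign a * e.repr y (dual a)) := by
  conv_lhs => rw [← e.sum_repr x]
  rw [map_sum, LinearMap.sum_apply]
  refine Finset.sum_congr rfl fun a _ => ?_
  rw [map_smul, LinearMap.smul_apply, form_repr e he, smul_eq_mul]

/-- Evaluation at the origin. -/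
def evalOrigin (p : ℕ) [Fact p.Prime] (k : Type u) [Field k] [CharP k p] (n : ℕ) :
    PS p k n →+* FractionRing (WittVector p k) :=
  (algebraMap (WittVector p k) (FractionRing (WittVector p k))).comp MvPowerSeries.constantCoeff

theorem evalOrigin_stdLift (a : PS p k n) :
    evalOrigin p k n ((stdLift p k n).hom a) = frobK (evalOrigin p k n a) := by
  rw [evalOrigin, RingHom.comp_apply, RingHom.comp_apply, frobK_algebraMap, constantCoeff_stdLift]

namespace IsOrdinaryCY3

/-- Frobenius-eigenfunctionals on the fibre at the origin, over `K`. -/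
theorem exists_functionals (hC : IsOrdinaryCY3 C 𝓕 B h) (e : Module.Basis (Idx h) (PS p k n) H)
    (he : (Matrix.of fun a b => B (e a) (e b)) = gram)
    (hΦ : ∀ a b, deg b ≤ deg a →
      e.repr (C.Φ₀ (e b)) a = if a = b then (p : PS p k n) ^ deg b else 0) :
    ∃ ℓ : Idx h → H →+ K,
      (∀ c (a : PS p k n) (x : H), ℓ c (a • x) =
        algebraMap _ K (MvPowerSeries.constantCoeff a) * ℓ c x) ∧
      (∀ c x, ℓ c (C.Φ₀ x) = (p : K) ^ deg c * frobK (ℓ c x)) ∧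
      (∀ c b, deg b ≤ deg c → ℓ c (e b) = if c = b then 1 else 0) ∧
      ∀ x y, ∑ c, ℓ c x * (gramSign c * ℓ (dual c) y) = evalOrigin p k n (B x y) := by
  -- The matrix of the standard Frobenius on the fibre at the origin. The standard lift fixes the
  -- origin, where it induces σ.
  let Q : Matrix (Idx h) (Idx h) K :=
    Matrix.of fun a b => evalOrigin p k n (e.repr (C.Φ₀ (e b)) a)
  have hQ (a b : Idx h) (hab : deg b ≤ deg a) : Q a b = if a = b then (p : K) ^ deg b else 0 := by
    change evalOrigin p k n _ = _
    rw [hΦ a b hab]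
    split_ifs
    · rw [map_pow, map_natCast]
    · rw [map_zero]
  obtain ⟨T, hT, hTQ⟩ := exists_unipotent deg Q hQ
  have hQG : Qᵀ * gram * Q = (p : K) ^ 3 • gram := by
    ext1 a b
    have h1 := congrArg (evalOrigin p k n) (form_eq_sum e he (C.Φ₀ (e a)) (C.Φ₀ (e b)))
    have h2 : B (e a) (e b) = gram a b := by rw [← he]; rfl
    rw [hC.form_Φ, h2, map_mul, map_pow, map_natCast, evalOrigin_stdLift, map_sum] at h1
    have h3 : frobK (evalOrigin p k n ((gram : Matrix (Idx h) (Idx h) (PS p k n)) a b)) =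
        (gram : Matrix (Idx h) (Idx h) K) a b := by
      rw [gram_apply, gram_apply]
      split_ifs <;> simp
    rw [h3] at h1
    rw [transpose_mul_gram_mul_apply, Matrix.smul_apply, smul_eq_mul, h1]
    refine Finset.sum_congr rfl fun c _ => ?_
    rw [map_mul, map_mul, map_intCast]
    rfl
  have hTG : Tᵀ * gram * T = gram := by
    refine transpose_mul_gram_mul Q T hQ hQG hT ?_
    ext1 a b
    rw [hTQ, diagP, Matrix.diagonal_mul]
    rfl
  let v : H → Idx h → K := fun x b => evalOrigin p k n (e.repr x b)
  have hvadd (x y : H) : v (x + y) = v x + v y := by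
    funext b
    simp [v]
  refine ⟨fun c => AddMonoidHom.mk' (fun x => (T *ᵥ v x) c) fun x y => by
      rw [hvadd, Matrix.mulVec_add, Pi.add_apply], fun c a x => ?_, fun c x => ?_, fun c b hcb => ?_,
    fun x y => ?_⟩
  · have : v (a • x) = evalOrigin p k n a • v x := by
      funext b
      simp [v]
    change (T *ᵥ v (a • x)) c = _
    rw [this, Matrix.mulVec_smul]
    rfl
  · have h1 : v (C.Φ₀ x) = Q *ᵥ fun b => frobK (v x b) := by
      funext a
      change evalOrigin p k n (e.repr (C.Φ₀ x) a) = _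
      conv_lhs => rw [← e.sum_repr x, map_sum, map_sum, Finsupp.finsetSum_apply, map_sum]
      rw [Matrix.mulVec, dotProduct]
      refine Finset.sum_congr rfl fun b _ => ?_
      rw [map_smulₛₗ, map_smul, Finsupp.smul_apply, smul_eq_mul, map_mul, evalOrigin_stdLift,
        mul_comm]
      rfl
    change (T *ᵥ v (C.Φ₀ x)) c = (p : K) ^ deg c * frobK ((T *ᵥ v x) c)
    rw [h1, Matrix.mulVec_mulVec, Matrix.mulVec, dotProduct, Matrix.mulVec, dotProduct, map_sum,
      Finset.mul_sum]
    refine Finset.sum_congr rfl fun b _ => ?_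
    rw [hTQ, map_mul, mul_assoc]
  · change (T *ᵥ v (e b)) c = _
    have : v (e b) = Pi.single b 1 := by
      funext a
      simp only [v, Module.Basis.repr_self, Finsupp.single_apply, Pi.single_apply]
      simp only [eq_comm]
      split_ifs <;> simp
    rw [this, Matrix.mulVec_single_one]
    exact hT c b hcb
  · change ∑ c, (T *ᵥ v x) c * (gramSign c * (T *ᵥ v y) (dual c)) = _
    rw [← sum_gram, ← Matrix.vecMul_transpose, ← Matrix.dotProduct_mulVec, Matrix.mulVec_mulVec,
      Matrix.mulVec_mulVec, hTG, sum_gram, form_eq_sum e he, map_sum]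
    refine Finset.sum_congr rfl fun c _ => ?_
    rw [map_mul, map_mul, map_intCast]

variable (ℓ : Idx h → H →+ FractionRing (WittVector p k))

/-- The identity holds at the origin, and both sides satisfy the same Leibniz rule because the form
is horizontal. -/
theorem sum_taylorSeries (hC : IsOrdinaryCY3 C 𝓕 B h)
    (hℓ : ∀ x y, ∑ c, ℓ c x * (gramSign c * ℓ (dual c) y) = evalOrigin p k n (B x y)) (x y : H) :
    ∑ c, C.taylorSeries (ℓ c) x * (gramSign c * C.taylorSeries (ℓ (dual c)) y) =
      toKPS p k n (B x y) := by
  let f : H × H → KPS p k n := fun q =>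
    ∑ c, C.taylorSeries (ℓ c) q.1 * (gramSign c * C.taylorSeries (ℓ (dual c)) q.2) -
      toKPS p k n (B q.1 q.2)
  have key := eq_zero_of_dK (S := Set.range f) ?_ ?_ _ ⟨(x, y), rfl⟩
  · exact sub_eq_zero.1 key
  · rintro _ ⟨⟨x, y⟩, rfl⟩
    rw [map_sub, map_sum, toKPS, MvPowerSeries.constantCoeff_map, sub_eq_zero]
    refine Eq.trans (Finset.sum_congr rfl fun c _ => ?_) (hℓ x y)
    rw [map_mul, map_mul, constantCoeff_taylorSeries, constantCoeff_taylorSeries, map_intCast]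
  · rintro _ ⟨⟨x, y⟩, rfl⟩ j
    have h1 := Ideal.subset_span (Set.mem_range_self (f := f) (C.D j x, y))
    have h2 := Ideal.subset_span (Set.mem_range_self (f := f) (x, C.D j y))
    convert add_mem h1 h2 using 1
    have h3 (c : Idx h) : dK p k n j (C.taylorSeries (ℓ c) x *
        (gramSign c * C.taylorSeries (ℓ (dual c)) y)) =
        C.taylorSeries (ℓ c) (C.D j x) * (gramSign c * C.taylorSeries (ℓ (dual c)) y) +
        C.taylorSeries (ℓ c) x * (gramSign c * C.taylorSeries (ℓ (dual c)) (C.D j y)) := by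
      rw [dK_mul, dK_mul, dK_intCast, dK_taylorSeries, dK_taylorSeries]
      ring
    simp only [f, dK_sub, dK_sum, h3, dK_toKPS, ← hC.form_D, map_add, Finset.sum_add_distrib]
    ring

theorem taylorSeries_eq_sum (e : Module.Basis (Idx h) (PS p k n) H)
    (hsmul : ∀ c (a : PS p k n) (x : H), ℓ c (a • x) =
        algebraMap _ K (MvPowerSeries.constantCoeff a) * ℓ c x) (c : Idx h) (x : H) :
    C.taylorSeries (ℓ c) x =
      ∑ a, toKPS p k n (e.repr x a) * C.taylorSeries (ℓ c) (e a) := by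
  have h1 (s : Finset (Idx h)) (f : Idx h → H) : C.taylorSeries (ℓ c) (∑ a ∈ s, f a) =
      ∑ a ∈ s, C.taylorSeries (ℓ c) (f a) :=
    map_sum (AddMonoidHom.mk' (C.taylorSeries (ℓ c)) (C.taylorSeries_add (ℓ c))) f s
  conv_lhs => rw [← e.sum_repr x]
  rw [h1]
  exact Finset.sum_congr rfl fun a _ => C.taylorSeries_smul (ℓ c) (hsmul c) _ _

/-- D_j e_b involves only basis vectors e_a of degree deg b - 1 < deg c, for which the expected
value is 0. Hence the entries on and below the block diagonal form a closed differential system. -/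
theorem taylorSeries_eq (e : Module.Basis (Idx h) (PS p k n) H)
    (hD : ∀ j a b, deg a + 1 ≠ deg b → e.repr (C.D j (e b)) a = 0)
    (hsmul : ∀ c (a : PS p k n) (x : H), ℓ c (a • x) =
        algebraMap _ K (MvPowerSeries.constantCoeff a) * ℓ c x)
    (hℓ : ∀ c b, deg b ≤ deg c → ℓ c (e b) = if c = b then 1 else 0) (c b : Idx h)
    (hcb : deg b ≤ deg c) : C.taylorSeries (ℓ c) (e b) = if c = b then 1 else 0 := by
  have key := eq_zero_of_dK (S := {f | ∃ c b : Idx h, deg b ≤ deg c ∧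
    f = C.taylorSeries (ℓ c) (e b) - if c = b then 1 else 0}) ?_ ?_ _ ⟨c, b, hcb, rfl⟩
  · exact sub_eq_zero.1 key
  · rintro _ ⟨c, b, hcb, rfl⟩
    rw [map_sub, constantCoeff_taylorSeries, hℓ c b hcb]
    split_ifs <;> simp
  · rintro _ ⟨c, b, hcb, rfl⟩ j
    have h0 : dK p k n j (if c = b then 1 else 0) = 0 := by
      split_ifs
      · simpa using dK_intCast (p := p) (k := k) j 1
      · simpa using dK_intCast (p := p) (k := k) j 0
    rw [dK_sub, h0, sub_zero, dK_taylorSeries, taylorSeries_eq_sum ℓ e hsmul]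
    refine sum_mem fun a _ => ?_
    by_cases hab : deg a + 1 = deg b
    · refine Ideal.mul_mem_left _ _ (Ideal.subset_span ⟨c, a, by omega, ?_⟩)
      rw [if_neg (by rintro rfl; omega), sub_zero]
    · rw [hD j a b hab, map_zero, zero_mul]
      exact zero_mem _

end IsOrdinaryCY3

end Periods

end CY3

end

noncomputable section

set_option linter.unusedSectionVars false

namespace CY3

/-! ### The binomial theorem for multi-indices. -/

section MultiBinomial

variable {n : ℕ}

theorem prod_add_pow {R : Type*} [CommRing R] (u v : Fin n → R) (r : Fin n →₀ ℕ) :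
    ∏ j, (u j + v j) ^ r j = ∑ q ∈ Finset.HasAntidiagonal.antidiagonal r,
      ((∏ j, (r j).choose (q.1 j) : ℕ) : R) * ((∏ j, u j ^ q.1 j) * ∏ j, v j ^ q.2 j) := by
  classical
  simp_rw [fun j => (Commute.all (u j) (v j)).add_pow']
  rw [Finset.prod_univ_sum]
  refine Finset.sum_bij'
    (fun f _ => (Finsupp.equivFunOnFinite.symm fun j => (f j).1,
      Finsupp.equivFunOnFinite.symm fun j => (f j).2))
    (fun q _ j => (q.1 j, q.2 j)) ?_ ?_ ?_ ?_ ?_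
  · intro f hf
    rw [Finset.HasAntidiagonal.mem_antidiagonal]
    refine Finsupp.ext fun j => ?_
    exact Finset.HasAntidiagonal.mem_antidiagonal.1 (Fintype.mem_piFinset.1 hf j)
  · intro q hq
    rw [Fintype.mem_piFinset]
    intro j
    rw [Finset.HasAntidiagonal.mem_antidiagonal] at hq ⊢
    exact DFunLike.congr_fun hq j
  · intro f _
    rfl
  · intro q _
    ext <;> rfl
  · intro f _
    simp only [nsmul_eq_mul, Finset.prod_mul_distrib, Nat.cast_prod]
    rfl

theorem prod_choose_mul {r : Fin n →₀ ℕ} {q : (Fin n →₀ ℕ) × (Fin n →₀ ℕ)}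
    (hq : q ∈ Finset.HasAntidiagonal.antidiagonal r) :
    (∏ j, (r j).choose (q.1 j)) * mfact q.1 * mfact q.2 = mfact r := by
  rw [Finset.HasAntidiagonal.mem_antidiagonal] at hq
  rw [mfact, mfact, mfact, ← Finset.prod_mul_distrib, ← Finset.prod_mul_distrib]
  refine Finset.prod_congr rfl fun j _ => ?_
  have := Nat.choose_mul_factorial_mul_factorial (Nat.le_add_right (q.1 j) (q.2 j))
  rwa [Nat.add_sub_cancel_left, ← Finsupp.add_apply, hq] at this

end MultiBinomial

/-! ### Convergence of ψ(f) for the period series. -/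

section FrobImage

variable {p : ℕ} [Fact p.Prime] {k : Type u} [Field k] [CharP k p] [PerfectRing k p] {n : ℕ}
variable {H : Type v} [AddCommGroup H] [Module (PS p k n) H]
  [Module.Free (PS p k n) H] [Module.Finite (PS p k n) H]

local notation "K" => FractionRing (WittVector p k)

variable (p k) in
/-- The lattice `W(k)` of `K`. -/
abbrev wittLattice : AddSubgroup (FractionRing (WittVector p k)) :=
  (algebraMap (WittVector p k) (FractionRing (WittVector p k))).toAddMonoidHom.range

theorem mul_mem_wittLattice {x y : K} (hx : x ∈ wittLattice p k) (hy : y ∈ wittLattice p k) :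
    x * y ∈ wittLattice p k := by
  obtain ⟨a, rfl⟩ := hx
  obtain ⟨b, rfl⟩ := hy
  exact ⟨a * b, map_mul (algebraMap (WittVector p k) K) a b⟩

theorem frobK_mem_wittLattice {x : K} (hx : x ∈ wittLattice p k) : frobK x ∈ wittLattice p k := by
  obtain ⟨a, rfl⟩ := hx
  exact ⟨WittVector.frobenius a, (frobK_algebraMap a).symm⟩

theorem pow_mem_wittLattice (N : ℕ) : (p : K) ^ N ∈ wittLattice p k :=
  ⟨(p : WittVector p k) ^ N, by
    change algebraMap (WittVector p k) K ((p : WittVector p k) ^ N) = _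
    rw [map_pow, map_natCast]⟩

theorem coeff_toKPS_mem (a : PS p k n) (d : Fin n →₀ ℕ) :
    MvPowerSeries.coeff d (toKPS p k n a) ∈ wittLattice p k :=
  ⟨MvPowerSeries.coeff d a,
    (MvPowerSeries.coeff_map (algebraMap (WittVector p k) K) _ _).symm⟩

theorem pow_mul_mem_of_le {x : K} {N M : ℕ} (hx : (p : K) ^ N * x ∈ wittLattice p k) (h : N ≤ M) :
    (p : K) ^ M * x ∈ wittLattice p k := by
  rw [← Nat.sub_add_cancel h, pow_add, mul_assoc]
  exact mul_mem_wittLattice (pow_mem_wittLattice _) hx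

/-- The coefficients of `frobKPS f * g`. -/
theorem coeff_mul_frobKPS (f g : KPS p k n) (d : Fin n →₀ ℕ) :
    MvPowerSeries.coeff d (g * frobKPS f) = ∑ l ∈ Finset.Iic d,
      frobK (MvPowerSeries.coeff l f) *
        MvPowerSeries.coeff d (MvPowerSeries.monomial (p • l) 1 * g) := by
  classical
  have hp := (Fact.out : p.Prime).ne_zero
  have hinj {l l' : Fin n →₀ ℕ} (h : p • l = p • l') : l = l' := by
    refine Finsupp.ext fun i => ?_
    have := DFunLike.congr_fun h i
    exact Nat.eq_of_mul_eq_mul_left (Nat.pos_of_ne_zero hp) this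
  have hle {l : Fin n →₀ ℕ} : l ≤ p • l := fun i => Nat.le_mul_of_pos_left _ (Nat.pos_of_ne_zero hp)
  rw [mul_comm, MvPowerSeries.coeff_mul]
  simp only [MvPowerSeries.coeff_monomial_mul, one_mul, mul_ite, mul_zero]
  rw [← Finset.sum_filter]
  symm
  refine Finset.sum_of_injOn (fun l => (p • l, d - p • l)) ?_ ?_ ?_ ?_
  · intro l _ l' _ h
    exact hinj (congrArg Prod.fst h)
  · intro l hl
    rw [Finset.mem_coe, Finset.mem_filter] at hl
    rw [Finset.mem_coe, Finset.HasAntidiagonal.mem_antidiagonal]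
    exact add_tsub_cancel_of_le hl.2
  · rintro ⟨a, b⟩ hab hnot
    rw [Finset.HasAntidiagonal.mem_antidiagonal] at hab
    by_cases ha : ∀ i, p ∣ a i
    · exfalso
      choose c hc using ha
      have hac : a = p • Finsupp.equivFunOnFinite.symm c := Finsupp.ext fun i => by
        rw [hc i]; rfl
      refine hnot ⟨Finsupp.equivFunOnFinite.symm c, ?_, ?_⟩
      · rw [Finset.mem_coe, Finset.mem_filter, Finset.mem_Iic, ← hac, ← hab]
        have h1 : Finsupp.equivFunOnFinite.symm c ≤ a := by
          rw [hac]
          exact hle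
        exact ⟨h1.trans le_self_add, le_self_add⟩
      · simp only [← hac, ← hab, add_tsub_cancel_left]
    · push Not at ha
      obtain ⟨i, hi⟩ := ha
      rw [coeff_frobKPS_of_not_dvd f hi, zero_mul]
  · intro l _
    rw [coeff_frobKPS_smul]

/-- Rearrangement of a `p`-adically convergent double series. -/
theorem hasPadicSum_antidiagonal (d : Fin n →₀ ℕ) (a : (Fin n →₀ ℕ) × (Fin n →₀ ℕ) → K) (s : K)
    (hd : ∀ q, ¬ q.1 ≤ d → a q = 0)
    (hs : HasPadicSum p (wittLattice p k) (fun m => ∑ l ∈ Finset.Iic d, a (l, m)) s)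
    (ha : ∀ N, ∃ M : Finset (Fin n →₀ ℕ), ∀ l ≤ d, ∀ m ∉ M, ∃ y ∈ wittLattice p k,
      a (l, m) = p ^ N • y) :
    HasPadicSum p (wittLattice p k) (fun r => ∑ q ∈ Finset.HasAntidiagonal.antidiagonal r, a q) s := by
  classical
  intro N
  obtain ⟨S, hS⟩ := hs N
  obtain ⟨M, hM⟩ := ha N
  obtain ⟨y, hy, hsy⟩ := hS (S ∪ M) Finset.subset_union_left
  -- Once R contains all sums of indices in this rectangle, its antidiagonals cover the rectangle,
  -- and every further term is divisible by p^N.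
  refine ⟨(Finset.Iic d ×ˢ (S ∪ M)).image fun q => q.1 + q.2, fun R hR => ?_⟩
  have hsub : Finset.Iic d ×ˢ (S ∪ M) ⊆ R.biUnion Finset.HasAntidiagonal.antidiagonal := by
    intro q hq
    rw [Finset.mem_biUnion]
    exact ⟨q.1 + q.2, hR (Finset.mem_image_of_mem _ hq), by
      rw [Finset.HasAntidiagonal.mem_antidiagonal]⟩
  have hsum : ∑ r ∈ R, ∑ q ∈ Finset.HasAntidiagonal.antidiagonal r, a q =
      ∑ q ∈ R.biUnion Finset.HasAntidiagonal.antidiagonal, a q := by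
    rw [Finset.sum_biUnion]
    intro r _ r' _ hrr'
    rw [Function.onFun, Finset.disjoint_left]
    intro q hq hq'
    rw [Finset.HasAntidiagonal.mem_antidiagonal] at hq hq'
    exact hrr' (hq.symm.trans hq')
  have hrest : ∃ z ∈ wittLattice p k,
      ∑ q ∈ R.biUnion Finset.HasAntidiagonal.antidiagonal \ (Finset.Iic d ×ˢ (S ∪ M)), a q = p ^ N • z := by
    have : ∀ q ∈ R.biUnion Finset.HasAntidiagonal.antidiagonal \ (Finset.Iic d ×ˢ (S ∪ M)),
        ∃ y ∈ wittLattice p k, a q = p ^ N • y := by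
      intro q hq
      by_cases hqd : q.1 ≤ d
      · refine hM q.1 hqd q.2 fun hqM => ?_
        rw [Finset.mem_sdiff, Finset.mem_product] at hq
        exact hq.2 ⟨Finset.mem_Iic.2 hqd, Finset.mem_union_right _ hqM⟩
      · exact ⟨0, zero_mem _, by rw [hd q hqd, nsmul_zero]⟩
    choose! y hy hay using this
    exact ⟨∑ q ∈ R.biUnion Finset.HasAntidiagonal.antidiagonal \ (Finset.Iic d ×ˢ (S ∪ M)), y q, sum_mem hy, by
      rw [Finset.sum_congr rfl hay, Finset.sum_nsmul]⟩
  obtain ⟨z, hz, hrz⟩ := hrest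
  refine ⟨y - z, sub_mem hy hz, ?_⟩
  rw [hsum, ← Finset.sum_sdiff hsub, hrz, nsmul_sub, ← hsy, Finset.sum_product_right]
  abel

namespace FCrystal

variable (C : FCrystal p k n H)

theorem Dpow_add (l m : Fin n →₀ ℕ) (x : H) : C.Dpow (l + m) x = C.Dpow l (C.Dpow m x) := by
  induction hd : m.degree generalizing m x with
  | zero =>
    rw [(Finsupp.degree_eq_zero_iff m).1 hd, add_zero, Dpow_zero]
    rfl
  | succ d ih =>
    obtain ⟨m', j, rfl⟩ := exists_eq_add_single (m := m) (by
      rintro rfl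
      simp at hd)
    rw [← add_assoc, Dpow_add_single, Dpow_add_single]
    refine ih m' _ ?_
    rw [map_add, Finsupp.degree_single] at hd
    omega

theorem Dpow_single (j : Fin n) (t : ℕ) (x : H) :
    C.Dpow (Finsupp.single j t) x = (C.D j ^ t) x := by
  induction t generalizing x with
  | zero =>
    rw [Finsupp.single_zero, Dpow_zero, pow_zero]
  | succ t ih =>
    rw [Finsupp.single_add, Dpow_add_single, ih, pow_succ]
    rfl

/-- Outside a finite box some exponent m_j exceeds the bound for D_j, and the commuting operators
let D_j^{m_j} act first. -/
theorem exists_Dpow_eq (N : ℕ) : ∃ M : Finset (Fin n →₀ ℕ), ∀ m ∉ M, ∀ x : H,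
    ∃ y, C.Dpow m x = p ^ N • y := by
  choose M hM using fun j => C.nilpotent j N
  refine ⟨Finset.Iic (Finsupp.equivFunOnFinite.symm M), fun m hm x => ?_⟩
  obtain ⟨j, hj⟩ : ∃ j, M j < m j := by
    rw [Finset.mem_Iic] at hm
    by_contra! h
    exact hm h
  obtain ⟨y, hy⟩ := hM j (m j) hj.le x
  have hm' : m = m.erase j + Finsupp.single j (m j) := (Finsupp.erase_add_single j m).symm
  refine ⟨C.Dpow (m.erase j) y, ?_⟩
  conv_lhs => rw [hm', Dpow_add, Dpow_single, hy, map_nsmul]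

variable (ℓ : H →+ FractionRing (WittVector p k))

/-- The functional is determined by its finitely many values on a basis, so its denominators are
bounded on H. This lets it be applied to p-adically convergent sums. -/
theorem exists_bound {ι : Type*} [Fintype ι] (e : Module.Basis ι (PS p k n) H)
    (hℓ : ∀ (a : PS p k n) (x : H),
      ℓ (a • x) = algebraMap _ K (MvPowerSeries.constantCoeff a) * ℓ x) :
    ∃ N, ∀ x, (p : K) ^ N * ℓ x ∈ wittLattice p k := by
  choose N w hN using fun a => exists_pow_mul_eq (ℓ (e a))
  refine ⟨Finset.univ.sup N, fun x => ?_⟩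
  conv => rw [← e.sum_repr x, map_sum, Finset.mul_sum]
  refine sum_mem fun a _ => ?_
  rw [hℓ, mul_left_comm]
  refine mul_mem_wittLattice ⟨_, rfl⟩ (pow_mul_mem_of_le (N := N a) ⟨w a, (hN a).symm⟩ ?_)
  exact Finset.le_sup (Finset.mem_univ a)

theorem exists_bound_coeff {ι : Type*} [Fintype ι] (e : Module.Basis ι (PS p k n) H)
    (hℓ : ∀ (a : PS p k n) (x : H),
      ℓ (a • x) = algebraMap _ K (MvPowerSeries.constantCoeff a) * ℓ x) (d : Fin n →₀ ℕ) :
    ∃ N, ∀ x, (p : K) ^ N * MvPowerSeries.coeff d (C.taylorSeries ℓ x) ∈ wittLattice p k := by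
  obtain ⟨N, hN⟩ := exists_bound ℓ e hℓ
  obtain ⟨M, w, hM⟩ := exists_pow_mul_eq ((mfact d : K)⁻¹)
  refine ⟨M + N, fun x => ?_⟩
  rw [coeff_taylorSeries, pow_add, mul_mul_mul_comm, hM]
  exact mul_mem_wittLattice ⟨w, rfl⟩ (hN _)

theorem taylorSeries_nsmul (N : ℕ) (x : H) :
    C.taylorSeries ℓ (N • x) = N • C.taylorSeries ℓ x :=
  map_nsmul (AddMonoidHom.mk' (C.taylorSeries ℓ) (C.taylorSeries_add ℓ)) N x

theorem taylorSeries_sum {ι : Type*} (s : Finset ι) (f : ι → H) :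
    C.taylorSeries ℓ (∑ i ∈ s, f i) = ∑ i ∈ s, C.taylorSeries ℓ (f i) :=
  map_sum (AddMonoidHom.mk' (C.taylorSeries ℓ) (C.taylorSeries_add ℓ)) f s

/-- The value of a lift of Frobenius at the Taylor series of a Frobenius-eigenfunctional. -/
theorem isFrobImage_taylorSeries {ι : Type*} [Fintype ι] (e : Module.Basis ι (PS p k n) H)
    (hℓ : ∀ (a : PS p k n) (x : H),
      ℓ (a • x) = algebraMap _ K (MvPowerSeries.constantCoeff a) * ℓ x) (i : ℕ)
    (hℓΦ : ∀ x, ℓ (C.Φ₀ x) = (p : K) ^ i * frobK (ℓ x)) (ψ : FrobLift p k n) (x : H)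
    (g : KPS p k n) (hg : C.taylorSeries ℓ (C.Φ ψ x) = (p : KPS p k n) ^ i * g) :
    IsFrobImage ψ (C.taylorSeries ℓ x) g := by
  intro d
  obtain ⟨c, hc, hsum⟩ := C.taylor ψ (stdLift p k n)
  have hX (j : Fin n) : (stdLift p k n).hom (MvPowerSeries.X j : PS p k n) =
      MvPowerSeries.X j ^ p := stdLift_X j
  let mon : (Fin n →₀ ℕ) → KPS p k n := fun l => MvPowerSeries.monomial (p • l) 1
  -- The index l belongs to the expansion in t^p and m to the Taylor formula comparing ψ with the
  -- standard lift.
  let a : (Fin n →₀ ℕ) × (Fin n →₀ ℕ) → K := fun q =>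
    frobK ((mfact q.1 : K)⁻¹ * ℓ (C.Dpow q.1 (C.Dpow q.2 x))) *
      MvPowerSeries.coeff d (mon q.1 * toKPS p k n (c q.2))
  -- Expand ψ(t)^r = (t^p + (ψ(t) - t^p))^r by the binomial theorem. The binomial coefficients with
  -- l! and m! combine to r!, which cancels the 1/r! of the Taylor coefficient.
  have hterm (r : Fin n →₀ ℕ) : frobK (MvPowerSeries.coeff r (C.taylorSeries ℓ x)) *
      MvPowerSeries.coeff d (toKPS p k n (∏ j, ψ.hom (MvPowerSeries.X j) ^ r j)) =
      ∑ q ∈ Finset.HasAntidiagonal.antidiagonal r, a q := by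
    have h1 : toKPS p k n (∏ j, ψ.hom (MvPowerSeries.X j) ^ r j) =
        ∑ q ∈ Finset.HasAntidiagonal.antidiagonal r, MvPowerSeries.C
          (((∏ j, (r j).choose (q.1 j) : ℕ) : K) * (mfact q.2 : K)) *
            (mon q.1 * toKPS p k n (c q.2)) := by
      have h2 (j : Fin n) : ψ.hom (MvPowerSeries.X j) = MvPowerSeries.X j ^ p +
          (ψ.hom (MvPowerSeries.X j) - (stdLift p k n).hom (MvPowerSeries.X j : PS p k n)) := by
        rw [hX]; ring
      rw [Finset.prod_congr rfl fun j _ => congrArg (· ^ r j) (h2 j), prod_add_pow, map_sum]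
      refine Finset.sum_congr rfl fun q _ => ?_
      rw [← hc, map_mul, map_mul, map_mul, map_natCast, map_natCast, map_mul, map_natCast,
        map_natCast]
      have h3 : toKPS p k n (∏ j, (MvPowerSeries.X j ^ p) ^ q.1 j) = mon q.1 := by
        rw [map_prod]
        simp only [mon, MvPowerSeries.monomial_one_eq]
        rw [Finsupp.prod_fintype _ _ fun j => pow_zero _]
        refine Finset.prod_congr rfl fun j _ => ?_
        rw [map_pow, map_pow, toKPS, MvPowerSeries.map_X, ← pow_mul]
        rfl
      rw [h3]
      change _ = ((∏ j, (r j).choose (q.1 j) : ℕ) : KPS p k n) * (mfact q.2 : KPS p k n) * _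
      rw [mfact]
      ring
    rw [h1, map_sum, Finset.mul_sum]
    refine Finset.sum_congr rfl fun q hq => ?_
    rw [MvPowerSeries.coeff_C_mul, ← mul_assoc]
    congr 1
    rw [coeff_taylorSeries, map_mul, map_mul, map_inv₀, map_inv₀, map_natCast, map_natCast,
      ← Dpow_add, Finset.HasAntidiagonal.mem_antidiagonal.1 hq]
    have hr : ((∏ j, (r j).choose (q.1 j) : ℕ) : K) * mfact q.1 * mfact q.2 = mfact r := by
      rw [← prod_choose_mul hq, Nat.cast_mul, Nat.cast_mul]
    have hr0 : (mfact r : K) ≠ 0 := Nat.cast_ne_zero.2 (mfact_ne_zero r)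
    have hq0 : (mfact q.1 : K) ≠ 0 := Nat.cast_ne_zero.2 (mfact_ne_zero q.1)
    field_simp
    linear_combination (frobK (ℓ (C.Dpow r x))) * hr
  have hd (q : (Fin n →₀ ℕ) × (Fin n →₀ ℕ)) (hq : ¬ q.1 ≤ d) : a q = 0 := by
    simp only [a, mon]
    rw [MvPowerSeries.coeff_monomial_mul, if_neg, mul_zero]
    exact fun h => hq (le_trans
      (fun j => Nat.le_mul_of_pos_left _ (Fact.out : p.Prime).pos) h)
  have key := hasPadicSum_antidiagonal d a (MvPowerSeries.coeff d g) hd ?_ ?_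
  · rw [← funext hterm] at key
    exact key
  · intro N
    obtain ⟨L, hL⟩ := C.exists_bound_coeff ℓ e hℓ d
    -- Of the precision i + N + L, the part i is lost in dividing by p^i and L in clearing the
    -- denominators of the d-th coefficient.
    obtain ⟨S, hS⟩ := hsum x (i + N + L)
    refine ⟨S, fun S' hS' => ?_⟩
    obtain ⟨y, -, hy⟩ := hS S' hS'
    refine ⟨_, hL y, ?_⟩
    have h1 (m : Fin n →₀ ℕ) : MvPowerSeries.coeff d (C.taylorSeries ℓ
        (c m • C.Φ (stdLift p k n) (C.Dpow m x))) =
        (p : K) ^ i * ∑ l ∈ Finset.Iic d, a (l, m) := by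
      rw [taylorSeries_smul C ℓ hℓ, C.taylorSeries_Φ₀ ℓ hℓ i hℓΦ, mul_left_comm, ← Nat.cast_pow,
        ← nsmul_eq_mul, map_nsmul, nsmul_eq_mul, Nat.cast_pow, coeff_mul_frobKPS]
      rfl
    have h2 := congrArg (fun z => MvPowerSeries.coeff d (C.taylorSeries ℓ z)) (sub_eq_iff_eq_add.1 hy)
    simp only [taylorSeries_add, taylorSeries_nsmul, taylorSeries_sum, map_add, map_nsmul,
      map_sum] at h2
    have h3 (s : Finset (Fin n →₀ ℕ)) : ∑ m ∈ s, MvPowerSeries.coeff d (C.taylorSeries ℓ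
        (c m • C.Φ (stdLift p k n) ((List.ofFn fun j => C.D j ^ m j).prod x))) =
        (p : K) ^ i * ∑ m ∈ s, ∑ l ∈ Finset.Iic d, a (l, m) := by
      rw [Finset.mul_sum]
      exact Finset.sum_congr rfl fun m _ => h1 m
    rw [h3, hg, ← Nat.cast_pow, ← nsmul_eq_mul, map_nsmul, nsmul_eq_mul, nsmul_eq_mul,
      Nat.cast_pow, Nat.cast_pow] at h2
    have hp := pow_ne_zero i (cast_p_ne_zero (p := p) (k := k))
    refine mul_left_cancel₀ hp ?_
    rw [mul_sub, h2, nsmul_eq_mul, Nat.cast_pow, pow_add, pow_add]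
    ring
  · intro N
    choose L hL using fun l => C.exists_bound_coeff ℓ e hℓ l
    -- The supremum absorbs the denominators of ℓ(D^l y) / l! uniformly for the finitely many l ≤ d.
    obtain ⟨M, hM⟩ := C.exists_Dpow_eq (N + (Finset.Iic d).sup L)
    refine ⟨M, fun l hl m hm => ?_⟩
    obtain ⟨y, hy⟩ := hM m hm x
    have h1 : (p : K) ^ ((Finset.Iic d).sup L) * ((mfact l : K)⁻¹ * ℓ (C.Dpow l y)) ∈
        wittLattice p k :=
      pow_mul_mem_of_le (hL l y) (Finset.le_sup (Finset.mem_Iic.2 hl))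
    have h2 : MvPowerSeries.coeff d (mon l * toKPS p k n (c m)) ∈ wittLattice p k := by
      have : mon l = toKPS p k n (MvPowerSeries.monomial (p • l) 1) := by
        rw [toKPS, MvPowerSeries.map_monomial, map_one]
      rw [this, ← map_mul]
      exact coeff_toKPS_mem _ _
    refine ⟨_, mul_mem_wittLattice (frobK_mem_wittLattice h1) h2, ?_⟩
    simp only [a]
    rw [hy, map_nsmul, map_nsmul, nsmul_eq_mul, nsmul_eq_mul, Nat.cast_pow, Nat.cast_pow, pow_add]
    simp only [map_mul, map_pow, map_natCast]
    ring

end FCrystal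

end FrobImage

end CY3

end

noncomputable section

set_option linter.unusedSectionVars false

namespace CY3

open Matrix FCrystal

/-! ### Block factorization of unipotent symplectic matrices. -/

section Factors

variable {R : Type*} [CommRing R] {h : ℕ}

/-- A unipotent symplectic matrix in terms of its blocks. -/
theorem exists_factors (T : Matrix (Idx h) (Idx h) R)
    (hT : ∀ a b, deg b ≤ deg a → T a b = if a = b then 1 else 0)
    (hG : Tᵀ * (gram : Matrix (Idx h) (Idx h) R) * T = gram) :
    ∃ (x y : Fin h → R) (w : Matrix (Fin h) (Fin h) R) (z : R),
      T = leftFactor x * rightFactor y w z ∧ (∀ i j, w i j = w j i) ∧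
      (∀ i, T (.inr (.inr (.inl i))) (.inr (.inr (.inr ()))) = x i) ∧
      (∀ i, T (.inr (.inl i)) (.inr (.inr (.inr ()))) = y i) ∧
      (∀ i j, T (.inr (.inl i)) (.inr (.inr (.inl j))) = w i j) ∧
      (∀ i, T (.inl ()) (.inr (.inr (.inl i))) = -y i + ∑ l, x l * w l i) ∧
      T (.inl ()) (.inr (.inr (.inr ()))) = z + ∑ l, x l * y l := by
  have key (a b : Idx h) : ∑ c, T c a * (gramSign c * T (dual c) b) = gram a b := by
    rw [← transpose_mul_gram_mul_apply, hG]
  have h00 : T (.inl ()) (.inl ()) = 1 := by rw [hT _ _ le_rfl, if_pos rfl]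
  have h33 : T (.inr (.inr (.inr ()))) (.inr (.inr (.inr ()))) = 1 := by
    rw [hT _ _ le_rfl, if_pos rfl]
  have h11 (i j : Fin h) : T (.inr (.inl i)) (.inr (.inl j)) = if i = j then 1 else 0 := by
    rw [hT _ _ (by simp [deg])]; simp
  have h22 (i j : Fin h) : T (.inr (.inr (.inl i))) (.inr (.inr (.inl j))) =
      if i = j then 1 else 0 := by
    rw [hT _ _ (by simp [deg])]; simp
  have h10 (i : Fin h) : T (.inr (.inl i)) (.inl ()) = 0 := by
    rw [hT _ _ (by simp [deg]), if_neg (by simp)]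
  have h20 (i : Fin h) : T (.inr (.inr (.inl i))) (.inl ()) = 0 := by
    rw [hT _ _ (by simp [deg]), if_neg (by simp)]
  have h30 : T (.inr (.inr (.inr ()))) (.inl ()) = 0 := by
    rw [hT _ _ (by simp [deg]), if_neg (by simp)]
  have h21 (i j : Fin h) : T (.inr (.inr (.inl i))) (.inr (.inl j)) = 0 := by
    rw [hT _ _ (by simp [deg]), if_neg (by simp)]
  have h31 (j : Fin h) : T (.inr (.inr (.inr ()))) (.inr (.inl j)) = 0 := by
    rw [hT _ _ (by simp [deg]), if_neg (by simp)]
  have h32 (j : Fin h) : T (.inr (.inr (.inr ()))) (.inr (.inr (.inl j))) = 0 := by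
    rw [hT _ _ (by simp [deg]), if_neg (by simp)]
  -- The block entries (1,3), (2,3) and (2,2) of TᵀGT = G: the first two express T₀₁ and T₀₂ through
  -- the other blocks, the last one is the symmetry of w.
  have e13 (i : Fin h) : T (.inr (.inr (.inl i))) (.inr (.inr (.inr ()))) =
      T (.inl ()) (.inr (.inl i)) := by
    have := key (.inr (.inl i)) (.inr (.inr (.inr ())))
    simp only [Fintype.sum_sum_type, Finset.univ_unique, Finset.sum_singleton, gramSign, dual,
      PUnit.default_eq_unit, h11, h21, h31, h33, gram_apply] at this
    simp at this
    linear_combination this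
  have e23 (i : Fin h) : T (.inl ()) (.inr (.inr (.inl i))) =
      -T (.inr (.inl i)) (.inr (.inr (.inr ()))) +
      ∑ l, T (.inl ()) (.inr (.inl l)) * T (.inr (.inl l)) (.inr (.inr (.inl i))) := by
    have := key (.inr (.inr (.inl i))) (.inr (.inr (.inr ())))
    simp only [Fintype.sum_sum_type, Finset.univ_unique, Finset.sum_singleton, gramSign, dual,
      PUnit.default_eq_unit, h22, h32, h33, e13, gram_apply] at this
    simp at this
    have h1 : ∑ l, T (.inl ()) (.inr (.inl l)) * T (.inr (.inl l)) (.inr (.inr (.inl i))) =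
        ∑ l, T (.inr (.inl l)) (.inr (.inr (.inl i))) * T (.inl ()) (.inr (.inl l)) :=
      Finset.sum_congr rfl fun l _ => mul_comm _ _
    rw [h1]
    linear_combination -this
  have e22 (i j : Fin h) : T (.inr (.inl i)) (.inr (.inr (.inl j))) =
      T (.inr (.inl j)) (.inr (.inr (.inl i))) := by
    have := key (.inr (.inr (.inl i))) (.inr (.inr (.inl j)))
    simp only [Fintype.sum_sum_type, Finset.univ_unique, Finset.sum_singleton, gramSign, dual,
      PUnit.default_eq_unit, h22, h32, gram_apply] at this
    simp at this
    linear_combination -this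
  refine ⟨fun i => T (.inl ()) (.inr (.inl i)), fun i => T (.inr (.inl i)) (.inr (.inr (.inr ()))),
    Matrix.of fun i j => T (.inr (.inl i)) (.inr (.inr (.inl j))),
    T (.inl ()) (.inr (.inr (.inr ()))) -
      ∑ l, T (.inl ()) (.inr (.inl l)) * T (.inr (.inl l)) (.inr (.inr (.inr ()))),
    ?_, fun i j => e22 i j, e13, fun _ => rfl, fun _ _ => rfl, e23, (sub_add_cancel _ _).symm⟩
  ext1 a b
  rcases a with _ | i | i | _ <;> rcases b with _ | j | j | _ <;>
    simp [Matrix.mul_apply, leftFactor, rightFactor, h00, h33, h11, h22, h10, h20, h30, h21,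
      h31, h32, e13, e23]

end Factors

/-! ### The prepotential. -/

section KodairaSpencer

variable {p : ℕ} [Fact p.Prime] {k : Type u} [Field k] [CharP k p] {n h : ℕ}

local notation "K" => FractionRing (WittVector p k)

/-- The prepotential: integration of the connection equation. -/
theorem prepotential (T : Matrix (Idx h) (Idx h) (KPS p k n))
    (N : Fin n → Matrix (Idx h) (Idx h) (KPS p k n))
    (hN : ∀ j a b, deg a + 1 ≠ deg b → N j a b = 0) (hdT : ∀ j, T.map (dK p k n j) = T * N j)
    (hT : ∀ a b, deg b ≤ deg a → T a b = if a = b then 1 else 0)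
    {x y : Fin h → KPS p k n} {w : Matrix (Fin h) (Fin h) (KPS p k n)} {z : KPS p k n}
    (hw : ∀ i j, w i j = w j i)
    (hx' : ∀ i, T (.inr (.inr (.inl i))) (.inr (.inr (.inr ()))) = x i)
    (hy' : ∀ i, T (.inr (.inl i)) (.inr (.inr (.inr ()))) = y i)
    (hw' : ∀ i j, T (.inr (.inl i)) (.inr (.inr (.inl j))) = w i j)
    (hu' : ∀ i, T (.inl ()) (.inr (.inr (.inl i))) = -y i + ∑ l, x l * w l i)
    (hz' : T (.inl ()) (.inr (.inr (.inr ()))) = z + ∑ l, x l * y l) :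
    (∀ i j, dK p k n j (x i) = N j (.inr (.inr (.inl i))) (.inr (.inr (.inr ())))) ∧
    ∀ G : Matrix (Fin n) (Fin h) (KPS p k n), jacobian x * G = 1 →
      (∀ i, y i = MvPowerSeries.C (-(1 / 2) : K) * dTau G i z) ∧
      ∀ i j, w i j = MvPowerSeries.C (-(1 / 2) : K) * dTau G i (dTau G j z) := by
  -- In the last column of dT = T N the only nonzero block of N is the one from degree 3 to degree
  -- 2, which will turn out to be dx.
  have key (j : Fin n) (a : Idx h) : dK p k n j (T a (.inr (.inr (.inr ())))) =
      ∑ l, T a (.inr (.inr (.inl l))) * N j (.inr (.inr (.inl l))) (.inr (.inr (.inr ()))) := by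
    have h1 := congrFun (congrFun (hdT j) a) (.inr (.inr (.inr ())))
    rw [Matrix.map_apply, Matrix.mul_apply] at h1
    rw [h1, Fintype.sum_sum_type, Fintype.sum_sum_type, Fintype.sum_sum_type]
    simp only [Finset.univ_unique, Finset.sum_singleton]
    rw [hN j (.inl _) _ (by simp [deg]), hN j (.inr (.inr (.inr _))) _ (by simp [deg]),
      Finset.sum_eq_zero fun l _ => by rw [hN j (.inr (.inl l)) _ (by simp [deg]), mul_zero]]
    simp
  have hx (i : Fin h) (j : Fin n) :
      dK p k n j (x i) = N j (.inr (.inr (.inl i))) (.inr (.inr (.inr ()))) := by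
    rw [← hx', key, Finset.sum_eq_single i]
    · rw [hT _ _ le_rfl, if_pos rfl, one_mul]
    · intro l _ hl
      rw [hT _ _ (by simp [deg]), if_neg (by simpa using hl.symm), zero_mul]
    · simp
  refine ⟨hx, fun G hG => ?_⟩
  have hy (i : Fin h) (j : Fin n) : dK p k n j (y i) = ∑ l, w i l * dK p k n j (x l) := by
    rw [← hy', key]
    exact Finset.sum_congr rfl fun l _ => by rw [hw', hx]
  -- The top entry gives d(z + x·y) = (-y + x w)·dx, while d(x·y) = x w dx + y·dx; the difference is
  -- -2 y·dx.
  have hz (j : Fin n) : dK p k n j z = -2 * ∑ l, y l * dK p k n j (x l) := by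
    have h1 := key j (.inl ())
    rw [hz', dK_add, dK_sum] at h1
    have h2 : ∑ l, dK p k n j (x l * y l) =
        ∑ l, ∑ m, x l * w l m * dK p k n j (x m) + ∑ l, y l * dK p k n j (x l) := by
      rw [← Finset.sum_add_distrib]
      refine Finset.sum_congr rfl fun l _ => ?_
      rw [dK_mul, hy, Finset.mul_sum]
      congr 1
      · exact Finset.sum_congr rfl fun m _ => by ring
      · ring
    have h3 : ∑ l, T (.inl ()) (.inr (.inr (.inl l))) *
        N j (.inr (.inr (.inl l))) (.inr (.inr (.inr ()))) =
        -∑ l, y l * dK p k n j (x l) + ∑ l, ∑ m, x l * w l m * dK p k n j (x m) := by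
      rw [Finset.sum_comm, ← Finset.sum_neg_distrib, ← Finset.sum_add_distrib]
      refine Finset.sum_congr rfl fun l _ => ?_
      rw [hu', hx, add_mul, Finset.sum_mul, neg_mul]
    rw [h2, h3] at h1
    linear_combination h1
  have hJ (i l : Fin h) : ∑ j, G j i * dK p k n j (x l) = if l = i then 1 else 0 := by
    have h1 := congrFun (congrFun hG l) i
    rw [Matrix.mul_apply, Matrix.one_apply] at h1
    rw [← h1]
    exact Finset.sum_congr rfl fun j _ => mul_comm _ _
  have hsum (i : Fin h) (f : KPS p k n) (c : KPS p k n) (g : Fin h → KPS p k n)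
      (hf : ∀ j, dK p k n j f = c * ∑ l, g l * dK p k n j (x l)) : dTau G i f = c * g i := by
    rw [dTau]
    calc ∑ j, G j i * dK p k n j f = c * ∑ l, g l * ∑ j, G j i * dK p k n j (x l) := by
          simp only [hf, Finset.mul_sum]
          rw [Finset.sum_comm]
          refine Finset.sum_congr rfl fun l _ => Finset.sum_congr rfl fun j _ => by ring
      _ = c * g i := by simp [hJ]
  have hC2 : MvPowerSeries.C (-(1 / 2) : K) * (-2 : KPS p k n) = 1 := by
    have h2 : (2 : KPS p k n) = MvPowerSeries.C (2 : K) := (map_ofNat _ 2).symm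
    rw [h2, ← map_neg, ← map_mul]
    norm_num
  have hzy (i : Fin h) : dTau G i z = -2 * y i := hsum i z (-2) y hz
  refine ⟨fun i => ?_, fun i j => ?_⟩
  · rw [hzy, ← mul_assoc, hC2, one_mul]
  · have h1 : dTau G i (dTau G j z) = -2 * w j i := by
      rw [hzy]
      refine hsum i _ (-2) (fun l => w j l) fun m => ?_
      have h2 : dK p k n m (-2 : KPS p k n) = 0 := by
        simpa using dK_intCast (p := p) (k := k) m (-2)
      rw [dK_mul, h2, zero_mul, add_zero, hy]
    rw [h1, ← mul_assoc, hC2, one_mul, hw]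

end KodairaSpencer

end CY3

end

noncomputable section

set_option linter.unusedSectionVars false

namespace CY3

open Matrix FCrystal

/-! ### The Kodaira–Spencer map in coordinates. -/

section KodairaSpencerMatrix

variable {p : ℕ} [Fact p.Prime] {k : Type u} [Field k] [CharP k p] [IsAlgClosed k] {n h : ℕ}
variable {H : Type v} [AddCommGroup H] [Module (PS p k n) H]
  [Module.Free (PS p k n) H] [Module.Finite (PS p k n) H]
variable {C : FCrystal p k n H} {𝓕 : HodgeFiltration C} {B : LinearMap.BilinForm (PS p k n) H}
variable {U : ℕ → Submodule (PS p k n) H}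

/-- The matrix of an isomorphic Kodaira–Spencer map is square and invertible. -/
theorem IsOrdinaryCY3.exists_inverse (hC : IsOrdinaryCY3 C 𝓕 B h)
    (e : Module.Basis (Idx h) (PS p k n) H) (he : ∀ a, e a ∈ U (deg a) ⊓ 𝓕.fil (deg a))
    (hB : (Matrix.of fun a b => B (e a) (e b)) = gram)
    (hKS : Function.Bijective 𝓕.kodairaSpencer)
    (M : Matrix (Fin h) (Fin n) (PS p k n))
    (hM : ∀ i j, M i j = e.repr (C.D j (e (.inr (.inr (.inr ()))))) (.inr (.inr (.inl i)))) :
    n = h ∧ ∃ M' : Matrix (Fin n) (Fin h) (PS p k n), M * M' = 1 ∧ M' * M = 1 := by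
  have he₃ : e (.inr (.inr (.inr ()))) ∈ 𝓕.fil 3 :=
    (he (.inr (.inr (.inr ())))).2
  have hfil (x : H) {i : ℕ} := hC.mem_fil_iff e he hB (i := i) (x := x)
  have hks (v : Fin n → PS p k n) (x : 𝓕.fil 3) (y : 𝓕.fil 2)
      (hy : (y : H) = ∑ j, v j • C.D j x) : 𝓕.kodairaSpencer v x =
        ((𝓕.fil 3).submoduleOf (𝓕.fil 2)).mkQ y := by
    change ∑ j, v j • ((𝓕.fil 3).submoduleOf (𝓕.fil 2)).mkQ _ = _
    simp only [← map_smul, ← map_sum]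
    congr 1
    ext
    rw [hy]
    simp
  have hmem (v : Fin n → PS p k n) (x : 𝓕.fil 3) : ∑ j, v j • C.D j x ∈ 𝓕.fil 2 :=
    sum_mem fun j _ => Submodule.smul_mem _ _ (𝓕.transversal 2 j x x.2)
  have hrepr (v : Fin n → PS p k n) (i : Fin h) :
      e.repr (∑ j, v j • C.D j (e (.inr (.inr (.inr ()))))) (.inr (.inr (.inl i))) =
        (M *ᵥ v) i := by
    rw [map_sum, Finsupp.finsetSum_apply, Matrix.mulVec, dotProduct]
    refine Finset.sum_congr rfl fun j _ => ?_
    rw [map_smul, Finsupp.smul_apply, smul_eq_mul, hM, mul_comm]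
  -- Fil^3 is free on the last basis vector, so a homomorphism on it is determined by one value,
  -- whose degree 2 coordinates for the vector field v are M v.
  have hspan (x : 𝓕.fil 3) : x = e.repr x (.inr (.inr (.inr ()))) •
      (⟨e (.inr (.inr (.inr ()))), he₃⟩ : 𝓕.fil 3) := by
    ext
    rw [Submodule.coe_smul]
    refine e.ext_elem fun a => ?_
    rw [map_smul, Finsupp.smul_apply, Module.Basis.repr_self, Finsupp.single_apply]
    split_ifs with ha
    · rw [← ha, smul_eq_mul, mul_one]
    · rw [smul_zero]
      refine (hfil x).1 x.2 a ?_
      rcases a with _ | _ | _ | _ <;> simp [deg] at ha ⊢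
  have hinj : Function.Injective M.mulVecLin := by
    rw [injective_iff_map_eq_zero]
    intro v hv
    refine (injective_iff_map_eq_zero 𝓕.kodairaSpencer).1 hKS.1 v ?_
    refine LinearMap.ext fun x => ?_
    rw [hspan x, map_smul, LinearMap.zero_apply, hks v _ ⟨_, hmem v _⟩ rfl,
      Submodule.mkQ_apply, (Submodule.Quotient.mk_eq_zero _).2, smul_zero]
    refine (hfil _).2 fun a ha => ?_
    rcases a with a | a | a | a
    · exact (hfil _).1 (hmem v ⟨_, he₃⟩) _ (by simp [deg])
    · exact (hfil _).1 (hmem v ⟨_, he₃⟩) _ (by simp [deg])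
    · exact (hrepr v a).trans (congrFun hv a)
    · simp [deg] at ha
  have hsurj : Function.Surjective M.mulVecLin := by
    intro w
    have hw : ∑ i, w i • e (.inr (.inr (.inl i))) ∈ 𝓕.fil 2 :=
      sum_mem fun i _ => Submodule.smul_mem _ _ (he (.inr (.inr (.inl i)))).2
    -- A preimage under Kodaira–Spencer of the homomorphism sending the last basis vector to the
    -- class of ∑ w_i e_i, the e_i of degree 2.
    obtain ⟨v, hv⟩ := hKS.2 (LinearMap.smulRight
      ((Finsupp.lapply (.inr (.inr (.inr ())))) ∘ₗ e.repr.toLinearMap ∘ₗ (𝓕.fil 3).subtype)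
      (((𝓕.fil 3).submoduleOf (𝓕.fil 2)).mkQ ⟨_, hw⟩))
    refine ⟨v, funext fun i => ?_⟩
    have h1 := LinearMap.congr_fun hv ⟨e (.inr (.inr (.inr ()))), he₃⟩
    rw [hks v _ ⟨_, hmem v _⟩ rfl, LinearMap.smulRight_apply] at h1
    have h2 : (Finsupp.lapply (.inr (.inr (.inr ()))) ∘ₗ e.repr.toLinearMap ∘ₗ
        (𝓕.fil 3).subtype) (⟨e (.inr (.inr (.inr ()))), he₃⟩ : 𝓕.fil 3) = (1 : PS p k n) := by
      simp
    rw [h2, one_smul, ← sub_eq_zero, ← map_sub, Submodule.mkQ_apply,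
      Submodule.Quotient.mk_eq_zero] at h1
    have h3 := (hfil _).1 (show ∑ j, v j • C.D j (e (.inr (.inr (.inr ())))) -
      ∑ i, w i • e (.inr (.inr (.inl i))) ∈ 𝓕.fil 3 from h1) (.inr (.inr (.inl i)))
      (by simp [deg])
    rw [map_sub, Finsupp.sub_apply, hrepr, sub_eq_zero] at h3
    rw [Matrix.mulVecLin_apply, h3, map_sum, Finsupp.finsetSum_apply, Finset.sum_eq_single i]
    · simp
    · intro l _ hl
      rw [map_smul, Finsupp.smul_apply, Module.Basis.repr_self, Finsupp.single_apply,
        if_neg (by simpa using hl), smul_zero]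
    · simp
  let E := LinearEquiv.ofBijective M.mulVecLin ⟨hinj, hsurj⟩
  refine ⟨by simpa using card_eq_of_linearEquiv _ E, LinearMap.toMatrix' E.symm.toLinearMap, ?_, ?_⟩
  · have h1 : M = LinearMap.toMatrix' E.toLinearMap := (LinearMap.toMatrix'_toLin' M).symm
    rw [h1, ← LinearMap.toMatrix'_comp, LinearEquiv.comp_symm, LinearMap.toMatrix'_id]
  · have h1 : M = LinearMap.toMatrix' E.toLinearMap := (LinearMap.toMatrix'_toLin' M).symm
    conv_lhs => rw [h1]
    rw [← LinearMap.toMatrix'_comp, LinearEquiv.symm_comp, LinearMap.toMatrix'_id]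

end KodairaSpencerMatrix

end CY3

end

theorem theorem2p2 (p : ℕ) [Fact p.Prime] (hp : 3 < p)
    (k : Type u) [Field k] [CharP k p] [IsAlgClosed k] (n h : ℕ)
    (H : Type v) [AddCommGroup H] [Module (CY3.PS p k n) H]
    [Module.Free (CY3.PS p k n) H] [Module.Finite (CY3.PS p k n) H]
    (C : CY3.FCrystal p k n H) (𝓕 : CY3.HodgeFiltration C)
    (B : LinearMap.BilinForm (CY3.PS p k n) H) (hC : CY3.IsOrdinaryCY3 C 𝓕 B h) :
    (∃ U, C.IsUnitRootFiltration U) ∧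
    ∀ U, C.IsUnitRootFiltration U →
      ∃ (e : Module.Basis (CY3.Idx h) (CY3.PS p k n) H)
        (T : Matrix (CY3.Idx h) (CY3.Idx h) (CY3.KPS p k n))
        (τ₂₃ τ₁₃ : Fin h → CY3.KPS p k n)
        (τ₁₂ : Matrix (Fin h) (Fin h) (CY3.KPS p k n)) (Z : CY3.KPS p k n),
        (∀ a, e a ∈ U (CY3.deg a) ⊓ 𝓕.fil (CY3.deg a)) ∧
        (Matrix.of fun a b => B (e a) (e b)) = CY3.gram ∧
        IsUnit T.det ∧
        (∀ j, CY3.connMatrix C e j = T⁻¹ * T.map (CY3.dK p k n j)) ∧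
        (∀ ψ : CY3.FrobLift p k n, ∃ ψT : Matrix (CY3.Idx h) (CY3.Idx h) (CY3.KPS p k n),
          (∀ a b, CY3.IsFrobImage ψ (T a b) (ψT a b)) ∧
          CY3.frobMatrix C e ψ = T⁻¹ * CY3.diagP p * ψT) ∧
        T = CY3.leftFactor τ₂₃ * CY3.rightFactor τ₁₃ τ₁₂ Z ∧
        (Function.Bijective 𝓕.kodairaSpencer →
          n = h ∧
          ∃ G : Matrix (Fin n) (Fin h) (CY3.KPS p k n),
            CY3.jacobian τ₂₃ * G = 1 ∧ G * CY3.jacobian τ₂₃ = 1 ∧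
            (∀ i, τ₁₃ i = MvPowerSeries.C (-(1 / 2) : FractionRing (WittVector p k)) * CY3.dTau G i Z) ∧
            ∀ i j, τ₁₂ i j =
              MvPowerSeries.C (-(1 / 2) : FractionRing (WittVector p k)) * CY3.dTau G i (CY3.dTau G j Z)) := by
  refine ⟨CY3.FCrystal.exists_isUnitRootFiltration hC.ordinary 𝓕, fun U hU => ?_⟩
  obtain ⟨e, he, hB, hD, hΦ⟩ := hC.exists_adapted_basis hU
  obtain ⟨ℓ, hℓ, hℓΦ, hℓe, hℓB⟩ := hC.exists_functionals e hB hΦ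
  let T : Matrix (CY3.Idx h) (CY3.Idx h) (CY3.KPS p k n) :=
    Matrix.of fun a b => C.taylorSeries (ℓ a) (e b)
  have hT (a b : CY3.Idx h) (hab : CY3.deg b ≤ CY3.deg a) : T a b = if a = b then 1 else 0 :=
    CY3.IsOrdinaryCY3.taylorSeries_eq ℓ e hD hℓ hℓe a b hab
  have hG : T.transpose * (CY3.gram : Matrix (CY3.Idx h) (CY3.Idx h) (CY3.KPS p k n)) * T =
      CY3.gram := by
    ext1 a b
    rw [CY3.transpose_mul_gram_mul_apply]
    refine (hC.sum_taylorSeries ℓ hℓB (e a) (e b)).trans ?_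
    rw [show B (e a) (e b) = CY3.gram a b by rw [← hB]; rfl]
    exact congrFun (congrFun (CY3.gram_map (CY3.toKPS p k n)) a) b
  have hdet : IsUnit T.det := CY3.isUnit_det_of_transpose_mul_gram_mul hG
  -- Since the functionals are A-linear, multiplying by T turns coordinates into periods. Applied to
  -- D_j e_b and to F(ψ) e_b, this reduces both matrix identities to statements about Taylor series.
  have hmul (x : CY3.Idx h → H) :
      T * (Matrix.of fun a b => CY3.toKPS p k n (e.repr (x b) a)) =
        Matrix.of fun a b => C.taylorSeries (ℓ a) (x b) := by
    ext1 a b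
    rw [Matrix.mul_apply, Matrix.of_apply, CY3.IsOrdinaryCY3.taylorSeries_eq_sum ℓ e hℓ]
    exact Finset.sum_congr rfl fun c _ => mul_comm _ _
  have hdT (j : Fin n) : T.map (CY3.dK p k n j) = T * CY3.connMatrix C e j := by
    rw [CY3.connMatrix, hmul]
    ext1 a b
    exact C.dK_taylorSeries (ℓ a) j (e b)
  obtain ⟨x, y, w, z, hfac, hw, hx', hy', hw', hu', hz'⟩ := CY3.exists_factors T hT hG
  refine ⟨e, T, x, y, w, z, he, hB, hdet, fun j => ?_, fun ψ => ?_, hfac, fun hKS => ?_⟩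
  · rw [hdT, Matrix.nonsing_inv_mul_cancel_left _ _ hdet]
  · have hp0 : (p : FractionRing (WittVector p k)) ≠ 0 := CY3.cast_p_ne_zero
    have hinv (i : ℕ) (f : CY3.KPS p k n) : (p : CY3.KPS p k n) ^ i *
        (MvPowerSeries.C ((p : FractionRing (WittVector p k)) ^ i)⁻¹ * f) = f := by
      rw [← mul_assoc, ← map_natCast (MvPowerSeries.C : FractionRing (WittVector p k) →+* _),
        ← map_pow, ← map_mul, mul_inv_cancel₀ (pow_ne_zero i hp0), map_one, one_mul]
    -- The candidate for ψ(T) is forced by T · F(ψ) = P · ψ(T): row a is the row of periods of F(ψ)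
    -- e_b divided by p^{deg a}.
    refine ⟨Matrix.of fun a b => MvPowerSeries.C ((p : FractionRing (WittVector p k)) ^
      CY3.deg a)⁻¹ * C.taylorSeries (ℓ a) (C.Φ ψ (e b)), fun a b => ?_, ?_⟩
    · exact C.isFrobImage_taylorSeries (ℓ a) e (hℓ a) (CY3.deg a) (hℓΦ a) ψ (e b) _
        (hinv _ _).symm
    · have h1 := hmul fun b => C.Φ ψ (e b)
      rw [Matrix.mul_assoc]
      rw [show CY3.frobMatrix C e ψ = T⁻¹ * (T * CY3.frobMatrix C e ψ) by
        rw [Matrix.nonsing_inv_mul_cancel_left _ _ hdet]]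
      congr 1
      refine h1.trans ?_
      ext1 a b
      rw [CY3.diagP, Matrix.diagonal_mul]
      exact (hinv _ _).symm
  · obtain ⟨hdx, hpre⟩ := CY3.prepotential T (CY3.connMatrix C e)
      (fun j a b hab => by
        change CY3.toKPS p k n _ = 0
        rw [hD j a b hab, map_zero]) hdT hT hw hx' hy' hw' hu' hz'
    obtain ⟨hnh, M', hM, hM'⟩ := hC.exists_inverse e he hB hKS
      (Matrix.of fun i j => e.repr (C.D j (e (.inr (.inr (.inr ()))))) (.inr (.inr (.inl i))))
      fun _ _ => rfl
    have hjac : CY3.jacobian x = (Matrix.of fun i j => e.repr (C.D j (e (.inr (.inr (.inr ())))))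
        (.inr (.inr (.inl i)))).map (CY3.toKPS p k n) := by
      ext1 i j
      exact hdx i j
    have h1 : CY3.jacobian x * M'.map (CY3.toKPS p k n) = 1 := by
      rw [hjac, ← Matrix.map_mul, hM, Matrix.map_one _ (map_zero _) (map_one _)]
    have h2 : M'.map (CY3.toKPS p k n) * CY3.jacobian x = 1 := by
      rw [hjac, ← Matrix.map_mul, hM', Matrix.map_one _ (map_zero _) (map_one _)]
    exact ⟨hnh, _, h1, h2, hpre _ h1⟩
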